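/- Let $\alpha\in(1/3,1/2)$, $T>0$, $d,p\ge 0$ integers, and let $\mathcal M$ be a compact metrizable $p$-dimensional foliated space modelled transversely on a locally compact, separable, metrizable space $\mathcal Z$: $\mathcal M$ is covered by foliated charts $\varphi=(y,z)\colon U\to B_1\times B_2$ (homeomorphisms, $B_1\subset\mathbb R^p$ open and connected, $B_2\subset\mathcal Z$ open) whose changes of charts are leafwise smooth, i.e. locally of the form $(y,z)\mapsto(f_1(y,z),f_2(z))$ with $f_2$ continuous and all $y$-derivatives of $f_1$ existing and jointly continuous in $(y,z)$. A plaque is a set $\varphi^{-1}(B_1\times\{z\})$, and the leaf $\mathcal L_m$ of $m$ consists of the points joined to $m$ by a finite chain of plaques, consecutive ones of which meet. A function (a vector field tangent to the leaves) is leafwise $C^k$ if in all foliated charts it (its components with respect to $\partial/\partial y^1,\dots,\partial/\partial y^p$) is $C^k$ in $y$ with all $y$-derivatives of order at most $k$ jointly continuous in $(y,z)$. Let $V_0,V_1,\dots,V_d$ be leafwise $C^3$ vector fields on $\mathcal M$. For $S\ge 0$ let $G\Omega_\alpha([0,S],\mathbb R^d)$ be the space of $\alpha$-Hölder geometric rough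 paths $\mathbf w=(\mathbf w^1,\mathbf w^2)$, the closure of the natural lifts of Lipschitz paths started at $0$ in the space of $\alpha$-Hölder rough paths with the distance $d_\alpha(\mathbf w,\hat{\mathbf w})=\max_{i=1,2}\sup_{0\le s<t\le S}|\mathbf w^i_{s,t}-\hat{\mathbf w}^i_{s,t}|/(t-s)^{i\alpha}$. A continuous path $x\colon[0,S]\to\mathcal M$ is a solution of $$dx_t=\sum_{i=1}^d V_i(x_t)\,dw^i_t+V_0(x_t)\,dt,\qquad x_0=m, \qquad (*)$$ driven by $\mathbf w$ if $x_0=m$ and, for every leafwise $C^3$ function $f\colon\mathcal M\to\mathbb R$, there is a constant $C$ such that for all $0\le s\le t\le S$ $$\Bigl|f(x_t)-f(x_s)-\sum_{i}V_if(x_s)\mathbf w^{1,i}_{s,t}-\sum_{j,k}V_jV_kf(x_s)\mathbf w^{2,jk}_{s,t}-V_0f(x_s)(t-s)\Bigr|\le C(t-s)^{3\alpha}.$$ For $S\in[0,T]$ and $\mathbf w\in G\Omega_\alpha([0,T],\mathbb R^d)$ the time reversal $\mathcal R_S\mathbf w\in G\Omega_\alpha([0,S],\mathbb R^d)$ is given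 by $(\mathcal R_S\mathbf w)^{1,i}_{s,t}=-\mathbf w^{1,i}_{S-t,S-s}$, $(\mathcal R_S\mathbf w)^{2,ij}_{s,t}=\mathbf w^{2,ji}_{S-t,S-s}$. Then: (1) For all $\mathbf w\in G\Omega_\alpha([0,T],\mathbb R^d)$ and $m\in\mathcal M$ equation $(*)$ on $[0,T]$ has a unique solution, denoted by $t\mapsto\Phi(m,\mathbf w)_t$; and for all $S\in[0,T]$ the equation on $[0,S]$ with $V_0$ replaced by $-V_0$, driven by $\mathcal R_S\mathbf w$, has a unique solution started at $m$, denoted by $t\mapsto\check\Phi(m,\mathcal R_S\mathbf w)_t$. (2) For every $S\in[0,T]$ and $\mathbf w\in G\Omega_\alpha([0,T],\mathbb R^d)$ the map $m\mapsto\Phi(m,\mathbf w)_S$ is a leaf preserving homeomorphism of $\mathcal M$ (that is, $\Phi(m,\mathbf w)_S\in\mathcal L_m$ for all $m$), it belongs to $\mathrm{Homeo}_L(\mathcal M)$, and its inverse is $m\mapsto\check\Phi(m,\mathcal R_S\mathbf w)_S$. (3) The map $\mathbf w\mapsto[t\mapsto\Phi(\bullet,\mathbf w)_t]$ is well defined and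 continuous from $G\Omega_\alpha([0,T],\mathbb R^d)$ to $C([0,T],\mathrm{Homeo}_L(\mathcal M))$ with the topology of uniform convergence. Here $\mathrm{Homeo}_L(\mathcal M)$ is the set of homeomorphisms $h$ of $\mathcal M$ such that $h$ and $h^{-1}$ map every leaf into a leaf, with the topology of uniform convergence of $h$ and of $h^{-1}$. -/

import Mathlib

/-! ## Leafwise regularity on products -/

/-- A function `f` on an open subset `U` of `E × W` (`E = ℝᵖ` the leaf direction, `W` the
transverse direction) is of class `C_L^k` if every slice `f (·, z)` is `C^k` and all leafwise
derivatives of order at most `k` are jointly continuous in `(y, z)`. -/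
def LeafwiseCkOn {E W G : Type*} [NormedAddCommGroup E] [NormedSpace ℝ E] [TopologicalSpace W]
    [NormedAddCommGroup G] [NormedSpace ℝ G] (k : ℕ) (f : E × W → G) (U : Set (E × W)) : Prop :=
  (∀ z : W, ContDiffOn ℝ k (fun y : E => f (y, z)) {y : E | (y, z) ∈ U}) ∧
  ∀ i : ℕ, i ≤ k →
    ContinuousOn (fun q : E × W => iteratedFDeriv ℝ i (fun y : E => f (y, q.2)) q.1) U

/-- A map between open subsets of products is leafwise smooth if it is locally of the form
`(y, z) ↦ (f₁ (y, z), f₂ z)` with `f₁` of class `C_L^k` for all `k` and `f₂` continuous. -/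
def LeafwiseSmoothMapOn {E W E' W' : Type*} [NormedAddCommGroup E] [NormedSpace ℝ E]
    [TopologicalSpace W] [NormedAddCommGroup E'] [NormedSpace ℝ E'] [TopologicalSpace W']
    (f : E × W → E' × W') (U : Set (E × W)) : Prop :=
  ∀ q ∈ U, ∃ O : Set (E × W), IsOpen O ∧ q ∈ O ∧ O ⊆ U ∧
    (∀ k : ℕ, LeafwiseCkOn k (fun r => (f r).1) O) ∧
    ∃ g : W → W', ContinuousOn g (Prod.snd '' O) ∧ ∀ r ∈ O, (f r).2 = g r.2

/-! ## Foliated spaces -/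

/-- A foliated atlas of dimension `p` on `M`, modelled transversely on `Z`: a family of
homeomorphisms from open sets covering `M` onto products `B₁ × B₂` with `B₁ ⊆ ℝᵖ` open and
connected and `B₂ ⊆ Z` open, with leafwise smooth changes of charts. -/
structure FoliatedAtlas (p : ℕ) (Z M : Type*) [TopologicalSpace Z] [TopologicalSpace M] where
  /-- the foliated charts -/
  charts : Set (OpenPartialHomeomorph M (EuclideanSpace ℝ (Fin p) × Z))
  exists_chart : ∀ m : M, ∃ φ ∈ charts, m ∈ φ.source
  target_eq_prod : ∀ φ ∈ charts, ∃ (B₁ : Set (EuclideanSpace ℝ (Fin p))) (B₂ : Set Z),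
    IsOpen B₁ ∧ IsConnected B₁ ∧ IsOpen B₂ ∧ φ.target = B₁ ×ˢ B₂
  leafwiseSmooth_transition : ∀ φ ∈ charts, ∀ ψ ∈ charts,
    LeafwiseSmoothMapOn (φ.symm.trans ψ) (φ.symm.trans ψ).source

namespace FoliatedAtlas

variable {p : ℕ} {Z M : Type*} [TopologicalSpace Z] [TopologicalSpace M]

/-- A plaque is a set `φ⁻¹ (B₁ × {z})` with `φ` a foliated chart and `z ∈ B₂`
(it is nonempty because `B₁` is). -/
def IsPlaque (𝓕 : FoliatedAtlas p Z M) (P : Set M) : Prop :=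
  P.Nonempty ∧ ∃ φ ∈ 𝓕.charts, ∃ z : Z, P = {x : M | x ∈ φ.source ∧ (φ x).2 = z}

/-- The leaf through `m`: all points that are joined to `m` by a finite nonempty chain of
plaques, consecutive ones of which meet. -/
def leaf (𝓕 : FoliatedAtlas p Z M) (m : M) : Set M :=
  {x : M | Relation.TransGen (fun a b : M => ∃ P : Set M, 𝓕.IsPlaque P ∧ a ∈ P ∧ b ∈ P) m x}

/-- A real function on `M` is leafwise `C^k` if it is of class `C_L^k` in all foliated charts. -/
def LeafwiseCk (𝓕 : FoliatedAtlas p Z M) (k : ℕ) (f : M → ℝ) : Prop :=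
  ∀ φ ∈ 𝓕.charts, LeafwiseCkOn k (fun q => f (φ.symm q)) φ.target

/-- A self-map of `M` is foliation preserving if it maps every leaf into some leaf. -/
def FoliationPreserving (𝓕 : FoliatedAtlas p Z M) (f : M → M) : Prop :=
  ∀ m : M, ∃ m' : M, f '' 𝓕.leaf m ⊆ 𝓕.leaf m'

/-- Some foliated chart around `m`. -/
noncomputable def chartAt (𝓕 : FoliatedAtlas p Z M) (m : M) :
    OpenPartialHomeomorph M (EuclideanSpace ℝ (Fin p) × Z) :=
  (𝓕.exists_chart m).choose

end FoliatedAtlas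

/-- A leafwise `C^k` vector field, a section of the bundle of tangent spaces of the leaves.
`comp φ (y, z)` is the vector of its components, in the foliated chart `φ`, with respect to
`∂/∂y¹, …, ∂/∂yᵖ`, at the point with coordinates `(y, z)`; components in two charts are related
by the leafwise derivative of the change of charts. (Only the values of `comp φ` on the target
of charts `φ` of the atlas matter.) -/
structure LeafwiseVectorField {p : ℕ} {Z M : Type*} [TopologicalSpace Z] [TopologicalSpace M]
    (𝓕 : FoliatedAtlas p Z M) (k : ℕ) where
  /-- components in a chart -/
  comp : OpenPartialHomeomorph M (EuclideanSpace ℝ (Fin p) × Z) →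
    EuclideanSpace ℝ (Fin p) × Z → EuclideanSpace ℝ (Fin p)
  leafwiseCk : ∀ φ ∈ 𝓕.charts, LeafwiseCkOn k (comp φ) φ.target
  compatible : ∀ φ ∈ 𝓕.charts, ∀ ψ ∈ 𝓕.charts, ∀ q ∈ (φ.symm.trans ψ).source,
    comp ψ (ψ (φ.symm q)) =
      fderiv ℝ (fun y : EuclideanSpace ℝ (Fin p) => (ψ (φ.symm (y, q.2))).1) q.1 (comp φ q)

namespace LeafwiseVectorField

variable {p : ℕ} {Z M : Type*} [TopologicalSpace Z] [TopologicalSpace M]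
  {𝓕 : FoliatedAtlas p Z M} {k : ℕ}

/-- The vector field `-V`. -/
def neg (V : LeafwiseVectorField 𝓕 k) : LeafwiseVectorField 𝓕 k where
  comp φ q := -V.comp φ q
  leafwiseCk φ hφ := by
    obtain ⟨h1, h2⟩ := V.leafwiseCk φ hφ
    refine ⟨fun z => (h1 z).neg, fun i hi => ?_⟩
    have : (fun q : EuclideanSpace ℝ (Fin p) × Z =>
        iteratedFDeriv ℝ i (fun y => -V.comp φ (y, q.2)) q.1) =
        fun q => -iteratedFDeriv ℝ i (fun y => V.comp φ (y, q.2)) q.1 := by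
      funext q
      exact iteratedFDeriv_neg_apply
    rw [this]
    exact (h2 i hi).neg
  compatible φ hφ ψ hψ q hq := by
    rw [V.compatible φ hφ ψ hψ q hq, map_neg]

/-- The derivative `V f` of a function `f` on `M` along `V`, computed in a chart `φ` around `m`:
`(V f) (m) = ∑ᵢ Vⁱ (y, z) ∂(f ∘ φ⁻¹)/∂yⁱ (y, z)`, where `(y, z) = φ m`. -/
noncomputable def lieDeriv (V : LeafwiseVectorField 𝓕 k) (f : M → ℝ) (m : M) : ℝ :=
  fderiv ℝ (fun y : EuclideanSpace ℝ (Fin p) =>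
      f ((𝓕.chartAt m).symm (y, (𝓕.chartAt m m).2))) (𝓕.chartAt m m).1
    (V.comp (𝓕.chartAt m) (𝓕.chartAt m m))

end LeafwiseVectorField

/-! ## The space `Homeo_L (M)` -/

/-- Homeomorphisms of `M` that are foliation preserving in both directions. -/
structure LeafHomeo {p : ℕ} {Z M : Type*} [TopologicalSpace Z] [TopologicalSpace M]
    (𝓕 : FoliatedAtlas p Z M) where
  /-- the underlying homeomorphism -/
  toHomeo : M ≃ₜ M
  foliationPreserving : 𝓕.FoliationPreserving toHomeo
  foliationPreserving_symm : 𝓕.FoliationPreserving toHomeo.symm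

/-- The topology of uniform convergence of the homeomorphisms and of their inverses. -/
instance {p : ℕ} {Z M : Type*} [TopologicalSpace Z] [TopologicalSpace M]
    (𝓕 : FoliatedAtlas p Z M) : TopologicalSpace (LeafHomeo 𝓕) :=
  TopologicalSpace.induced
    (fun h : LeafHomeo 𝓕 =>
      ((⟨h.toHomeo, h.toHomeo.continuous⟩, ⟨h.toHomeo.symm, h.toHomeo.symm.continuous⟩) :
        C(M, M) × C(M, M)))
    inferInstance

/-! ## Rough paths -/

/-- The simplex `{(s, t) : 0 ≤ s ≤ t ≤ T}`. -/
abbrev TimeSimplex (T : ℝ) : Type :=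
  {q : Set.Icc (0 : ℝ) T × Set.Icc (0 : ℝ) T // q.1 ≤ q.2}

/-- The length `t - s` for `(s, t)` in the simplex. -/
def TimeSimplex.len {T : ℝ} (q : TimeSimplex T) : ℝ := (q.1.2 : ℝ) - (q.1.1 : ℝ)

/-- The Hölder norm `sup_{s < t} |f (s, t)| / (t - s) ^ γ` of a function on the simplex. -/
noncomputable def simplexHolderNorm {T : ℝ} {E : Type*} [NormedAddCommGroup E] (γ : ℝ)
    (f : TimeSimplex T → E) : ℝ :=
  ⨆ q : {q : TimeSimplex T // q.1.1 < q.1.2}, ‖f q.1‖ / q.1.len ^ γ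

/-- `α`-Hölder rough paths `(1, w¹, w²)` on `[0, T]` over `ℝᵈ`; the tensor `w²` is given by its
coordinates `w² (i, j)`. -/
@[ext]
structure RoughPath (α : ℝ) (d : ℕ) (T : ℝ) where
  /-- first level -/
  lvl1 : TimeSimplex T → EuclideanSpace ℝ (Fin d)
  /-- second level -/
  lvl2 : TimeSimplex T → EuclideanSpace ℝ (Fin d × Fin d)
  continuous_lvl1 : Continuous lvl1
  continuous_lvl2 : Continuous lvl2
  chen1 : ∀ (s u t : Set.Icc (0 : ℝ) T) (hsu : s ≤ u) (hut : u ≤ t),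
    lvl1 ⟨(s, t), hsu.trans hut⟩ = lvl1 ⟨(s, u), hsu⟩ + lvl1 ⟨(u, t), hut⟩
  chen2 : ∀ (s u t : Set.Icc (0 : ℝ) T) (hsu : s ≤ u) (hut : u ≤ t) (i j : Fin d),
    lvl2 ⟨(s, t), hsu.trans hut⟩ (i, j) =
      lvl2 ⟨(s, u), hsu⟩ (i, j) + lvl2 ⟨(u, t), hut⟩ (i, j) +
        lvl1 ⟨(s, u), hsu⟩ i * lvl1 ⟨(u, t), hut⟩ j
  holder1 : ∃ C : ℝ, ∀ q : TimeSimplex T, q.1.1 < q.1.2 → ‖lvl1 q‖ ≤ C * q.len ^ α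
  holder2 : ∃ C : ℝ, ∀ q : TimeSimplex T, q.1.1 < q.1.2 → ‖lvl2 q‖ ≤ C * q.len ^ (2 * α)

section SimplexHolderNorm

variable {T : ℝ} {E : Type*} [NormedAddCommGroup E]

theorem TimeSimplex.len_pos {q : TimeSimplex T} (h : q.1.1 < q.1.2) : 0 < q.len :=
  sub_pos.2 (Subtype.coe_lt_coe.2 h)

theorem simplexHolderNorm_nonneg (γ : ℝ) (f : TimeSimplex T → E) : 0 ≤ simplexHolderNorm γ f :=
  Real.iSup_nonneg fun q =>
    div_nonneg (norm_nonneg _) (Real.rpow_nonneg (TimeSimplex.len_pos q.2).le _)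

theorem simplexHolderNorm_le {γ C : ℝ} (hC : 0 ≤ C) {f : TimeSimplex T → E}
    (h : ∀ q : TimeSimplex T, q.1.1 < q.1.2 → ‖f q‖ ≤ C * q.len ^ γ) :
    simplexHolderNorm γ f ≤ C :=
  Real.iSup_le (fun q => (div_le_iff₀ (Real.rpow_pos_of_pos (TimeSimplex.len_pos q.2) _)).2
    (h q.1 q.2)) hC

theorem norm_le_simplexHolderNorm {γ : ℝ} {f : TimeSimplex T → E}
    (hf : ∃ C : ℝ, ∀ q : TimeSimplex T, q.1.1 < q.1.2 → ‖f q‖ ≤ C * q.len ^ γ)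
    (q : TimeSimplex T) (hq : q.1.1 < q.1.2) :
    ‖f q‖ ≤ simplexHolderNorm γ f * q.len ^ γ := by
  obtain ⟨C, hC⟩ := hf
  rw [← div_le_iff₀ (Real.rpow_pos_of_pos (TimeSimplex.len_pos hq) _)]
  refine le_ciSup (f := fun q : {q : TimeSimplex T // q.1.1 < q.1.2} => ‖f q.1‖ / q.1.len ^ γ)
    ⟨C, ?_⟩ ⟨q, hq⟩
  rintro _ ⟨r, rfl⟩
  exact (div_le_iff₀ (Real.rpow_pos_of_pos (TimeSimplex.len_pos r.2) _)).2 (hC r.1 r.2)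

theorem exists_bound_sub {γ : ℝ} {f g : TimeSimplex T → E}
    (hf : ∃ C : ℝ, ∀ q : TimeSimplex T, q.1.1 < q.1.2 → ‖f q‖ ≤ C * q.len ^ γ)
    (hg : ∃ C : ℝ, ∀ q : TimeSimplex T, q.1.1 < q.1.2 → ‖g q‖ ≤ C * q.len ^ γ) :
    ∃ C : ℝ, ∀ q : TimeSimplex T, q.1.1 < q.1.2 → ‖(f - g) q‖ ≤ C * q.len ^ γ := by
  obtain ⟨C, hC⟩ := hf
  obtain ⟨D, hD⟩ := hg
  refine ⟨C + D, fun q hq => ?_⟩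
  rw [add_mul]
  exact (norm_sub_le _ _).trans (add_le_add (hC q hq) (hD q hq))

theorem simplexHolderNorm_sub_comm (γ : ℝ) (f g : TimeSimplex T → E) :
    simplexHolderNorm γ (f - g) = simplexHolderNorm γ (g - f) := by
  unfold simplexHolderNorm
  simp only [Pi.sub_apply, norm_sub_rev]

theorem simplexHolderNorm_sub_le {γ : ℝ} {f g h : TimeSimplex T → E}
    (hf : ∃ C : ℝ, ∀ q : TimeSimplex T, q.1.1 < q.1.2 → ‖f q‖ ≤ C * q.len ^ γ)
    (hg : ∃ C : ℝ, ∀ q : TimeSimplex T, q.1.1 < q.1.2 → ‖g q‖ ≤ C * q.len ^ γ)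
    (hh : ∃ C : ℝ, ∀ q : TimeSimplex T, q.1.1 < q.1.2 → ‖h q‖ ≤ C * q.len ^ γ) :
    simplexHolderNorm γ (f - h) ≤ simplexHolderNorm γ (f - g) + simplexHolderNorm γ (g - h) := by
  refine simplexHolderNorm_le
    (add_nonneg (simplexHolderNorm_nonneg _ _) (simplexHolderNorm_nonneg _ _)) fun q hq => ?_
  rw [add_mul]
  refine le_trans ?_ (add_le_add
    (norm_le_simplexHolderNorm (exists_bound_sub hf hg) q hq)
    (norm_le_simplexHolderNorm (exists_bound_sub hg hh) q hq))
  simpa using norm_sub_le_norm_sub_add_norm_sub (f q) (g q) (h q)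

theorem eq_of_simplexHolderNorm_sub_eq_zero {γ : ℝ} {f g : TimeSimplex T → E}
    (hf : ∃ C : ℝ, ∀ q : TimeSimplex T, q.1.1 < q.1.2 → ‖f q‖ ≤ C * q.len ^ γ)
    (hg : ∃ C : ℝ, ∀ q : TimeSimplex T, q.1.1 < q.1.2 → ‖g q‖ ≤ C * q.len ^ γ)
    (h0 : simplexHolderNorm γ (f - g) ≤ 0) (q : TimeSimplex T) (hq : q.1.1 < q.1.2) :
    f q = g q := by
  have h1 := norm_le_simplexHolderNorm (exists_bound_sub hf hg) q hq
  have h2 : simplexHolderNorm γ (f - g) = 0 := le_antisymm h0 (simplexHolderNorm_nonneg _ _)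
  rw [h2, zero_mul] at h1
  exact sub_eq_zero.1 (norm_le_zero_iff.1 h1)

end SimplexHolderNorm

namespace RoughPath

variable {α : ℝ} {d : ℕ} {T : ℝ}

theorem lvl1_diag (w : RoughPath α d T) (s : Set.Icc (0 : ℝ) T) :
    w.lvl1 ⟨(s, s), le_rfl⟩ = 0 := by
  simpa using w.chen1 s s s le_rfl le_rfl

theorem lvl2_diag (w : RoughPath α d T) (s : Set.Icc (0 : ℝ) T) :
    w.lvl2 ⟨(s, s), le_rfl⟩ = 0 := by
  ext ⟨i, j⟩
  have h := w.chen2 s s s le_rfl le_rfl i j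
  rw [w.lvl1_diag] at h
  simpa using h

/-- The distance `d_α (w, w') = max_{i = 1, 2} ‖wⁱ - w'ⁱ‖_{iα}`. -/
noncomputable instance : MetricSpace (RoughPath α d T) where
  dist w w' := max (simplexHolderNorm α (w.lvl1 - w'.lvl1))
    (simplexHolderNorm (2 * α) (w.lvl2 - w'.lvl2))
  dist_self w := by simp [simplexHolderNorm]
  dist_comm w w' := by
    rw [simplexHolderNorm_sub_comm α, simplexHolderNorm_sub_comm (2 * α)]
  dist_triangle w w' w'' := max_le
    ((simplexHolderNorm_sub_le w.holder1 w'.holder1 w''.holder1).trans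
      (add_le_add (le_max_left _ _) (le_max_left _ _)))
    ((simplexHolderNorm_sub_le w.holder2 w'.holder2 w''.holder2).trans
      (add_le_add (le_max_right _ _) (le_max_right _ _)))
  eq_of_dist_eq_zero := by
    intro w w' h
    have h1 : simplexHolderNorm α (w.lvl1 - w'.lvl1) ≤ 0 := (le_max_left _ _).trans h.le
    have h2 : simplexHolderNorm (2 * α) (w.lvl2 - w'.lvl2) ≤ 0 := (le_max_right _ _).trans h.le
    ext1
    · funext q
      obtain ⟨⟨s, t⟩, hst⟩ := q
      rcases hst.lt_or_eq with hlt | heq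
      · exact eq_of_simplexHolderNorm_sub_eq_zero w.holder1 w'.holder1 h1 _ hlt
      · obtain rfl : s = t := heq
        rw [lvl1_diag, lvl1_diag]
    · funext q
      obtain ⟨⟨s, t⟩, hst⟩ := q
      rcases hst.lt_or_eq with hlt | heq
      · exact eq_of_simplexHolderNorm_sub_eq_zero w.holder2 w'.holder2 h2 _ hlt
      · obtain rfl : s = t := heq
        rw [lvl2_diag, lvl2_diag]

end RoughPath

/-- `I` is the Riemann-Stieltjes integral `∫_a^b f dg`: the sums over tagged partitions of
`[a, b]` converge to `I` as the mesh tends to zero. -/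
def HasRiemannStieltjesIntegral (f g : ℝ → ℝ) (a b I : ℝ) : Prop :=
  ∀ ε > 0, ∃ δ > 0, ∀ (n : ℕ) (t ξ : ℕ → ℝ), Monotone t → t 0 = a → t n = b →
    (∀ i < n, t (i + 1) - t i < δ) → (∀ i < n, ξ i ∈ Set.Icc (t i) (t (i + 1))) →
    |∑ i ∈ Finset.range n, f (ξ i) * (g (t (i + 1)) - g (t i)) - I| < ε

/-- `w` is the natural lift of the Lipschitz path `γ : [0, T] → ℝᵈ` with `γ 0 = 0`:
`w¹_{s,t} = γ_t - γ_s` and `w²_{s,t} = ∫_s^t (γ_u - γ_s) ⊗ dγ_u`. -/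
def RoughPath.IsLipschitzLift {α : ℝ} {d : ℕ} {T : ℝ} (γ : ℝ → EuclideanSpace ℝ (Fin d))
    (w : RoughPath α d T) : Prop :=
  (∃ K : NNReal, LipschitzOnWith K γ (Set.Icc 0 T)) ∧ γ 0 = 0 ∧
  ∀ q : TimeSimplex T, w.lvl1 q = γ q.1.2 - γ q.1.1 ∧
    ∀ i j : Fin d, HasRiemannStieltjesIntegral (fun u => γ u i - γ q.1.1 i) (fun u => γ u j)
      q.1.1 q.1.2 (w.lvl2 q (i, j))

/-- The space `GΩ_α ([0, T], ℝᵈ)` of geometric rough paths: the closure, in the metric `d_α`, of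
the natural lifts of Lipschitz paths. -/
abbrev GeometricRoughPath (α : ℝ) (d : ℕ) (T : ℝ) : Type :=
  closure {w : RoughPath α d T | ∃ γ, RoughPath.IsLipschitzLift γ w}

/-! ## Time reversal -/

/-- For `S ∈ [0, T]`, the map `(s, t) ↦ (S - t, S - s)` from the simplex of `[0, S]` to that of
`[0, T]`. -/
def TimeSimplex.rev {T : ℝ} (S : Set.Icc (0 : ℝ) T) (q : TimeSimplex (S : ℝ)) : TimeSimplex T :=
  ⟨(⟨S - q.1.2, by have := q.1.2.2.2; linarith, by have := q.1.2.2.1; have := S.2.2; linarith⟩,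
    ⟨S - q.1.1, by have := q.1.1.2.2; linarith, by have := q.1.1.2.1; have := S.2.2; linarith⟩),
    by
      have h : (q.1.1 : ℝ) ≤ q.1.2 := q.2
      exact Subtype.mk_le_mk.2 (by linarith)⟩

theorem TimeSimplex.len_rev {T : ℝ} (S : Set.Icc (0 : ℝ) T) (q : TimeSimplex (S : ℝ)) :
    (TimeSimplex.rev S q).len = q.len := by
  simp [TimeSimplex.len, TimeSimplex.rev]

theorem TimeSimplex.rev_lt {T : ℝ} (S : Set.Icc (0 : ℝ) T) {q : TimeSimplex (S : ℝ)}
    (h : q.1.1 < q.1.2) : (TimeSimplex.rev S q).1.1 < (TimeSimplex.rev S q).1.2 := by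
  have h' : (q.1.1 : ℝ) < q.1.2 := h
  exact Subtype.mk_lt_mk.2 (by linarith)

theorem TimeSimplex.continuous_rev {T : ℝ} (S : Set.Icc (0 : ℝ) T) :
    Continuous (TimeSimplex.rev S) := by
  unfold TimeSimplex.rev
  fun_prop

/-- The flip `a ⊗ b ↦ b ⊗ a` in coordinates. -/
noncomputable def tensorFlip {d : ℕ} (v : EuclideanSpace ℝ (Fin d × Fin d)) :
    EuclideanSpace ℝ (Fin d × Fin d) :=
  WithLp.toLp 2 fun ij => v (ij.2, ij.1)

theorem norm_tensorFlip {d : ℕ} (v : EuclideanSpace ℝ (Fin d × Fin d)) :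
    ‖tensorFlip v‖ = ‖v‖ := by
  rw [EuclideanSpace.norm_eq, EuclideanSpace.norm_eq]
  congr 1
  exact Fintype.sum_equiv (Equiv.prodComm _ _) _ _ fun _ => rfl

/-- The reversal `R_S w` of a rough path `w` on `[0, T]` at time `S ∈ [0, T]`, a rough path on
`[0, S]`: `(R_S w)^{1,i}_{s,t} = -w^{1,i}_{S-t,S-s}` and
`(R_S w)^{2,ij}_{s,t} = w^{2,ji}_{S-t,S-s}`. -/
noncomputable def RoughPath.reverse {α : ℝ} {d : ℕ} {T : ℝ} (S : Set.Icc (0 : ℝ) T)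
    (w : RoughPath α d T) : RoughPath α d S where
  lvl1 q := -w.lvl1 (TimeSimplex.rev S q)
  lvl2 q := tensorFlip (w.lvl2 (TimeSimplex.rev S q))
  continuous_lvl1 := (w.continuous_lvl1.comp (TimeSimplex.continuous_rev S)).neg
  continuous_lvl2 := by
    have h := w.continuous_lvl2.comp (TimeSimplex.continuous_rev S)
    unfold tensorFlip
    fun_prop
  chen1 s u t hsu hut := by
    have h := w.chen1 _ _ _ (TimeSimplex.rev S ⟨(u, t), hut⟩).2
      (TimeSimplex.rev S ⟨(s, u), hsu⟩).2
    rw [← neg_add, add_comm]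
    exact congrArg Neg.neg h
  chen2 s u t hsu hut i j := by
    have h := w.chen2 _ _ _ (TimeSimplex.rev S ⟨(u, t), hut⟩).2
      (TimeSimplex.rev S ⟨(s, u), hsu⟩).2 j i
    refine h.trans ?_
    change w.lvl2 (TimeSimplex.rev S ⟨(u, t), hut⟩) (j, i) +
      w.lvl2 (TimeSimplex.rev S ⟨(s, u), hsu⟩) (j, i) +
      w.lvl1 (TimeSimplex.rev S ⟨(u, t), hut⟩) j * w.lvl1 (TimeSimplex.rev S ⟨(s, u), hsu⟩) i =
      w.lvl2 (TimeSimplex.rev S ⟨(s, u), hsu⟩) (j, i) +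
      w.lvl2 (TimeSimplex.rev S ⟨(u, t), hut⟩) (j, i) +
      (-w.lvl1 (TimeSimplex.rev S ⟨(s, u), hsu⟩) i) *
        (-w.lvl1 (TimeSimplex.rev S ⟨(u, t), hut⟩) j)
    ring
  holder1 := by
    obtain ⟨C, hC⟩ := w.holder1
    refine ⟨C, fun q hq => ?_⟩
    have h := hC _ (TimeSimplex.rev_lt S hq)
    rwa [TimeSimplex.len_rev, ← norm_neg] at h
  holder2 := by
    obtain ⟨C, hC⟩ := w.holder2
    refine ⟨C, fun q hq => ?_⟩
    have h := hC _ (TimeSimplex.rev_lt S hq)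
    rwa [TimeSimplex.len_rev, ← norm_tensorFlip] at h

namespace RoughPath

variable {α : ℝ} {d : ℕ} {T : ℝ}

theorem dist_reverse_le (S : Set.Icc (0 : ℝ) T) (w w' : RoughPath α d T) :
    dist (w.reverse S) (w'.reverse S) ≤ dist w w' := by
  refine max_le ?_ ?_
  · refine le_trans (simplexHolderNorm_le (simplexHolderNorm_nonneg _ _) fun q hq => ?_)
      (le_max_left _ _)
    have h := norm_le_simplexHolderNorm (exists_bound_sub w.holder1 w'.holder1) _
      (TimeSimplex.rev_lt S hq)
    rw [TimeSimplex.len_rev] at h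
    refine le_trans (le_of_eq ?_) h
    change ‖-w.lvl1 _ - -w'.lvl1 _‖ = ‖w.lvl1 _ - w'.lvl1 _‖
    rw [← norm_neg]
    congr 1
    abel
  · refine le_trans (simplexHolderNorm_le (simplexHolderNorm_nonneg _ _) fun q hq => ?_)
      (le_max_right _ _)
    have h := norm_le_simplexHolderNorm (exists_bound_sub w.holder2 w'.holder2) _
      (TimeSimplex.rev_lt S hq)
    rw [TimeSimplex.len_rev] at h
    refine le_trans (le_of_eq ?_) h
    exact norm_tensorFlip (w.lvl2 (TimeSimplex.rev S q) - w'.lvl2 (TimeSimplex.rev S q))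

theorem continuous_reverse (S : Set.Icc (0 : ℝ) T) :
    Continuous (RoughPath.reverse S : RoughPath α d T → RoughPath α d S) :=
  (LipschitzWith.of_dist_le_mul (K := 1) fun w w' => by
    simpa using dist_reverse_le S w w').continuous

end RoughPath

theorem sum_mul_sub_eq_sum_reflect (a b : ℕ → ℝ) (n : ℕ) :
    ∑ k ∈ Finset.range n, (a k - a 0) * (b (k + 1) - b k) =
      ∑ k ∈ Finset.range n, (b (n - k) - b n) * (a (n - (k + 1)) - a (n - k)) := by
  have h1 : ∑ k ∈ Finset.range n, ((a (k + 1) - a 0) * (b (k + 1) - b n) -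
      (a k - a 0) * (b k - b n)) = 0 := by
    rw [Finset.sum_range_sub (fun k => (a k - a 0) * (b k - b n))]
    ring
  have h2 : ∑ k ∈ Finset.range n, (a k - a 0) * (b (k + 1) - b k) =
      ∑ k ∈ Finset.range n, (b (k + 1) - b n) * (a k - a (k + 1)) := by
    rw [← sub_eq_zero, ← h1, ← Finset.sum_sub_distrib]
    refine Finset.sum_congr rfl fun k _ => ?_
    ring
  rw [h2, ← Finset.sum_range_reflect]
  refine Finset.sum_congr rfl fun k hk => ?_
  have hk' := Finset.mem_range.1 hk
  have e1 : n - 1 - k + 1 = n - k := by omega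
  have e2 : n - 1 - k = n - (k + 1) := by omega
  rw [e1, e2]

/-- Reversing the time in `∫ (g - g (S - t)) df` and integrating by parts, for Lipschitz `f`, `g`. -/
theorem HasRiemannStieltjesIntegral.reverse {f g : ℝ → ℝ} {S s t K I : ℝ} (hst : s ≤ t)
    (hK : 0 ≤ K)
    (hf : ∀ x ∈ Set.Icc (S - t) (S - s), ∀ y ∈ Set.Icc (S - t) (S - s), |f x - f y| ≤ K * |x - y|)
    (hg : ∀ x ∈ Set.Icc (S - t) (S - s), ∀ y ∈ Set.Icc (S - t) (S - s), |g x - g y| ≤ K * |x - y|)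
    (h : HasRiemannStieltjesIntegral (fun u => g u - g (S - t)) f (S - t) (S - s) I) :
    HasRiemannStieltjesIntegral (fun u => f (S - u) - f (S - s)) (fun u => g (S - u)) s t I := by
  intro ε hε
  obtain ⟨δ, hδ, H⟩ := h (ε / 2) (half_pos hε)
  have hc : 0 < 2 * (K * K * (t - s) + 1) := by
    have : 0 ≤ K * K * (t - s) := mul_nonneg (mul_nonneg hK hK) (sub_nonneg.2 hst)
    linarith
  refine ⟨min δ (ε / (2 * (K * K * (t - s) + 1))), lt_min hδ (div_pos hε hc), ?_⟩
  intro n τ ξ hτ h0 hn hmesh htag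
  set η := ε / (2 * (K * K * (t - s) + 1)) with hη
  have hηpos : 0 < η := div_pos hε hc
  have hmem : ∀ k ≤ n, S - τ k ∈ Set.Icc (S - t) (S - s) := fun k hk =>
    ⟨by have := hτ hk; rw [hn] at this; linarith,
     by have := hτ (Nat.zero_le k); rw [h0] at this; linarith⟩
  have H1 := H n (fun i => S - τ (n - i)) (fun i => S - τ (n - i))
    (fun i j hij => by
      have := hτ (Nat.sub_le_sub_left hij n)
      simp only
      linarith)
    (by simp [hn]) (by simp [h0])
    (fun i hi => by
      have e : n - i = n - (i + 1) + 1 := by omega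
      have := hmesh (n - (i + 1)) (by omega)
      have := this.trans_le (min_le_left _ _)
      rw [← e] at this
      linarith)
    (fun i hi => ⟨le_rfl, by
      have := hτ (Nat.sub_le_sub_left (Nat.le_succ i) n)
      simp only [Nat.succ_eq_add_one] at this
      linarith⟩)
  have H2 := sum_mul_sub_eq_sum_reflect (fun k => f (S - τ k)) (fun k => g (S - τ k)) n
  simp only [h0, hn] at H2
  simp only at H1
  rw [← H2] at H1
  have H3 : |∑ i ∈ Finset.range n, (f (S - ξ i) - f (S - s)) *
        (g (S - τ (i + 1)) - g (S - τ i)) -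
      ∑ i ∈ Finset.range n, (f (S - τ i) - f (S - s)) * (g (S - τ (i + 1)) - g (S - τ i))| ≤
      K * K * η * (t - s) := by
    rw [← Finset.sum_sub_distrib]
    refine (Finset.abs_sum_le_sum_abs _ _).trans ?_
    have hts : t - s = ∑ i ∈ Finset.range n, (τ (i + 1) - τ i) := by
      rw [Finset.sum_range_sub, h0, hn]
    rw [hts, Finset.mul_sum]
    refine Finset.sum_le_sum fun i hi => ?_
    have hi' := Finset.mem_range.1 hi
    have m0 := hmem i hi'.le
    have m1 := hmem (i + 1) hi'
    have hx := htag i hi'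
    have mx : S - ξ i ∈ Set.Icc (S - t) (S - s) :=
      ⟨by linarith [m1.1, hx.2], by linarith [m0.2, hx.1]⟩
    have hm : τ (i + 1) - τ i < η := (hmesh i hi').trans_le (min_le_right _ _)
    have a1 := hf _ mx _ m0
    have a2 := hg _ m1 _ m0
    have b1 : |S - ξ i - (S - τ i)| ≤ η := by
      rw [abs_le]; constructor <;> linarith [hx.1, hx.2]
    have b2 : |S - τ (i + 1) - (S - τ i)| = τ (i + 1) - τ i := by
      rw [abs_sub_comm, abs_of_nonneg] <;> linarith [hx.1, hx.2]
    rw [b2] at a2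
    have e : (f (S - ξ i) - f (S - s)) * (g (S - τ (i + 1)) - g (S - τ i)) -
        (f (S - τ i) - f (S - s)) * (g (S - τ (i + 1)) - g (S - τ i)) =
        (f (S - ξ i) - f (S - τ i)) * (g (S - τ (i + 1)) - g (S - τ i)) := by ring
    rw [e, abs_mul]
    calc |f (S - ξ i) - f (S - τ i)| * |g (S - τ (i + 1)) - g (S - τ i)|
        ≤ (K * η) * (K * (τ (i + 1) - τ i)) :=
          mul_le_mul (a1.trans (mul_le_mul_of_nonneg_left b1 hK)) a2 (abs_nonneg _)
            (mul_nonneg hK hηpos.le)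
      _ = K * K * η * (τ (i + 1) - τ i) := by ring
  have H4 : K * K * η * (t - s) < ε / 2 := by
    have e : η * (2 * (K * K * (t - s) + 1)) = ε := by
      rw [hη]; exact div_mul_cancel₀ _ hc.ne'
    nlinarith
  calc |∑ i ∈ Finset.range n, (f (S - ξ i) - f (S - s)) * (g (S - τ (i + 1)) - g (S - τ i)) - I|
      ≤ _ := abs_sub_le _ (∑ i ∈ Finset.range n, (f (S - τ i) - f (S - s)) *
          (g (S - τ (i + 1)) - g (S - τ i))) _
    _ < ε / 2 + ε / 2 := add_lt_add (H3.trans_lt H4) H1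
    _ = ε := add_halves ε

namespace RoughPath

variable {α : ℝ} {d : ℕ} {T : ℝ}

/-- The reversal of the lift of `γ` is the lift of `u ↦ γ (S - u) - γ S`. -/
theorem IsLipschitzLift.reverse (S : Set.Icc (0 : ℝ) T) {γ : ℝ → EuclideanSpace ℝ (Fin d)}
    {w : RoughPath α d T} (h : IsLipschitzLift γ w) :
    IsLipschitzLift (fun u => γ (S - u) - γ S) (w.reverse S) := by
  obtain ⟨⟨K, hK⟩, -, hq⟩ := h
  have hS : ∀ u ∈ Set.Icc (0 : ℝ) S, (S : ℝ) - u ∈ Set.Icc (0 : ℝ) T := fun u hu =>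
    ⟨by linarith [hu.2], by linarith [hu.1, S.2.2]⟩
  refine ⟨⟨K, ?_⟩, by simp, fun q => ⟨?_, fun i j => ?_⟩⟩
  · refine LipschitzOnWith.of_dist_le_mul fun u hu v hv => ?_
    have := hK.dist_le_mul _ (hS u hu) _ (hS v hv)
    rw [dist_sub_right]
    refine this.trans (le_of_eq ?_)
    rw [dist_sub_left]
  · change -w.lvl1 (TimeSimplex.rev S q) = _
    rw [(hq (TimeSimplex.rev S q)).1]
    change -(γ (S - q.1.1) - γ (S - q.1.2)) = γ (S - q.1.2) - γ S - (γ (S - q.1.1) - γ S)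
    rw [neg_sub, sub_sub_sub_cancel_right]
  · have hI := (hq (TimeSimplex.rev S q)).2 j i
    change HasRiemannStieltjesIntegral (fun u => γ u j - γ (S - q.1.2) j) (fun u => γ u i)
      (S - q.1.2) (S - q.1.1) (w.lvl2 (TimeSimplex.rev S q) (j, i)) at hI
    have hlip : ∀ k : Fin d, ∀ x ∈ Set.Icc ((S : ℝ) - q.1.2) (S - q.1.1),
        ∀ y ∈ Set.Icc ((S : ℝ) - q.1.2) (S - q.1.1), |γ x k - γ y k| ≤ K * |x - y| := by
      intro k x hx y hy
      have sub : ∀ x ∈ Set.Icc ((S : ℝ) - q.1.2) (S - q.1.1), x ∈ Set.Icc (0 : ℝ) T :=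
        fun x hx => ⟨by linarith [hx.1, q.1.2.2.2], by linarith [hx.2, q.1.1.2.1, S.2.2]⟩
      have h1 := hK.dist_le_mul _ (sub x hx) _ (sub y hy)
      rw [dist_eq_norm, Real.dist_eq] at h1
      exact (PiLp.norm_apply_le (γ x - γ y) k).trans h1
    have h2 := HasRiemannStieltjesIntegral.reverse (f := fun u => γ u i) (g := fun u => γ u j)
      (show (q.1.1 : ℝ) ≤ q.1.2 from q.2) K.2 (hlip i) (hlip j) hI
    intro ε hε
    obtain ⟨δ, hδ, H⟩ := h2 ε hε
    refine ⟨δ, hδ, fun n t ξ a b c e f => ?_⟩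
    have := H n t ξ a b c e f
    change |_ - w.lvl2 (TimeSimplex.rev S q) (j, i)| < ε
    simpa using this

end RoughPath

/-- The reversal `R_S : GΩ_α ([0, T], ℝᵈ) → GΩ_α ([0, S], ℝᵈ)`. -/
noncomputable def GeometricRoughPath.reverse {α : ℝ} {d : ℕ} {T : ℝ} (S : Set.Icc (0 : ℝ) T)
    (w : GeometricRoughPath α d T) : GeometricRoughPath α d S :=
  ⟨w.1.reverse S, map_mem_closure (RoughPath.continuous_reverse S) w.2
    fun _ ⟨_, h⟩ => ⟨_, h.reverse S⟩⟩

/-! ## Rough differential equations on a foliated space -/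

/-- `x` solves `dx_t = ∑ᵢ Vᵢ (x_t) dwⁱ_t + V₀ (x_t) dt` on `[0, T]` with `x_0 = m`: for every
leafwise `C³` function `f`, uniformly in `0 ≤ s ≤ t ≤ T`,
`f (x_t) - f (x_s) = ∑ᵢ Vᵢ f (x_s) w^{1,i}_{s,t} + ∑_{j,k} V_j V_k f (x_s) w^{2,jk}_{s,t}
  + V₀ f (x_s) (t - s) + O ((t - s) ^ (3 α))`. -/
def IsRDESolution {p d : ℕ} {Z M : Type*} [TopologicalSpace Z] [TopologicalSpace M]
    {𝓕 : FoliatedAtlas p Z M} {α T : ℝ} (V : Fin d → LeafwiseVectorField 𝓕 3)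
    (V₀ : LeafwiseVectorField 𝓕 3) (w : GeometricRoughPath α d T) (m : M)
    (x : C(Set.Icc (0 : ℝ) T, M)) : Prop :=
  (∀ t : Set.Icc (0 : ℝ) T, (t : ℝ) = 0 → x t = m) ∧
  ∀ f : M → ℝ, 𝓕.LeafwiseCk 3 f → ∃ C : ℝ, ∀ q : TimeSimplex T,
    |f (x q.1.2) - f (x q.1.1) -
      (∑ i : Fin d, (V i).lieDeriv f (x q.1.1) * w.1.lvl1 q i +
        ∑ j : Fin d, ∑ k : Fin d,
          (V j).lieDeriv ((V k).lieDeriv f) (x q.1.1) * w.1.lvl2 q (j, k) +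
        V₀.lieDeriv f (x q.1.1) * q.len)| ≤ C * q.len ^ (3 * α)

open Classical in
/-- The Lyons-Itô map `Φ (m, w) ∈ C ([0, T], M)`: the solution of the equation driven by `w` with
coefficients `[V₁, …, V_d; V₀]` and initial condition `m` (with a junk value if there is none). -/
noncomputable def lyonsIto {p d : ℕ} {Z M : Type*} [TopologicalSpace Z] [TopologicalSpace M]
    {𝓕 : FoliatedAtlas p Z M} {α T : ℝ} (V : Fin d → LeafwiseVectorField 𝓕 3)
    (V₀ : LeafwiseVectorField 𝓕 3) (m : M) (w : GeometricRoughPath α d T) :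
    C(Set.Icc (0 : ℝ) T, M) :=
  if h : ∃ x : C(Set.Icc (0 : ℝ) T, M), IsRDESolution V V₀ w m x then h.choose
  else ContinuousMap.const _ m

/-!
The equation is solved in foliated charts, plaque by plaque, in Davie's way. In a chart `φ` and on
the plaque with transverse coordinate `z`, the one-step map `chartStep` sends `y` to its second order
expansion along an increment of the rough path. By Chen's relation these maps form an approximate
flow (`FieldBound.approxFlowOn`): they satisfy the flow property up to an error of order
`(t - s) ^ (3 α)`, and `3 α > 1`. By Davie's estimate (`exists_davie_constants`) their Euler
schemes do the same uniformly in the step size, so limits of them along an ultrafilter are paths that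
follow the one-step maps up to an error of order `3 α`. Since the coefficients are of class `C³`, the tangent
maps of the one-step maps are the one-step maps of an equation with `C²` coefficients, so they are an
approximate flow too. The bounds for the tangent Euler schemes say that Euler schemes are uniformly
Lipschitz in the initial value, and a telescoping sum then shows that every path that follows the
one-step maps is the limit of the Euler schemes, at an explicit rate
(`exists_local_flow_constants`). This gives existence, uniqueness and uniform approximation in one
stroke; all constants are uniform in the plaque, because leafwise derivatives are continuous in `z`
and `Z` is locally compact.

The intrinsic definition, by expansions of leafwise `C³` functions, is equivalent to following the
one-step maps in charts. In one direction (`IsSolOn.davieOn`), one tests with functions supported in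
a chart: a function of the form `η(z)` near the point, where `η` peaks at one value, is constant
along the solution because its increments are of order greater than one, so solutions stay in
plaques; then the coordinates are used as test functions. In the other direction
(`isSolOn_of_davieOn`), a Taylor expansion of a test function is compared with the required one;
their quadratic terms agree because the rough path is geometric, and the local estimates on the
diagonal of the simplex are made uniform by compactness. As a consequence solutions can be
concatenated (`IsSolOn.glue`) and run backwards (`IsSolOn.reverse`).

Compactness of `M` makes the length of the time intervals uniform, so solutions exist globally, and
they stay in a leaf because each local piece stays in a plaque. Running the flow backwards inverts
it (`flow_reverse_flow`). The flow is jointly continuous in the point, the rough path and the time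
(`continuous_lyonsIto`), since over short intervals it is a uniform limit of Euler schemes, which
are continuous in all the data; continuity of the inverses then comes for free from compactness of
`M`, and currying yields the continuous map into `C([0, T], Homeo_L(M))`.
-/

/-! ### Calculus of leafwise `C^k` functions -/

section LeafCalculus

variable {E E' G G' G'' : Type} {W W' : Type*}
  [NormedAddCommGroup E] [NormedSpace ℝ E] [NormedAddCommGroup E'] [NormedSpace ℝ E']
  [NormedAddCommGroup G] [NormedSpace ℝ G] [NormedAddCommGroup G'] [NormedSpace ℝ G']
  [NormedAddCommGroup G''] [NormedSpace ℝ G'']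
  [TopologicalSpace W] [TopologicalSpace W']

/-- The derivative of `f : E × W → G` in the leaf direction `E`. -/
noncomputable def leafDeriv (f : E × W → G) (q : E × W) : E →L[ℝ] G :=
  fderiv ℝ (fun y => f (y, q.2)) q.1

/-- A recursive form of `LeafwiseCkOn`, convenient for inductions over the order of
differentiability: `f` is continuous, differentiable along the leaves, and its leafwise derivative
is of class `C_L^{k-1}`. The two notions agree on open sets, see `leafwiseCkOn_iff`. -/
def LeafwiseCkRec : ∀ (_ : ℕ) {G : Type} [NormedAddCommGroup G] [NormedSpace ℝ G]
    (_ : E × W → G) (_ : Set (E × W)), Prop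
  | 0, _, _, _, f, U => ContinuousOn f U
  | k + 1, _, _, _, f, U => ContinuousOn f U ∧
      (∀ q ∈ U, DifferentiableAt ℝ (fun y => f (y, q.2)) q.1) ∧
      LeafwiseCkRec k (leafDeriv f) U

theorem isOpen_slice {U : Set (E × W)} (hU : IsOpen U) (z : W) : IsOpen {y : E | (y, z) ∈ U} :=
  hU.preimage (by fun_prop : Continuous fun y : E => (y, z))

theorem continuousOn_iteratedFDeriv_zero_iff (f : E × W → G) (U : Set (E × W)) :
    ContinuousOn (fun q : E × W => iteratedFDeriv ℝ 0 (fun y : E => f (y, q.2)) q.1) U ↔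
      ContinuousOn f U := by
  have : (fun q : E × W => iteratedFDeriv ℝ 0 (fun y : E => f (y, q.2)) q.1) =
      (continuousMultilinearCurryFin0 ℝ E G).symm ∘ f := by
    funext q
    rw [iteratedFDeriv_zero_eq_comp]
    rfl
  rw [this]
  exact (continuousMultilinearCurryFin0 ℝ E G).symm.toHomeomorph.comp_continuousOn_iff _ _

theorem leafwiseCkOn_iff {k : ℕ} {f : E × W → G} {U : Set (E × W)} (hU : IsOpen U) :
    LeafwiseCkOn k f U ↔ LeafwiseCkRec k f U := by
  induction k generalizing G with
  | zero =>
    constructor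
    · intro h
      exact (continuousOn_iteratedFDeriv_zero_iff f U).1 (h.2 0 le_rfl)
    · intro h
      refine ⟨fun z => ?_, fun i hi => ?_⟩
      · exact contDiffOn_zero.2 (ContinuousOn.comp h
          (by fun_prop : Continuous fun y : E => (y, z)).continuousOn fun y hy => hy)
      · obtain rfl : i = 0 := by omega
        exact (continuousOn_iteratedFDeriv_zero_iff f U).2 h
  | succ k ih =>
    have keyS : ∀ i,
        ContinuousOn (fun q : E × W => iteratedFDeriv ℝ (i + 1) (fun y : E => f (y, q.2)) q.1) U
        ↔ ContinuousOn (fun q : E × W =>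
          iteratedFDeriv ℝ i (fun y : E => leafDeriv f (y, q.2)) q.1) U := by
      intro i
      have : (fun q : E × W => iteratedFDeriv ℝ (i + 1) (fun y : E => f (y, q.2)) q.1) =
          (continuousMultilinearCurryRightEquiv' ℝ i E G).symm ∘ (fun q : E × W =>
          iteratedFDeriv ℝ i (fun y : E => leafDeriv f (y, q.2)) q.1) := by
        funext q
        rw [iteratedFDeriv_succ_eq_comp_right]
        rfl
      rw [this]
      exact (continuousMultilinearCurryRightEquiv' ℝ i E G).symm.toHomeomorph.comp_continuousOn_iff
        _ _
    have slice : ∀ z : W, ContDiffOn ℝ ((k + 1 : ℕ)) (fun y : E => f (y, z)) {y | (y, z) ∈ U} ↔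
        DifferentiableOn ℝ (fun y : E => f (y, z)) {y | (y, z) ∈ U} ∧
        ContDiffOn ℝ k (fun y : E => leafDeriv f (y, z)) {y | (y, z) ∈ U} := by
      intro z
      have := contDiffOn_succ_iff_fderiv_of_isOpen (𝕜 := ℝ) (n := (k : ℕ∞))
        (f := fun y : E => f (y, z)) (isOpen_slice hU z)
      simpa [leafDeriv] using this
    constructor
    · rintro ⟨h1, h2⟩
      refine ⟨(continuousOn_iteratedFDeriv_zero_iff f U).1 (h2 0 (Nat.zero_le _)), fun q hq => ?_, ?_⟩
      · exact ((slice q.2).1 (h1 q.2)).1.differentiableAt ((isOpen_slice hU q.2).mem_nhds hq)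
      · exact ih.1 ⟨fun z => ((slice z).1 (h1 z)).2,
          fun i hi => (keyS i).1 (h2 (i + 1) (by omega))⟩
    · rintro ⟨h0, h1, h2⟩
      obtain ⟨h3, h4⟩ := ih.2 h2
      refine ⟨fun z => (slice z).2 ⟨fun y hy => (h1 (y, z) hy).differentiableWithinAt, h3 z⟩, ?_⟩
      rintro (_ | i) hi
      · exact (continuousOn_iteratedFDeriv_zero_iff f U).2 h0
      · exact (keyS i).2 (h4 i (by omega))

namespace LeafwiseCkRec

variable {k : ℕ} {f g : E × W → G} {U O : Set (E × W)}

theorem continuousOn (h : LeafwiseCkRec k f U) : ContinuousOn f U := by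
  cases k with
  | zero => exact h
  | succ k => exact h.1

theorem of_succ (h : LeafwiseCkRec (k + 1) f U) : LeafwiseCkRec k f U := by
  induction k generalizing G with
  | zero => exact h.1
  | succ k ih => exact ⟨h.1, h.2.1, ih h.2.2⟩

theorem of_le {l : ℕ} (h : LeafwiseCkRec l f U) (hkl : k ≤ l) : LeafwiseCkRec k f U := by
  induction l, hkl using Nat.le_induction with
  | base => exact h
  | succ l _ ih => exact ih h.of_succ

theorem slice_eventuallyEq (hU : IsOpen U) (hfg : Set.EqOn f g U) {q : E × W} (hq : q ∈ U) :
    (fun y => f (y, q.2)) =ᶠ[nhds q.1] fun y => g (y, q.2) := by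
  filter_upwards [(isOpen_slice hU q.2).mem_nhds hq] with y hy
  exact hfg hy

theorem leafDeriv_eqOn (hU : IsOpen U) (hfg : Set.EqOn f g U) :
    Set.EqOn (leafDeriv f) (leafDeriv g) U := fun _ hq =>
  (slice_eventuallyEq hU hfg hq).fderiv_eq

theorem congr (hU : IsOpen U) (h : LeafwiseCkRec k f U) (hfg : Set.EqOn g f U) :
    LeafwiseCkRec k g U := by
  induction k generalizing G with
  | zero => exact ContinuousOn.congr h hfg
  | succ k ih =>
    refine ⟨h.1.congr hfg, fun q hq => ?_, ih h.2.2 (leafDeriv_eqOn hU hfg)⟩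
    exact (h.2.1 q hq).congr_of_eventuallyEq (slice_eventuallyEq hU hfg hq)

theorem of_local (h : ∀ q ∈ U, ∃ O, IsOpen O ∧ q ∈ O ∧ LeafwiseCkRec k f O) :
    LeafwiseCkRec k f U := by
  have hc : ∀ {G : Type} [NormedAddCommGroup G] [NormedSpace ℝ G] {f : E × W → G},
      (∀ q ∈ U, ∃ O, IsOpen O ∧ q ∈ O ∧ ContinuousOn f O) → ContinuousOn f U := by
    intro G _ _ f h q hq
    obtain ⟨O, hO, hqO, hf⟩ := h q hq
    exact (hf.continuousAt (hO.mem_nhds hqO)).continuousWithinAt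
  induction k generalizing G with
  | zero => exact hc h
  | succ k ih =>
    refine ⟨hc fun q hq => ?_, fun q hq => ?_, ih fun q hq => ?_⟩
    all_goals obtain ⟨O, hO, hqO, hf⟩ := h q hq
    · exact ⟨O, hO, hqO, hf.1⟩
    · exact hf.2.1 q hqO
    · exact ⟨O, hO, hqO, hf.2.2⟩

theorem clm_comp (hU : IsOpen U) (h : LeafwiseCkRec k f U) (L : G →L[ℝ] G') :
    LeafwiseCkRec k (fun q => L (f q)) U := by
  induction k generalizing G G' with
  | zero => exact L.continuous.comp_continuousOn h
  | succ k ih =>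
    refine ⟨L.continuous.comp_continuousOn h.1,
      fun q hq => L.differentiableAt.comp q.1 (h.2.1 q hq), ?_⟩
    refine (ih h.2.2 (ContinuousLinearMap.compL ℝ E G G' L)).congr hU fun q hq => ?_
    exact (L.hasFDerivAt.comp q.1 (h.2.1 q hq).hasFDerivAt).fderiv

theorem add (hU : IsOpen U) (hf : LeafwiseCkRec k f U) (hg : LeafwiseCkRec k g U) :
    LeafwiseCkRec k (fun q => f q + g q) U := by
  induction k generalizing G with
  | zero => exact ContinuousOn.add hf hg
  | succ k ih =>
    refine ⟨hf.1.add hg.1, fun q hq => (hf.2.1 q hq).add (hg.2.1 q hq), ?_⟩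
    refine (ih hf.2.2 hg.2.2).congr hU fun q hq => ?_
    exact ((hf.2.1 q hq).hasFDerivAt.add (hg.2.1 q hq).hasFDerivAt).fderiv

theorem bilin (hU : IsOpen U) {g : E × W → G'} (B : G →L[ℝ] G' →L[ℝ] G'')
    (hf : LeafwiseCkRec k f U) (hg : LeafwiseCkRec k g U) :
    LeafwiseCkRec k (fun q => B (f q) (g q)) U := by
  induction k generalizing G G' G'' with
  | zero => exact B.isBoundedBilinearMap.continuous.comp_continuousOn (ContinuousOn.prodMk hf hg)
  | succ k ih =>
    refine ⟨B.isBoundedBilinearMap.continuous.comp_continuousOn (hf.1.prodMk hg.1),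
      fun q hq => (B.hasFDerivAt_of_bilinear (hf.2.1 q hq).hasFDerivAt
        (hg.2.1 q hq).hasFDerivAt).differentiableAt, ?_⟩
    refine ((ih (B.precompR E) hf.of_succ hg.2.2).add hU
      (ih (B.precompL E) hf.2.2 hg.of_succ)).congr hU fun q hq => ?_
    exact (B.hasFDerivAt_of_bilinear (hf.2.1 q hq).hasFDerivAt
        (hg.2.1 q hq).hasFDerivAt).fderiv

/-- Leafwise regularity is preserved under composition with leafwise `C^k` maps
`(y, z) ↦ (h (y, z), c z)`. -/
theorem comp (hU : IsOpen U) {U' : Set (E' × W')} {f : E' × W' → G} {h : E × W → E'} {c : W → W'}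
    (hf : LeafwiseCkRec k f U') (hh : LeafwiseCkRec k h U)
    (hc : ContinuousOn (fun q : E × W => c q.2) U) (hmaps : ∀ q ∈ U, (h q, c q.2) ∈ U') :
    LeafwiseCkRec k (fun q => f (h q, c q.2)) U := by
  induction k generalizing G with
  | zero => exact ContinuousOn.comp hf (ContinuousOn.prodMk hh hc) hmaps
  | succ k ih =>
    have hd : ∀ q ∈ U, HasFDerivAt (fun y => f (h (y, q.2), c q.2))
        ((leafDeriv f (h q, c q.2)).comp (leafDeriv h q)) q.1 := fun q hq =>
      HasFDerivAt.comp (g := fun y => f (y, c q.2)) (f := fun y => h (y, q.2)) q.1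
        (hf.2.1 _ (hmaps q hq)).hasFDerivAt (hh.2.1 q hq).hasFDerivAt
    refine ⟨hf.1.comp (hh.1.prodMk hc) hmaps, fun q hq => (hd q hq).differentiableAt, ?_⟩
    refine ((ih hf.2.2 hh.of_succ).bilin hU (ContinuousLinearMap.compL ℝ E E' G)
      hh.2.2).congr hU fun q hq => ?_
    exact (hd q hq).fderiv

theorem of_contDiff {χ : E → G} (h : ContDiff ℝ k χ) (U : Set (E × W)) :
    LeafwiseCkRec k (fun q : E × W => χ q.1) U := by
  induction k generalizing G with
  | zero => exact (h.continuous.comp continuous_fst).continuousOn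
  | succ k ih =>
    have h' := contDiff_succ_iff_fderiv.1 (show ContDiff ℝ ((k : WithTop ℕ∞) + 1) χ by exact_mod_cast h)
    exact ⟨(h.continuous.comp continuous_fst).continuousOn, fun q _ => h'.1 q.1, ih h'.2.2⟩

theorem of_transverse {η : W → G} (h : Continuous η) (U : Set (E × W)) :
    LeafwiseCkRec k (fun q : E × W => η q.2) U := by
  cases k with
  | zero => exact (h.comp continuous_snd).continuousOn
  | succ k =>
    refine ⟨(h.comp continuous_snd).continuousOn, fun q _ =>
      (differentiableAt_const (η q.2) : DifferentiableAt ℝ (fun _ : E => η q.2) q.1), ?_⟩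
    have : leafDeriv (fun q : E × W => η q.2) = fun _ => 0 := by
      funext q
      exact fderiv_const_apply (η q.2)
    rw [this]
    exact of_contDiff (χ := fun _ => (0 : E →L[ℝ] G)) contDiff_const U

theorem prodMk (hU : IsOpen U) {g : E × W → G'} (hf : LeafwiseCkRec k f U)
    (hg : LeafwiseCkRec k g U) : LeafwiseCkRec k (fun q => (f q, g q)) U := by
  refine ((hf.clm_comp hU (ContinuousLinearMap.inl ℝ G G')).add hU
    (hg.clm_comp hU (ContinuousLinearMap.inr ℝ G G'))).congr hU fun q _ => ?_
  simp

/-- The derivative of `f` along a vector field `v`. -/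
theorem leafDeriv_apply (hU : IsOpen U) {v : E × W → E} (hf : LeafwiseCkRec (k + 1) f U)
    (hv : LeafwiseCkRec k v U) : LeafwiseCkRec k (fun q => leafDeriv f q (v q)) U :=
  bilin hU (ContinuousLinearMap.id ℝ (E →L[ℝ] G)) hf.2.2 hv

/-- The slices of a leafwise `C^k` function are `C^k`. -/
theorem contDiffAt (hU : IsOpen U) (h : LeafwiseCkRec k f U) {q : E × W} (hq : q ∈ U) :
    ContDiffAt ℝ k (fun y => f (y, q.2)) q.1 :=
  (((leafwiseCkOn_iff hU).2 h).1 q.2).contDiffAt ((isOpen_slice hU q.2).mem_nhds hq)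

end LeafwiseCkRec

end LeafCalculus

/-- Uniform bounds, by `K` and on `U`, for a map, its derivative and the Lipschitz constant of its
derivative. -/
structure HasC2Bound {E G : Type} [NormedAddCommGroup E] [NormedSpace ℝ E]
    [NormedAddCommGroup G] [NormedSpace ℝ G] (V : E → G) (U : Set E) (K : ℝ) : Prop where
  differentiableAt : ∀ y ∈ U, DifferentiableAt ℝ V y
  norm_le : ∀ y ∈ U, ‖V y‖ ≤ K
  norm_fderiv_le : ∀ y ∈ U, ‖fderiv ℝ V y‖ ≤ K
  fderiv_sub_le : ∀ y ∈ U, ∀ y' ∈ U, ‖fderiv ℝ V y' - fderiv ℝ V y‖ ≤ K * ‖y' - y‖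

section HasC2Bound

variable {E G : Type} {W : Type*} [NormedAddCommGroup E] [NormedSpace ℝ E]
  [NormedAddCommGroup G] [NormedSpace ℝ G] [TopologicalSpace W]

theorem HasC2Bound.mono {V : E → G} {U U' : Set E} {K K' : ℝ} (h : HasC2Bound V U K)
    (hU : U' ⊆ U) (hK : K ≤ K') : HasC2Bound V U' K' where
  differentiableAt y hy := h.differentiableAt y (hU hy)
  norm_le y hy := (h.norm_le y (hU hy)).trans hK
  norm_fderiv_le y hy := (h.norm_fderiv_le y (hU hy)).trans hK
  fderiv_sub_le y hy y' hy' := (h.fderiv_sub_le y (hU hy) y' (hU hy')).trans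
    (mul_le_mul_of_nonneg_right hK (norm_nonneg _))

theorem LeafwiseCkRec.exists_hasC2Bound {f : E × W → G} {U : Set (E × W)} {A : Set E} {C : Set W}
    (h : LeafwiseCkRec 2 f U) (hA : IsCompact A) (hAc : Convex ℝ A) (hC : IsCompact C)
    (hAC : A ×ˢ C ⊆ U) : ∃ K, ∀ z ∈ C, HasC2Bound (fun y => f (y, z)) A K := by
  obtain ⟨h0, h1, h2, h3, h4⟩ := h
  have hcomp := hA.prod hC
  obtain ⟨K0, hK0⟩ := hcomp.exists_bound_of_continuousOn (h0.mono hAC)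
  obtain ⟨K1, hK1⟩ := hcomp.exists_bound_of_continuousOn (h2.mono hAC)
  obtain ⟨K2, hK2⟩ := hcomp.exists_bound_of_continuousOn (ContinuousOn.mono h4 hAC)
  refine ⟨max K0 (max K1 K2), fun z hz => ⟨fun y hy => h1 (y, z) (hAC ⟨hy, hz⟩),
    fun y hy => (hK0 (y, z) ⟨hy, hz⟩).trans (le_max_left _ _),
    fun y hy => (hK1 (y, z) ⟨hy, hz⟩).trans ((le_max_left _ _).trans (le_max_right _ _)),
    fun y hy y' hy' => ?_⟩⟩
  refine hAc.norm_image_sub_le_of_norm_fderiv_le (f := fun y => leafDeriv f (y, z))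
    (fun x hx => h3 (x, z) (hAC ⟨hx, hz⟩)) (fun x hx => ?_) hy hy'
  exact (hK2 (x, z) ⟨hx, hz⟩).trans ((le_max_right _ _).trans (le_max_right _ _))

theorem HasC2Bound.lipschitz {V : E → G} {U : Set E} {K : ℝ} (h : HasC2Bound V U K)
    (hU : Convex ℝ U) {y y' : E} (hy : y ∈ U) (hy' : y' ∈ U) : ‖V y' - V y‖ ≤ K * ‖y' - y‖ :=
  hU.norm_image_sub_le_of_norm_fderiv_le h.differentiableAt h.norm_fderiv_le hy hy'

theorem HasC2Bound.taylor {V : E → G} {U : Set E} {K : ℝ} (h : HasC2Bound V U K)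
    (hU : Convex ℝ U) {y y' : E} (hy : y ∈ U) (hy' : y' ∈ U) :
    ‖V y' - V y - fderiv ℝ V y (y' - y)‖ ≤ K * ‖y' - y‖ ^ 2 := by
  have hseg : segment ℝ y y' ⊆ U := hU.segment_subset hy hy'
  have hK : 0 ≤ K := (norm_nonneg _).trans (h.norm_le y hy)
  have := (convex_segment y y').norm_image_sub_le_of_norm_fderiv_le' (f := V) (𝕜 := ℝ)
    (φ := fderiv ℝ V y) (C := K * ‖y' - y‖) (fun x hx => h.differentiableAt x (hseg hx))
    (fun x hx => ?_) (left_mem_segment ℝ y y') (right_mem_segment ℝ y y')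
  · calc _ ≤ _ := this
      _ = _ := by ring
  · refine (h.fderiv_sub_le y hy x (hseg hx)).trans (mul_le_mul_of_nonneg_left ?_ hK)
    exact norm_sub_le_of_mem_segment hx

end HasC2Bound

/-! ### One-step maps of rough differential equations -/

/-- An increment of a (time-extended) rough path: first level, second level, and the increment of
the coordinate that drives the drift. -/
abbrev Inc (d : ℕ) : Type := (Fin d → ℝ) × (Fin d → Fin d → ℝ) × ℝ

namespace Inc

variable {d : ℕ}

/-- Chen's product of increments. -/
def chen (a b : Inc d) : Inc d :=
  (a.1 + b.1, fun j k => a.2.1 j k + b.2.1 j k + a.1 j * b.1 k, a.2.2 + b.2.2)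

/-- The inverse with respect to Chen's product. -/
def chenInv (a : Inc d) : Inc d :=
  (-a.1, fun j k => -a.2.1 j k + a.1 j * a.1 k, -a.2.2)

/-- The homogeneous size of an increment is at most `κ`, up to the constant `R`. -/
structure Size (a : Inc d) (R κ : ℝ) : Prop where
  fst : ∀ i, |a.1 i| ≤ R * κ
  snd : ∀ j k, |a.2.1 j k| ≤ R * κ ^ 2
  drift : |a.2.2| ≤ R * κ ^ 2

theorem chen_chenInv (a : Inc d) : a.chen a.chenInv = 0 := by
  refine Prod.ext ?_ (Prod.ext ?_ ?_)
  · simp [chen, chenInv]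
  · funext j k
    simp [chen, chenInv]
  · simp [chen, chenInv]

theorem Size.chenInv {a : Inc d} {R κ : ℝ} (hκ : 0 ≤ κ) (h : a.Size R κ) :
    a.chenInv.Size (R + R ^ 2) κ := by
  have e : ∀ j k, |a.1 j * a.1 k| ≤ R ^ 2 * κ ^ 2 := fun j k => by
    rw [abs_mul, ← mul_pow, sq]
    exact mul_le_mul (h.fst j) (h.fst k) (abs_nonneg _) ((abs_nonneg _).trans (h.fst j))
  refine ⟨fun i => ?_, fun j k => ?_, ?_⟩
  · have h1 := h.fst i
    simp only [Inc.chenInv, Pi.neg_apply, abs_neg]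
    nlinarith [mul_nonneg (sq_nonneg R) hκ]
  · simp only [Inc.chenInv]
    calc _ ≤ |-a.2.1 j k| + |a.1 j * a.1 k| := abs_add_le _ _
      _ ≤ R * κ ^ 2 + R ^ 2 * κ ^ 2 := by
        rw [abs_neg]
        exact add_le_add (h.snd j k) (e j k)
      _ = _ := by ring
  · simp only [Inc.chenInv, abs_neg]
    nlinarith [h.drift, mul_nonneg (sq_nonneg R) (sq_nonneg κ)]

end Inc

section RdeStep

variable {E : Type} [NormedAddCommGroup E] [NormedSpace ℝ E] {d : ℕ}

/-- The displacement of the one-step map: the second order Taylor expansion of the flow. -/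
noncomputable def rdeIncr (V : Fin d → E → E) (V₀ : E → E) (a : Inc d) (y : E) : E :=
  ∑ i, a.1 i • V i y + ∑ j, ∑ k, a.2.1 j k • fderiv ℝ (V k) y (V j y) + a.2.2 • V₀ y

/-- The one-step map of the Euler-Davie scheme. -/
noncomputable def rdeStep (V : Fin d → E → E) (V₀ : E → E) (a : Inc d) (y : E) : E :=
  y + rdeIncr V V₀ a y

theorem rdeStep_zero (V : Fin d → E → E) (V₀ : E → E) (y : E) : rdeStep V V₀ 0 y = y := by
  simp [rdeStep, rdeIncr]

theorem norm_sum_smul_le {ι : Type*} [Fintype ι] {F : Type*} [NormedAddCommGroup F]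
    [NormedSpace ℝ F] {c : ι → ℝ} {x : ι → F} {A B : ℝ} (hc : ∀ i, |c i| ≤ A)
    (hx : ∀ i, ‖x i‖ ≤ B) : ‖∑ i, c i • x i‖ ≤ Fintype.card ι * (A * B) := by
  refine (norm_sum_le _ _).trans ?_
  refine (Finset.sum_le_card_nsmul _ _ (A * B) fun i _ => ?_).trans (by simp)
  rw [norm_smul, Real.norm_eq_abs]
  exact mul_le_mul (hc i) (hx i) (norm_nonneg _) ((abs_nonneg _).trans (hc i))

theorem norm_sum_sum_smul_le {F : Type*} [NormedAddCommGroup F]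
    [NormedSpace ℝ F] {c : Fin d → Fin d → ℝ} {x : Fin d → Fin d → F} {A B : ℝ}
    (hc : ∀ j k, |c j k| ≤ A) (hx : ∀ j k, ‖x j k‖ ≤ B) :
    ‖∑ j, ∑ k, c j k • x j k‖ ≤ (d : ℝ) ^ 2 * (A * B) := by
  rw [← Finset.sum_product' Finset.univ Finset.univ (fun j k => c j k • x j k)]
  refine (norm_sum_smul_le (ι := Fin d × Fin d) (fun i => hc i.1 i.2)
    (fun i => hx i.1 i.2)).trans (le_of_eq ?_)
  simp [sq]

/-- The data `V`, `V₀` satisfies second order bounds on `U`. -/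
structure FieldBound (V : Fin d → E → E) (V₀ : E → E) (U : Set E) (K : ℝ) : Prop where
  diffusion : ∀ i, HasC2Bound (V i) U K
  drift : HasC2Bound V₀ U K

namespace FieldBound

variable {V : Fin d → E → E} {V₀ : E → E} {U : Set E} {K R κ : ℝ} {a b : Inc d} {y y' : E}

theorem mono {U' : Set E} {K' : ℝ} (h : FieldBound V V₀ U K)
    (hU : U' ⊆ U) (hK : K ≤ K') : FieldBound V V₀ U' K' :=
  ⟨fun i => (h.diffusion i).mono hU hK, h.drift.mono hU hK⟩

theorem nonneg (h : FieldBound V V₀ U K) (hy : y ∈ U) : 0 ≤ K :=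
  (norm_nonneg _).trans (h.drift.norm_le y hy)

theorem norm_covDeriv_le (h : FieldBound V V₀ U K) (hy : y ∈ U) (j k : Fin d) :
    ‖fderiv ℝ (V k) y (V j y)‖ ≤ K ^ 2 := by
  refine (ContinuousLinearMap.le_opNorm _ _).trans ?_
  rw [sq]
  exact mul_le_mul ((h.diffusion k).norm_fderiv_le y hy) ((h.diffusion j).norm_le y hy)
    (norm_nonneg _) (h.nonneg hy)

theorem norm_covDeriv_sub_le (h : FieldBound V V₀ U K) (hU : Convex ℝ U) (hy : y ∈ U)
    (hy' : y' ∈ U) (j k : Fin d) :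
    ‖fderiv ℝ (V k) y' (V j y') - fderiv ℝ (V k) y (V j y)‖ ≤ 2 * K ^ 2 * ‖y' - y‖ := by
  have e : fderiv ℝ (V k) y' (V j y') - fderiv ℝ (V k) y (V j y) =
      (fderiv ℝ (V k) y' - fderiv ℝ (V k) y) (V j y') + fderiv ℝ (V k) y (V j y' - V j y) := by
    simp
  rw [e]
  have hK := h.nonneg hy
  have h1 : ‖(fderiv ℝ (V k) y' - fderiv ℝ (V k) y) (V j y')‖ ≤ (K * ‖y' - y‖) * K :=
    (ContinuousLinearMap.le_opNorm _ _).trans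
      (mul_le_mul ((h.diffusion k).fderiv_sub_le y hy y' hy') ((h.diffusion j).norm_le y' hy')
        (norm_nonneg _) (by positivity))
  have h2 : ‖fderiv ℝ (V k) y (V j y' - V j y)‖ ≤ K * (K * ‖y' - y‖) :=
    (ContinuousLinearMap.le_opNorm _ _).trans
      (mul_le_mul ((h.diffusion k).norm_fderiv_le y hy) ((h.diffusion j).lipschitz hU hy hy')
        (norm_nonneg _) hK)
  calc _ ≤ _ := norm_add_le _ _
    _ ≤ _ := add_le_add h1 h2
    _ = _ := by ring

/-- The part of the displacement that is of second order in the size of the increment. -/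
theorem norm_second_order_le (h : FieldBound V V₀ U K) (ha : a.Size R κ) (hy : y ∈ U) :
    ‖∑ j, ∑ k, a.2.1 j k • fderiv ℝ (V k) y (V j y) + a.2.2 • V₀ y‖ ≤
      R * (d ^ 2 * K ^ 2 + K) * κ ^ 2 := by
  have h1 := norm_sum_sum_smul_le (fun j k => ha.snd j k) (fun j k => h.norm_covDeriv_le hy j k)
  have h2 : ‖a.2.2 • V₀ y‖ ≤ R * κ ^ 2 * K := by
    rw [norm_smul, Real.norm_eq_abs]
    exact mul_le_mul ha.drift (h.drift.norm_le y hy) (norm_nonneg _)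
      ((abs_nonneg _).trans ha.drift)
  calc _ ≤ _ := norm_add_le _ _
    _ ≤ _ := add_le_add h1 h2
    _ = _ := by ring

theorem norm_rdeIncr_le (h : FieldBound V V₀ U K) (hR : 0 ≤ R) (hκ : 0 ≤ κ) (hκ1 : κ ≤ 1)
    (ha : a.Size R κ) (hy : y ∈ U) :
    ‖rdeIncr V V₀ a y‖ ≤ R * (d * K + 2 * d ^ 2 * K ^ 2 + K) * κ := by
  have hK := h.nonneg hy
  have h1 : ‖∑ i, a.1 i • V i y‖ ≤ d * (R * κ * K) := by
    simpa using norm_sum_smul_le ha.fst (fun i => (h.diffusion i).norm_le y hy)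
  have h2 := h.norm_second_order_le ha hy
  have h3 : R * (d ^ 2 * K ^ 2 + K) * κ ^ 2 ≤ R * (d ^ 2 * K ^ 2 + K) * κ :=
    mul_le_mul_of_nonneg_left (by nlinarith) (by positivity)
  have h4 : 0 ≤ R * (d ^ 2 * K ^ 2) * κ := by positivity
  unfold rdeIncr
  rw [add_assoc]
  calc _ ≤ _ := norm_add_le _ _
    _ ≤ _ := add_le_add h1 (h2.trans h3)
    _ ≤ _ := by nlinarith

theorem norm_rdeIncr_sub_le (h : FieldBound V V₀ U K) (hU : Convex ℝ U) (hR : 0 ≤ R)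
    (hκ : 0 ≤ κ) (hκ1 : κ ≤ 1) (ha : a.Size R κ) (hy : y ∈ U) (hy' : y' ∈ U) :
    ‖rdeIncr V V₀ a y' - rdeIncr V V₀ a y‖ ≤
      R * (d * K + 2 * d ^ 2 * K ^ 2 + K) * κ * ‖y' - y‖ := by
  have hK := h.nonneg hy
  have e : rdeIncr V V₀ a y' - rdeIncr V V₀ a y = ∑ i, a.1 i • (V i y' - V i y) +
      ∑ j, ∑ k, a.2.1 j k • (fderiv ℝ (V k) y' (V j y') - fderiv ℝ (V k) y (V j y)) +
      a.2.2 • (V₀ y' - V₀ y) := by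
    simp only [rdeIncr, smul_sub, Finset.sum_sub_distrib]
    abel
  have h1 : ‖∑ i, a.1 i • (V i y' - V i y)‖ ≤ d * (R * κ * (K * ‖y' - y‖)) := by
    simpa using norm_sum_smul_le ha.fst (fun i => (h.diffusion i).lipschitz hU hy hy')
  have h2 := norm_sum_sum_smul_le (fun j k => ha.snd j k)
    (fun j k => h.norm_covDeriv_sub_le hU hy hy' j k)
  have h3 : ‖a.2.2 • (V₀ y' - V₀ y)‖ ≤ R * κ ^ 2 * (K * ‖y' - y‖) := by
    rw [norm_smul, Real.norm_eq_abs]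
    exact mul_le_mul ha.drift (h.drift.lipschitz hU hy hy') (norm_nonneg _)
      ((abs_nonneg _).trans ha.drift)
  have h4 : (R * (2 * d ^ 2 * K ^ 2 + K) * ‖y' - y‖) * κ ^ 2 ≤
      (R * (2 * d ^ 2 * K ^ 2 + K) * ‖y' - y‖) * κ :=
    mul_le_mul_of_nonneg_left (by nlinarith) (by positivity)
  rw [e]
  calc _ ≤ _ := norm_add₃_le
    _ ≤ _ := add_le_add (add_le_add h1 h2) h3
    _ ≤ _ := by nlinarith

/-- The one-step maps form an approximate flow: composition agrees with Chen's product up to the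
third order. -/
theorem norm_rdeStep_chen_le (h : FieldBound V V₀ U K) (hU : Convex ℝ U) (hR : 0 ≤ R)
    (hκ : 0 ≤ κ) (hκ1 : κ ≤ 1) (ha : a.Size R κ) (hb : b.Size R κ) (hy : y ∈ U)
    (hy' : rdeStep V V₀ a y ∈ U) {c : ℝ} (hc : c = R * (d * K + 2 * d ^ 2 * K ^ 2 + K)) :
    ‖rdeStep V V₀ b (rdeStep V V₀ a y) - rdeStep V V₀ (a.chen b) y‖ ≤
      (d * R * K * (c ^ 2 + c) + c ^ 2) * κ ^ 3 := by
  have hK := h.nonneg hy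
  have hc0 : 0 ≤ c := by rw [hc]; positivity
  set y' := rdeStep V V₀ a y with hy'def
  have hd : y' - y = rdeIncr V V₀ a y := by simp [hy'def, rdeStep]
  set r := ∑ j, ∑ k, a.2.1 j k • fderiv ℝ (V k) y (V j y) + a.2.2 • V₀ y with hr
  have hdn : ‖y' - y‖ ≤ c * κ := by
    rw [hd, hc]; exact h.norm_rdeIncr_le hR hκ hκ1 ha hy
  have hrn : ‖r‖ ≤ c * κ ^ 2 := by
    refine (h.norm_second_order_le ha hy).trans (mul_le_mul_of_nonneg_right ?_ (sq_nonneg _))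
    rw [hc]
    refine mul_le_mul_of_nonneg_left ?_ hR
    have : 0 ≤ (d : ℝ) * K := by positivity
    have : 0 ≤ (d : ℝ) ^ 2 * K ^ 2 := by positivity
    linarith
  have hdr : y' - y - r = ∑ i, a.1 i • V i y := by
    rw [hd, hr, rdeIncr]; abel
  have e : rdeStep V V₀ b y' - rdeStep V V₀ (a.chen b) y =
      ∑ i, b.1 i • ((V i y' - V i y - fderiv ℝ (V i) y (y' - y)) + fderiv ℝ (V i) y r) +
      ∑ j, ∑ k, b.2.1 j k • (fderiv ℝ (V k) y' (V j y') - fderiv ℝ (V k) y (V j y)) +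
      b.2.2 • (V₀ y' - V₀ y) := by
    have e1 : ∑ i, b.1 i • ((V i y' - V i y - fderiv ℝ (V i) y (y' - y)) +
        fderiv ℝ (V i) y r) = ∑ i, b.1 i • (V i y' - V i y) -
        ∑ j, ∑ k, (a.1 j * b.1 k) • fderiv ℝ (V k) y (V j y) := by
      rw [Finset.sum_comm, ← Finset.sum_sub_distrib]
      refine Finset.sum_congr rfl fun i _ => ?_
      have : fderiv ℝ (V i) y (y' - y) - fderiv ℝ (V i) y r =
          ∑ j, a.1 j • fderiv ℝ (V i) y (V j y) := by
        rw [← map_sub, hdr, map_sum]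
        simp
      rw [sub_add, this, smul_sub, Finset.smul_sum]
      congr 1
      refine Finset.sum_congr rfl fun j _ => ?_
      rw [smul_smul, mul_comm]
    have e2 : rdeStep V V₀ b y' - rdeStep V V₀ (a.chen b) y =
        (y' - y) + rdeIncr V V₀ b y' - rdeIncr V V₀ (a.chen b) y := by
      simp only [rdeStep]; abel
    rw [e1, e2, hd]
    simp only [rdeIncr, Inc.chen, Pi.add_apply, add_smul, smul_sub, Finset.sum_sub_distrib,
      Finset.sum_add_distrib]
    abel
  have h1 : ‖∑ i, b.1 i • ((V i y' - V i y - fderiv ℝ (V i) y (y' - y)) +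
      fderiv ℝ (V i) y r)‖ ≤ d * (R * κ * (K * (c * κ) ^ 2 + K * (c * κ ^ 2))) := by
    refine (norm_sum_smul_le (B := K * (c * κ) ^ 2 + K * (c * κ ^ 2)) hb.fst
      (fun i => ?_)).trans (by simp)
    refine (norm_add_le _ _).trans (add_le_add ?_ ?_)
    · refine ((h.diffusion i).taylor hU hy hy').trans (mul_le_mul_of_nonneg_left ?_ hK)
      exact pow_le_pow_left₀ (norm_nonneg _) hdn 2
    · exact (ContinuousLinearMap.le_opNorm _ _).trans (mul_le_mul
        ((h.diffusion i).norm_fderiv_le y hy) hrn (norm_nonneg _) hK)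
  have h2 := norm_sum_sum_smul_le (fun j k => hb.snd j k)
    (fun j k => (h.norm_covDeriv_sub_le hU hy hy' j k).trans
      (mul_le_mul_of_nonneg_left hdn (by positivity)))
  have h3 : ‖b.2.2 • (V₀ y' - V₀ y)‖ ≤ R * κ ^ 2 * (K * (c * κ)) := by
    rw [norm_smul, Real.norm_eq_abs]
    exact mul_le_mul hb.drift ((h.drift.lipschitz hU hy hy').trans
      (mul_le_mul_of_nonneg_left hdn hK)) (norm_nonneg _) ((abs_nonneg _).trans hb.drift)
  rw [e]
  calc _ ≤ _ := norm_add₃_le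
    _ ≤ _ := add_le_add (add_le_add h1 h2) h3
    _ = (d * R * K * (c ^ 2 + c) + (R * (2 * d ^ 2 * K ^ 2 + K)) * c) * κ ^ 3 := by ring
    _ ≤ _ := by
      refine mul_le_mul_of_nonneg_right ?_ (by positivity)
      have : 0 ≤ R * (d * K) * c := by positivity
      nlinarith

end FieldBound

/-- The lift of a vector field to the tangent bundle. -/
noncomputable def tangentField (V : E → E) (q : E × E) : E × E := (V q.1, fderiv ℝ V q.1 q.2)

theorem fderiv_tangentField {V : E → E} {y : E} (hV : ContDiffAt ℝ 2 V y) (v u u' : E) :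
    fderiv ℝ (tangentField V) (y, v) (u, u') =
      (fderiv ℝ V y u, fderiv ℝ (fderiv ℝ V) y u v + fderiv ℝ V y u') := by
  have h1 : HasFDerivAt (fun q : E × E => V q.1)
      ((fderiv ℝ V y).comp (ContinuousLinearMap.fst ℝ E E)) (y, v) :=
    HasFDerivAt.comp (g := V) (y, v) (hV.differentiableAt (by norm_num)).hasFDerivAt hasFDerivAt_fst
  have hV' : DifferentiableAt ℝ (fderiv ℝ V) y :=
    (hV.fderiv_right (m := 1) (by norm_num)).differentiableAt (by norm_num)
  have h2 : HasFDerivAt (fun q : E × E => fderiv ℝ V q.1)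
      ((fderiv ℝ (fderiv ℝ V) y).comp (ContinuousLinearMap.fst ℝ E E)) (y, v) :=
    HasFDerivAt.comp (g := fderiv ℝ V) (y, v) hV'.hasFDerivAt hasFDerivAt_fst
  have h3 := h1.prodMk (h2.clm_apply hasFDerivAt_snd)
  have h4 : fderiv ℝ (tangentField V) (y, v) = _ := h3.fderiv
  rw [h4]
  simp [add_comm]

/-- The one-step map of the lifted equation is the tangent map of the one-step map. -/
theorem rdeStep_tangentField {V : Fin d → E → E} {V₀ : E → E} {y : E}
    (hV : ∀ i, ContDiffAt ℝ 2 (V i) y) (hV₀ : DifferentiableAt ℝ V₀ y) (a : Inc d) (v : E) :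
    DifferentiableAt ℝ (rdeStep V V₀ a) y ∧
    rdeStep (fun i => tangentField (V i)) (tangentField V₀) a (y, v) =
      (rdeStep V V₀ a y, fderiv ℝ (rdeStep V V₀ a) y v) := by
  have hV1 : ∀ i, DifferentiableAt ℝ (V i) y := fun i => (hV i).differentiableAt (by norm_num)
  have hV2 : ∀ i, DifferentiableAt ℝ (fderiv ℝ (V i)) y := fun i =>
    ((hV i).fderiv_right (m := 1) (by norm_num)).differentiableAt (by norm_num)
  have hs : ∀ i u u', fderiv ℝ (fderiv ℝ (V i)) y u u' = fderiv ℝ (fderiv ℝ (V i)) y u' u :=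
    fun i u u' => ((hV i).isSymmSndFDerivAt (by simp)).eq u u'
  have hD : HasFDerivAt (rdeStep V V₀ a)
      (ContinuousLinearMap.id ℝ E + (∑ i, a.1 i • fderiv ℝ (V i) y +
        ∑ j, ∑ k, a.2.1 j k • ((fderiv ℝ (V k) y).comp (fderiv ℝ (V j) y) +
          (fderiv ℝ (fderiv ℝ (V k)) y).flip (V j y)) + a.2.2 • fderiv ℝ V₀ y)) y := by
    refine (hasFDerivAt_id y).add (((HasFDerivAt.fun_sum fun i _ =>
      (hV1 i).hasFDerivAt.const_smul (a.1 i)).add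
      (HasFDerivAt.fun_sum fun j _ => HasFDerivAt.fun_sum fun k _ => ?_)).add
      (hV₀.hasFDerivAt.const_smul a.2.2))
    exact ((hV2 k).hasFDerivAt.clm_apply (hV1 j).hasFDerivAt).const_smul (a.2.1 j k)
  refine ⟨hD.differentiableAt, ?_⟩
  rw [hD.fderiv]
  simp only [rdeStep, rdeIncr]
  have e1 : ∀ j k, fderiv ℝ (tangentField (V k)) (y, v) (tangentField (V j) (y, v)) =
      (fderiv ℝ (V k) y (V j y), fderiv ℝ (fderiv ℝ (V k)) y (V j y) v +
        fderiv ℝ (V k) y (fderiv ℝ (V j) y v)) := fun j k => by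
    rw [tangentField, fderiv_tangentField (hV k)]
  simp only [e1]
  refine Prod.ext ?_ ?_
  · simp [tangentField, Prod.fst_sum]
  · simp only [tangentField, Prod.snd_add, Prod.snd_sum, Prod.smul_snd, _root_.add_apply,
      sum_apply, smul_apply,
      ContinuousLinearMap.comp_apply, ContinuousLinearMap.flip_apply,
      ContinuousLinearMap.id_apply]
    congr 3
    refine Finset.sum_congr rfl fun j _ => Finset.sum_congr rfl fun k _ => ?_
    rw [hs k (V j y) v, add_comm]

end RdeStep

/-! ### Approximate flows and their Euler schemes -/

theorem tendsto_nat_mul_div_rpow {θ τ : ℝ} (hθ : 1 < θ) (hτ : 0 ≤ τ) (K : ℝ) :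
    Filter.Tendsto (fun n : ℕ => (n : ℝ) * (K * (τ / n) ^ θ)) Filter.atTop (nhds 0) := by
  have h1 : Filter.Tendsto (fun n : ℕ => K * τ ^ θ * (n : ℝ) ^ (-(θ - 1))) Filter.atTop
      (nhds (K * τ ^ θ * 0)) :=
    ((tendsto_rpow_neg_atTop (by linarith)).comp tendsto_natCast_atTop_atTop).const_mul _
  rw [mul_zero] at h1
  refine h1.congr' ?_
  filter_upwards [Filter.eventually_gt_atTop 0] with n hn
  have hn0 : (0 : ℝ) < n := by exact_mod_cast hn
  rw [Real.div_rpow hτ hn0.le, neg_sub, Real.rpow_sub hn0, Real.rpow_one]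
  field_simp

theorem exists_forall_mul_rpow_le {α : ℝ} (hα : 0 < α) (c : ℝ) {ε : ℝ} (hε : 0 < ε) :
    ∃ δ > 0, ∀ x : ℝ, 0 ≤ x → x ≤ δ → c * x ^ α ≤ ε := by
  have h : ContinuousAt (fun x : ℝ => c * x ^ α) 0 :=
    continuousAt_const.mul (Real.continuousAt_rpow_const 0 α (Or.inr hα.le))
  obtain ⟨δ, hδ, H⟩ := Metric.continuousAt_iff.1 h ε hε
  refine ⟨δ / 2, half_pos hδ, fun x hx hxδ => ?_⟩
  have := H (x := x) (by rw [Real.dist_eq, sub_zero, abs_of_nonneg hx]; linarith)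
  rw [Real.zero_rpow hα.ne', mul_zero, Real.dist_eq, sub_zero] at this
  exact (le_abs_self _).trans this.le

/-- The Euler scheme: `n` steps of size `h`, starting at time `s`. -/
def euler {X : Type*} (μ : ℝ → ℝ → X → X) : ℝ → ℝ → ℕ → X → X
  | _, _, 0, y => y
  | s, h, n + 1, y => euler μ (s + h) h n (μ s (s + h) y)

theorem euler_succ {X : Type*} (μ : ℝ → ℝ → X → X) (s h : ℝ) (n : ℕ) (y : X) :
    euler μ s h (n + 1) y = μ (s + n * h) (s + (n + 1 : ℕ) * h) (euler μ s h n y) := by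
  induction n generalizing s y with
  | zero => simp [euler]
  | succ n ih =>
    have h1 := ih (s + h) (μ s (s + h) y)
    rw [euler, h1, euler]
    congr 1 <;> push_cast <;> ring

section ApproxFlow

variable {E : Type} [NormedAddCommGroup E]

/-- A family of maps `μ s t`, `a ≤ s ≤ t ≤ b`, that is close to the identity and satisfies the flow
property up to an error of order `(t - s) ^ (3 α)`. -/
structure ApproxFlowOn (μ : ℝ → ℝ → E → E) (U : Set E) (a b c α : ℝ) : Prop where
  disp : ∀ s t y, a ≤ s → s ≤ t → t ≤ b → y ∈ U → ‖μ s t y - y‖ ≤ c * (t - s) ^ α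
  lip : ∀ s t y y', a ≤ s → s ≤ t → t ≤ b → y ∈ U → y' ∈ U →
    ‖μ s t y' - μ s t y‖ ≤ (1 + c * (t - s) ^ α) * ‖y' - y‖
  comp : ∀ s u t y, a ≤ s → s ≤ u → u ≤ t → t ≤ b → y ∈ U → μ s u y ∈ U →
    ‖μ u t (μ s u y) - μ s t y‖ ≤ c * (t - s) ^ (3 * α)

theorem ApproxFlowOn.mono {μ : ℝ → ℝ → E → E} {U U' : Set E} {a b a' b' c α : ℝ}
    (h : ApproxFlowOn μ U a b c α) (hU : U' ⊆ U) (ha : a ≤ a') (hb : b' ≤ b) :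
    ApproxFlowOn μ U' a' b' c α where
  disp s t y h1 h2 h3 hy := h.disp s t y (ha.trans h1) h2 (h3.trans hb) (hU hy)
  lip s t y y' h1 h2 h3 hy hy' := h.lip s t y y' (ha.trans h1) h2 (h3.trans hb) (hU hy) (hU hy')
  comp s u t y h1 h2 h3 h4 hy hy' :=
    h.comp s u t y (ha.trans h1) h2 h3 (h4.trans hb) (hU hy) (hU hy')

/-- The inductive step in Davie's estimate: a step from `t₁` to `t₂` in between two intervals of at
most half the length. -/
theorem ApproxFlowOn.davie_step {μ : ℝ → ℝ → E → E} {U : Set E} {a b c α η q C : ℝ}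
    (h : ApproxFlowOn μ U a b c α) (hη : ∀ s t, a ≤ s → s ≤ t → t ≤ b → c * (t - s) ^ α ≤ η)
    (hc : 0 ≤ c) (hη0 : 0 ≤ η) (hη1 : η ≤ 1) (hα : 0 < α)
    (hq : (2 + 3 * η) * q * C + 3 * c ≤ C)
    {t₀ t₁ t₂ t₃ : ℝ} (h0 : a ≤ t₀) (h01 : t₀ ≤ t₁) (h12 : t₁ ≤ t₂) (h23 : t₂ ≤ t₃) (h3 : t₃ ≤ b)
    {p₀ p₁ p₂ p₃ : E} (hp₀ : p₀ ∈ U) (hp₁ : p₁ ∈ U) (hp₂ : p₂ ∈ U)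
    (hμ1 : μ t₀ t₁ p₀ ∈ U) (hμ2 : μ t₀ t₂ p₀ ∈ U) (hp : p₂ = μ t₁ t₂ p₁)
    (hJ1 : ‖p₁ - μ t₀ t₁ p₀‖ ≤ q * C * (t₃ - t₀) ^ (3 * α))
    (hJ2 : ‖p₃ - μ t₂ t₃ p₂‖ ≤ q * C * (t₃ - t₀) ^ (3 * α)) :
    ‖p₃ - μ t₀ t₃ p₀‖ ≤ C * (t₃ - t₀) ^ (3 * α) := by
  set X := (t₃ - t₀) ^ (3 * α) with hX
  have hX0 : 0 ≤ X := Real.rpow_nonneg (by linarith) _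
  have hlip : ∀ s t y y', a ≤ s → s ≤ t → t ≤ b → y ∈ U → y' ∈ U →
      ‖μ s t y' - μ s t y‖ ≤ (1 + η) * ‖y' - y‖ := fun s t y y' h1 h2 h3 hy hy' =>
    (h.lip s t y y' h1 h2 h3 hy hy').trans
      (mul_le_mul_of_nonneg_right (by linarith [hη s t h1 h2 h3]) (norm_nonneg _))
  have hA : ‖p₂ - μ t₀ t₂ p₀‖ ≤ (1 + η) * (q * C * X) + c * X := by
    have e : p₂ - μ t₀ t₂ p₀ = (μ t₁ t₂ p₁ - μ t₁ t₂ (μ t₀ t₁ p₀)) +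
        (μ t₁ t₂ (μ t₀ t₁ p₀) - μ t₀ t₂ p₀) := by rw [hp]; abel
    rw [e]
    refine (norm_add_le _ _).trans (add_le_add ?_ ?_)
    · exact (hlip _ _ _ _ (by linarith) h12 (by linarith) hμ1 hp₁).trans
        (mul_le_mul_of_nonneg_left hJ1 (by linarith))
    · refine (h.comp _ _ _ _ h0 h01 h12 (by linarith) hp₀ hμ1).trans
        (mul_le_mul_of_nonneg_left ?_ hc)
      exact Real.rpow_le_rpow (by linarith) (by linarith) (by linarith)
  have e : p₃ - μ t₀ t₃ p₀ = (p₃ - μ t₂ t₃ p₂) + (μ t₂ t₃ p₂ - μ t₂ t₃ (μ t₀ t₂ p₀)) +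
      (μ t₂ t₃ (μ t₀ t₂ p₀) - μ t₀ t₃ p₀) := by abel
  rw [e]
  have hB : ‖μ t₂ t₃ p₂ - μ t₂ t₃ (μ t₀ t₂ p₀)‖ ≤ (1 + η) * ((1 + η) * (q * C * X) + c * X) :=
    (hlip _ _ _ _ (by linarith) h23 h3 hμ2 hp₂).trans (mul_le_mul_of_nonneg_left hA (by linarith))
  have hD := h.comp _ _ _ _ h0 (h01.trans h12) h23 h3 hp₀ hμ2
  have hqCX : 0 ≤ q * C * X := (norm_nonneg _).trans hJ1
  have hη2 : η ^ 2 ≤ η := by nlinarith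
  calc _ ≤ _ := norm_add₃_le
    _ ≤ q * C * X + (1 + η) * ((1 + η) * (q * C * X) + c * X) + c * X :=
      add_le_add (add_le_add hJ2 hB) hD
    _ ≤ ((2 + 3 * η) * q * C + 3 * c) * X := by
      have h1 : η ^ 2 * (q * C * X) ≤ η * (q * C * X) := mul_le_mul_of_nonneg_right hη2 hqCX
      have h2 : η * (c * X) ≤ 1 * (c * X) := mul_le_mul_of_nonneg_right hη1 (by positivity)
      nlinarith
    _ ≤ C * X := mul_le_mul_of_nonneg_right hq hX0

/-- Davie's estimate for Euler schemes on short time intervals: they stay close to their starting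
point and follow the approximate flow up to an error of order `3 α`, uniformly in the step size. -/
theorem exists_davie_constants (E : Type) [NormedAddCommGroup E] {c α r : ℝ} (hc : 0 ≤ c)
    (hα : 1 / 3 < α) (hr : 0 < r) :
    ∃ δ > 0, ∃ C ≥ 0, ∀ (μ : ℝ → ℝ → E → E) (y₀ : E) (a b : ℝ), b - a ≤ δ →
      ApproxFlowOn μ (Metric.closedBall y₀ (2 * r)) a b c α →
      ∀ (h : ℝ) (n : ℕ), 0 ≤ h → a + n * h ≤ b →
        (∀ k ≤ n, euler μ a h k y₀ ∈ Metric.closedBall y₀ r) ∧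
        ∀ i j, i ≤ j → j ≤ n →
          ‖euler μ a h j y₀ - μ (a + i * h) (a + j * h) (euler μ a h i y₀)‖ ≤
            C * ((a + j * h) - (a + i * h)) ^ (3 * α) := by
  have hα0 : 0 < α := by linarith
  set q : ℝ := (1 / 2) ^ (3 * α) with hq
  have hq0 : 0 < q := by positivity
  have hq1 : q < 1 / 2 := by
    have := Real.rpow_lt_rpow_of_exponent_gt (x := (1 / 2 : ℝ)) (y := 3 * α) (z := 1)
      (by norm_num) (by norm_num) (by linarith)
    exact this.trans_eq (Real.rpow_one _)
  -- the factor `2 q < 1` gains over two halves; `η` leaves half of the gain for the distortion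
  set η : ℝ := (1 - 2 * q) / 6 with hη
  have hη0 : 0 < η := by rw [hη]; linarith
  have hη1 : η ≤ 1 := by rw [hη]; linarith
  have hgap : 0 < 1 - (2 + 3 * η) * q := by
    have : 3 * η * q ≤ 3 * η * 1 := mul_le_mul_of_nonneg_left (by linarith) (by linarith)
    nlinarith
  set C : ℝ := 3 * c / (1 - (2 + 3 * η) * q) with hC
  have hC0 : 0 ≤ C := by positivity
  have hCq : (2 + 3 * η) * q * C + 3 * c ≤ C := by
    have : C * (1 - (2 + 3 * η) * q) = 3 * c := div_mul_cancel₀ _ hgap.ne'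
    linarith
  obtain ⟨δ₁, hδ₁, H₁⟩ := exists_forall_mul_rpow_le hα0 c (lt_min hη0 (half_pos hr))
  obtain ⟨δ₂, hδ₂, H₂⟩ := exists_forall_mul_rpow_le (α := 3 * α) (by linarith) C (half_pos hr)
  refine ⟨min δ₁ δ₂, lt_min hδ₁ hδ₂, C, hC0, ?_⟩
  intro μ y₀ a b hab hμ h n hh hn
  have hsmall : ∀ s t, a ≤ s → s ≤ t → t ≤ b → c * (t - s) ^ α ≤ min η (r / 2) :=
    fun s t h1 h2 h3 => H₁ _ (by linarith) ((by linarith : t - s ≤ b - a).trans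
      (hab.trans (min_le_left _ _)))
  have hsmall2 : ∀ s t, a ≤ s → s ≤ t → t ≤ b → C * (t - s) ^ (3 * α) ≤ r / 2 :=
    fun s t h1 h2 h3 => H₂ _ (by linarith) ((by linarith : t - s ≤ b - a).trans
      (hab.trans (min_le_right _ _)))
  set Y : ℕ → E := fun k => euler μ a h k y₀ with hY
  set τ : ℕ → ℝ := fun k => a + k * h with hτ
  have hτmono : ∀ {i j : ℕ}, i ≤ j → τ i ≤ τ j := fun {i j} hij => by
    have : (i : ℝ) ≤ j := by exact_mod_cast hij
    simp only [hτ]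
    nlinarith
  have hτa : ∀ i, a ≤ τ i := fun i => by
    have := hτmono (Nat.zero_le i)
    simpa [hτ] using this
  have hτb : ∀ {i : ℕ}, i ≤ n → τ i ≤ b := fun hi => (hτmono hi).trans hn
  have hsub : Metric.closedBall y₀ r ⊆ Metric.closedBall y₀ (2 * r) :=
    Metric.closedBall_subset_closedBall (by linarith)
  have hμmem : ∀ s t y, a ≤ s → s ≤ t → t ≤ b → y ∈ Metric.closedBall y₀ r →
      μ s t y ∈ Metric.closedBall y₀ (2 * r) := fun s t y h1 h2 h3 hy => by
    have e := (hμ.disp s t y h1 h2 h3 (hsub hy)).trans ((hsmall s t h1 h2 h3).trans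
      (min_le_right _ _))
    rw [Metric.mem_closedBall] at hy ⊢
    calc _ ≤ dist (μ s t y) y + dist y y₀ := dist_triangle _ _ _
      _ ≤ r / 2 + r := add_le_add (by rwa [dist_eq_norm]) hy
      _ ≤ 2 * r := by linarith
  have hstep : ∀ k, Y (k + 1) = μ (τ k) (τ (k + 1)) (Y k) := fun k => euler_succ μ a h k y₀
  have main : ∀ j₀ ≤ n, (∀ k < j₀, Y k ∈ Metric.closedBall y₀ r) → ∀ l i, i + l ≤ j₀ → i < j₀ →
      ‖Y (i + l) - μ (τ i) (τ (i + l)) (Y i)‖ ≤ C * (τ (i + l) - τ i) ^ (3 * α) := by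
    intro j₀ hj₀ hmem l
    induction l using Nat.strong_induction_on with
    | _ l ih =>
      intro i hil hi
      have hCn : 0 ≤ C * (τ (i + l) - τ i) ^ (3 * α) :=
        mul_nonneg hC0 (Real.rpow_nonneg (sub_nonneg.2 (hτmono (by omega))) _)
      rcases Nat.lt_or_ge l 2 with hl | hl
      · interval_cases l
        · have := hμ.disp (τ i) (τ i) (Y i) (hτa i) le_rfl (hτb (by omega)) (hsub (hmem i hi))
          rw [sub_self, Real.zero_rpow hα0.ne', mul_zero] at this
          rw [norm_sub_rev] at this
          exact this.trans hCn
        · rw [← hstep, sub_self, norm_zero]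
          exact hCn
      · set m := (l - 1) / 2 with hm
        have hm1 : 2 * m ≤ l := by omega
        have hm2 : 2 * (l - (m + 1)) ≤ l := by omega
        have hhalf : ∀ u v x : ℕ, u ≤ v → 2 * (v - u) ≤ l →
            C * (τ v - τ u) ^ (3 * α) ≤ q * C * (τ (i + l) - τ i) ^ (3 * α) := by
          intro u v _ huv hlen
          rw [mul_comm q C, mul_assoc, hq, ← Real.mul_rpow (by norm_num)
            (sub_nonneg.2 (hτmono (by omega)))]
          refine mul_le_mul_of_nonneg_left (Real.rpow_le_rpow (sub_nonneg.2 (hτmono huv)) ?_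
            (by linarith)) hC0
          have h1 : (2 : ℝ) * (v - u) ≤ l := by
            rw [← Nat.cast_sub huv]; exact_mod_cast hlen
          simp only [hτ]
          push_cast
          nlinarith
        have j1 := ih m (by omega) i (by omega) hi
        have j2 := ih (l - (m + 1)) (by omega) (i + m + 1) (by omega) (by omega)
        have e : i + m + 1 + (l - (m + 1)) = i + l := by omega
        rw [e] at j2
        exact hμ.davie_step (fun s t h1 h2 h3 => (hsmall s t h1 h2 h3).trans (min_le_left _ _)) hc
          hη0.le hη1 hα0 hCq (hτa i) (hτmono (by omega)) (hτmono (Nat.le_succ (i + m)))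
          (hτmono (by omega)) (hτb (by omega)) (hsub (hmem i hi)) (hsub (hmem (i + m) (by omega)))
          (hsub (hmem (i + m + 1) (by omega)))
          (hμmem _ _ _ (hτa i) (hτmono (by omega)) (hτb (by omega)) (hmem i hi))
          (hμmem _ _ _ (hτa i) (hτmono (by omega)) (hτb (by omega)) (hmem i hi))
          (hstep (i + m)) (j1.trans (hhalf _ _ 0 (by omega) (by omega)))
          (j2.trans (hhalf _ _ 0 (by omega) (by omega)))
  have hmem : ∀ k ≤ n, Y k ∈ Metric.closedBall y₀ r := by
    intro k
    induction k using Nat.strong_induction_on with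
    | _ k ih =>
      intro hk
      rcases Nat.eq_zero_or_pos k with rfl | hpos
      · simpa [hY, euler] using hr.le
      · have h1 := main k hk (fun l hl => ih l hl (by omega)) k 0 (by omega) hpos
        rw [zero_add] at h1
        have h2 := h1.trans (hsmall2 _ _ (hτa 0) (hτmono (Nat.zero_le k)) (hτb hk))
        have h0 : Y 0 = y₀ := rfl
        rw [h0] at h2
        have h3 := (hμ.disp (τ 0) (τ k) y₀ (hτa 0) (hτmono (Nat.zero_le k)) (hτb hk)
          (Metric.mem_closedBall_self (by linarith))).trans ((hsmall _ _ (hτa 0)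
          (hτmono (Nat.zero_le k)) (hτb hk)).trans (min_le_right _ _))
        rw [Metric.mem_closedBall, dist_eq_norm]
        calc ‖Y k - y₀‖ = ‖(Y k - μ (τ 0) (τ k) y₀) + (μ (τ 0) (τ k) y₀ - y₀)‖ := by
              congr 1; abel
          _ ≤ r / 2 + r / 2 := (norm_add_le _ _).trans (add_le_add h2 h3)
          _ = r := add_halves r
  refine ⟨hmem, fun i j hij hj => ?_⟩
  obtain ⟨l, rfl⟩ := Nat.exists_eq_add_of_le hij
  rcases Nat.eq_zero_or_pos l with rfl | hl
  · have := hμ.disp (τ i) (τ i) (Y i) (hτa i) le_rfl (hτb (by omega)) (hsub (hmem i (by omega)))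
    rw [sub_self, Real.zero_rpow hα0.ne', mul_zero, norm_sub_rev] at this
    exact this.trans (mul_nonneg hC0 (Real.rpow_nonneg (sub_nonneg.2 le_rfl) _))
  · exact main (i + l) hj (fun k hk => hmem k (by omega)) l i le_rfl (by omega)

/-- Passing to the limit in Euler schemes along an ultrafilter produces a path that follows the
approximate flow. -/
theorem exists_path_of_euler [ProperSpace E] {μ : ℝ → ℝ → E → E} {y₀ : E} {a b r C θ : ℝ}
    (hab : a ≤ b) (hθ : 0 < θ)
    (hcont : ContinuousOn (fun p : ℝ × ℝ × E => μ p.1 p.2.1 p.2.2)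
      {p | a ≤ p.1 ∧ p.1 ≤ p.2.1 ∧ p.2.1 ≤ b ∧ p.2.2 ∈ Metric.closedBall y₀ r})
    (hmem : ∀ (h : ℝ) (n k : ℕ), 0 ≤ h → a + n * h ≤ b → k ≤ n →
      euler μ a h k y₀ ∈ Metric.closedBall y₀ r)
    (hdavie : ∀ (h : ℝ) (n : ℕ), 0 ≤ h → a + n * h ≤ b → ∀ i j, i ≤ j → j ≤ n →
      ‖euler μ a h j y₀ - μ (a + i * h) (a + j * h) (euler μ a h i y₀)‖ ≤
        C * ((a + j * h) - (a + i * h)) ^ θ) :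
    ∃ y : ℝ → E, y a = y₀ ∧ (∀ s, a ≤ s → s ≤ b → y s ∈ Metric.closedBall y₀ r) ∧
      ∀ s t, a ≤ s → s ≤ t → t ≤ b → ‖y t - μ s t (y s)‖ ≤ C * (t - s) ^ θ := by
  set h : ℕ → ℝ := fun n => (b - a) / (n + 1 : ℕ) with hh
  have hh0 : ∀ n, 0 ≤ h n := fun n => div_nonneg (by linarith) (Nat.cast_nonneg _)
  have hhn : ∀ n, ((n + 1 : ℕ) : ℝ) * h n = b - a := fun n => by
    simp only [hh]; field_simp
  have hn : ∀ n, a + ((n + 1 : ℕ) : ℝ) * h n ≤ b := fun n => by rw [hhn]; linarith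
  set k : ℕ → ℝ → ℕ := fun n s => ⌊(s - a) / h n⌋₊ with hk
  have hkle : ∀ n s, a ≤ s → s ≤ b → k n s ≤ n + 1 := fun n s _ h2 => by
    refine Nat.floor_le_of_le ?_
    rcases (hh0 n).eq_or_lt with h0 | h0
    · rw [← h0, div_zero]; positivity
    · rw [div_le_iff₀ h0, hhn]; linarith
  have hkmono : ∀ n s t, s ≤ t → k n s ≤ k n t := fun n s t hst =>
    Nat.floor_le_floor (div_le_div_of_nonneg_right (by linarith) (hh0 n))
  have hks : ∀ n s, a ≤ s → s ≤ b → |a + k n s * h n - s| ≤ h n := fun n s h1 h2 => by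
    rcases (hh0 n).eq_or_lt with h0 | h0
    · have := hhn n
      rw [← h0, mul_zero] at this ⊢
      have : s = a := by linarith
      simp [this]
    · have f1 := Nat.floor_le (div_nonneg (sub_nonneg.2 h1) (hh0 n))
      have f2 := Nat.lt_floor_add_one ((s - a) / h n)
      rw [le_div_iff₀ h0] at f1
      rw [div_lt_iff₀ h0] at f2
      rw [abs_le]
      constructor <;> simp only [hk] <;> nlinarith
  have hhlim : Filter.Tendsto h Filter.atTop (nhds 0) :=
    (tendsto_const_div_atTop_nhds_zero_nat (b - a)).comp (Filter.tendsto_add_atTop_nat 1)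
  have hslim : ∀ s, a ≤ s → s ≤ b →
      Filter.Tendsto (fun n => a + k n s * h n) Filter.atTop (nhds s) := fun s h1 h2 =>
    tendsto_iff_norm_sub_tendsto_zero.2
      (squeeze_zero (fun _ => norm_nonneg _) (fun n => hks n s h1 h2) hhlim)
  set 𝒰 : Ultrafilter ℕ := Filter.hyperfilter ℕ
  have h𝒰 : (𝒰 : Filter ℕ) ≤ Filter.atTop := by
    rw [← Nat.cofinite_eq_atTop]; exact Filter.hyperfilter_le_cofinite
  have hex : ∀ s, ∃ z, a ≤ s → s ≤ b → z ∈ Metric.closedBall y₀ r ∧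
      Filter.Tendsto (fun n => euler μ a (h n) (k n s) y₀) 𝒰 (nhds z) := by
    intro s
    by_cases hs : a ≤ s ∧ s ≤ b
    · obtain ⟨z, hz, hlim⟩ := (isCompact_closedBall y₀ r).ultrafilter_le_nhds'
        (𝒰.map fun n => euler μ a (h n) (k n s) y₀)
        (Filter.Eventually.of_forall (f := (𝒰 : Filter ℕ)) fun n =>
          hmem (h n) (n + 1) _ (hh0 n) (hn n) (hkle n s hs.1 hs.2))
      exact ⟨z, fun _ _ => ⟨hz, hlim⟩⟩
    · exact ⟨y₀, fun h1 h2 => absurd ⟨h1, h2⟩ hs⟩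
  choose y hy using hex
  refine ⟨y, ?_, fun s h1 h2 => (hy s h1 h2).1, fun s t h1 h2 h3 => ?_⟩
  · refine tendsto_nhds_unique (hy a le_rfl hab).2 ?_
    have : (fun n => euler μ a (h n) (k n a) y₀) = fun _ => y₀ := by
      funext n
      simp [hk, euler]
    rw [this]
    exact tendsto_const_nhds
  · have hs := (hslim s h1 (h2.trans h3)).mono_left h𝒰
    have ht := (hslim t (h1.trans h2) h3).mono_left h𝒰
    obtain ⟨hys, hys'⟩ := hy s h1 (h2.trans h3)
    obtain ⟨hyt, hyt'⟩ := hy t (h1.trans h2) h3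
    have hc := (hcont (s, t, y s) ⟨h1, h2, h3, hys⟩).tendsto
    have hin : ∀ n : ℕ, (a + k n s * h n, a + k n t * h n, euler μ a (h n) (k n s) y₀) ∈
        {p : ℝ × ℝ × E | a ≤ p.1 ∧ p.1 ≤ p.2.1 ∧ p.2.1 ≤ b ∧
          p.2.2 ∈ Metric.closedBall y₀ r} := fun n => by
      have c1 : (k n s : ℝ) ≤ k n t := by exact_mod_cast hkmono n s t h2
      have c2 : (k n t : ℝ) ≤ (n + 1 : ℕ) := by exact_mod_cast hkle n t (h1.trans h2) h3
      refine ⟨?_, ?_, ?_, hmem (h n) (n + 1) _ (hh0 n) (hn n) (hkle n s h1 (h2.trans h3))⟩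
      · have := mul_nonneg (Nat.cast_nonneg (α := ℝ) (k n s)) (hh0 n)
        simp only; linarith
      · have := mul_le_mul_of_nonneg_right c1 (hh0 n)
        simp only; linarith
      · have := mul_le_mul_of_nonneg_right c2 (hh0 n)
        have := hn n
        simp only; linarith
    have hμlim : Filter.Tendsto (fun n => μ (a + k n s * h n) (a + k n t * h n)
        (euler μ a (h n) (k n s) y₀)) 𝒰 (nhds (μ s t (y s))) :=
      hc.comp (tendsto_nhdsWithin_iff.2 ⟨hs.prodMk_nhds (ht.prodMk_nhds hys'),
        Filter.Eventually.of_forall hin⟩)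
    have hrlim : Filter.Tendsto (fun n => C * ((a + k n t * h n) - (a + k n s * h n)) ^ θ) 𝒰
        (nhds (C * (t - s) ^ θ)) :=
      ((ht.sub hs).rpow_const (Or.inr hθ.le)).const_mul C
    exact le_of_tendsto_of_tendsto (hyt'.sub hμlim).norm hrlim
      (Filter.Eventually.of_forall fun n => hdavie (h n) (n + 1) (hh0 n) (hn n) _ _
        (hkmono n s t h2) (hkle n t (h1.trans h2) h3))

/-- Comparison of a path that follows the approximate flow with the Euler scheme. -/
theorem norm_sub_euler_le {μ : ℝ → ℝ → E → E} {B : Set E} {a b h e L : ℝ} (hh : 0 ≤ h)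
    (hL : ∀ s, ∀ n : ℕ, a ≤ s → s + n * h ≤ b → ∀ y ∈ B, ∀ y' ∈ B,
      ‖euler μ s h n y' - euler μ s h n y‖ ≤ L * ‖y' - y‖) (hL0 : 0 ≤ L)
    {y : ℝ → E} (hy : ∀ s, a ≤ s → s ≤ b → y s ∈ B)
    (hyB : ∀ s, a ≤ s → s + h ≤ b → μ s (s + h) (y s) ∈ B)
    (hstep : ∀ s, a ≤ s → s + h ≤ b → ‖y (s + h) - μ s (s + h) (y s)‖ ≤ e)
    (n : ℕ) (s : ℝ) (hs : a ≤ s) (hn : s + n * h ≤ b) :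
    ‖y (s + n * h) - euler μ s h n (y s)‖ ≤ n * (L * e) := by
  induction n generalizing s with
  | zero => simp [euler]
  | succ n ih =>
    have hn' : s + h + n * h ≤ b := by push_cast at hn; linarith
    have hsh : s + h ≤ b := by
      have := mul_nonneg (Nat.cast_nonneg (α := ℝ) n) hh
      linarith
    have i1 := ih (s + h) (by linarith) hn'
    have i2 := hL (s + h) n (by linarith) hn' _ (hyB s hs hsh) _ (hy (s + h) (by linarith) hsh)
    have i3 := mul_le_mul_of_nonneg_left (hstep s hs hsh) hL0
    have e1 : s + ((n + 1 : ℕ) : ℝ) * h = s + h + n * h := by push_cast; ring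
    rw [e1, euler]
    calc _ = ‖(y (s + h + n * h) - euler μ (s + h) h n (y (s + h))) +
          (euler μ (s + h) h n (y (s + h)) - euler μ (s + h) h n (μ s (s + h) (y s)))‖ := by
          congr 1; abel
      _ ≤ n * (L * e) + L * e := (norm_add_le _ _).trans (add_le_add i1 (i2.trans i3))
      _ = _ := by push_cast; ring

variable [NormedSpace ℝ E]

/-- An approximate flow `μ` on a ball together with its tangent maps `ν`, which form an approximate
flow on a product of balls. -/
structure TangentApproxFlow (μ : ℝ → ℝ → E → E) (ν : ℝ → ℝ → E × E → E × E) (y₀ : E)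
    (r a b c α : ℝ) : Prop where
  flow : ApproxFlowOn μ (Metric.closedBall y₀ (4 * r)) a b c α
  tangent : ApproxFlowOn ν (Metric.closedBall y₀ (4 * r) ×ˢ Metric.closedBall 0 3) a b c α
  differentiableAt : ∀ s t y, a ≤ s → s ≤ t → t ≤ b → y ∈ Metric.closedBall y₀ (4 * r) →
    DifferentiableAt ℝ (μ s t) y
  tangent_eq : ∀ s t y v, a ≤ s → s ≤ t → t ≤ b → y ∈ Metric.closedBall y₀ (4 * r) →
    ν s t (y, v) = (μ s t y, fderiv ℝ (μ s t) y v)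
  continuousOn : ContinuousOn (fun p : ℝ × ℝ × E => μ p.1 p.2.1 p.2.2)
      {p | a ≤ p.1 ∧ p.1 ≤ p.2.1 ∧ p.2.1 ≤ b ∧ p.2.2 ∈ Metric.closedBall y₀ (4 * r)}

/-- Euler schemes are uniformly Lipschitz: Davie's estimate for the tangent maps bounds their
derivatives. -/
theorem exists_euler_lipschitz (E : Type) [NormedAddCommGroup E] [NormedSpace ℝ E]
    {c α r : ℝ} (hc : 0 ≤ c) (hα : 1 / 3 < α) (hr : 0 < r) :
    ∃ δ > 0, ∀ (μ : ℝ → ℝ → E → E) (ν : ℝ → ℝ → E × E → E × E) (y₀ : E) (a b : ℝ), b - a ≤ δ →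
      TangentApproxFlow μ ν y₀ r a b c α → ∀ s h, ∀ n : ℕ, 0 ≤ h → a ≤ s → s + n * h ≤ b →
        ∀ y ∈ Metric.closedBall y₀ (3 * r), ∀ y' ∈ Metric.closedBall y₀ (3 * r),
          ‖euler μ s h n y' - euler μ s h n y‖ ≤ 2 * ‖y' - y‖ := by
  set ρ := min r 1 / 2 with hρ
  have hρ0 : 0 < ρ := half_pos (lt_min hr one_pos)
  have hρr : 2 * ρ ≤ r := by rw [hρ]; linarith [min_le_left r 1]
  have hρ1 : 2 * ρ ≤ 1 := by rw [hρ]; linarith [min_le_right r 1]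
  obtain ⟨δ, hδ, C, -, H⟩ := exists_davie_constants (E × E) hc hα hρ0
  refine ⟨δ, hδ, fun μ ν y₀ a b hab hμ s h n hh hs hn y hy y' hy' => ?_⟩
  have key : ∀ y ∈ Metric.closedBall y₀ (3 * r), DifferentiableAt ℝ (euler μ s h n) y ∧
      ∀ v : E, ‖v‖ = 1 → ‖fderiv ℝ (euler μ s h n) y v‖ ≤ 2 := by
    intro y hy
    have hball : ∀ v : E, ‖v‖ ≤ 1 → Metric.closedBall (y, v) (2 * ρ) ⊆
        Metric.closedBall y₀ (4 * r) ×ˢ Metric.closedBall 0 3 := by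
      intro v hv
      rw [← closedBall_prod_same]
      refine Set.prod_mono (Metric.closedBall_subset_closedBall' ?_)
        (Metric.closedBall_subset_closedBall' ?_)
      · rw [Metric.mem_closedBall] at hy; linarith
      · rw [dist_zero_right]; linarith
    have hH : ∀ v : E, ‖v‖ ≤ 1 → ∀ k ≤ n, euler ν s h k (y, v) ∈ Metric.closedBall (y, v) ρ :=
      fun v hv => (H ν (y, v) s b (by linarith)
        (hμ.tangent.mono (hball v hv) hs le_rfl) h n hh hn).1
    have hρρ : ∀ v : E, Metric.closedBall (y, v) ρ ⊆ Metric.closedBall (y, v) (2 * ρ) := fun v =>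
      Metric.closedBall_subset_closedBall (by linarith)
    have ind : ∀ k ≤ n, DifferentiableAt ℝ (euler μ s h k) y ∧
        euler μ s h k y ∈ Metric.closedBall y₀ (4 * r) ∧ ∀ v : E, ‖v‖ ≤ 1 →
        euler ν s h k (y, v) = (euler μ s h k y, fderiv ℝ (euler μ s h k) y v) := by
      intro k
      induction k with
      | zero =>
        intro _
        have e : euler μ s h 0 = id := rfl
        refine ⟨by rw [e]; exact differentiableAt_fun_id, ?_, fun v _ => ?_⟩
        · exact Metric.closedBall_subset_closedBall (by linarith) hy
        · rw [e, fderiv_id]; rfl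
      | succ k ih =>
        intro hk
        obtain ⟨i1, i2, i3⟩ := ih (by omega)
        have hkn : s + (k + 1 : ℕ) * h ≤ b := by
          have : ((k + 1 : ℕ) : ℝ) ≤ n := by exact_mod_cast hk
          nlinarith
        have hk0 : a ≤ s + k * h := by
          have := mul_nonneg (Nat.cast_nonneg (α := ℝ) k) hh
          linarith
        have hkk : s + k * h ≤ s + (k + 1 : ℕ) * h := by push_cast; nlinarith
        have e : euler μ s h (k + 1) =
            μ (s + k * h) (s + (k + 1 : ℕ) * h) ∘ euler μ s h k := by
          funext x; exact euler_succ μ s h k x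
        have d1 := hμ.differentiableAt _ _ _ hk0 hkk hkn i2
        have hd : HasFDerivAt (euler μ s h (k + 1))
            ((fderiv ℝ (μ (s + k * h) (s + (k + 1 : ℕ) * h)) (euler μ s h k y)).comp
              (fderiv ℝ (euler μ s h k) y)) y := by
          rw [e]; exact d1.hasFDerivAt.comp y i1.hasFDerivAt
        have i3' : ∀ v : E, ‖v‖ ≤ 1 → euler ν s h (k + 1) (y, v) =
            (euler μ s h (k + 1) y, fderiv ℝ (euler μ s h (k + 1)) y v) := fun v hv => by
          rw [euler_succ, i3 v hv, hμ.tangent_eq _ _ _ _ hk0 hkk hkn i2, hd.fderiv, e]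
          rfl
        refine ⟨hd.differentiableAt, ?_, i3'⟩
        have := hball 0 (by simp) (hρρ 0 (hH 0 (by simp) (k + 1) hk))
        rw [i3' 0 (by simp)] at this
        exact this.1
    obtain ⟨d, -, hv⟩ := ind n le_rfl
    refine ⟨d, fun v hv1 => ?_⟩
    have := hH v hv1.le n le_rfl
    rw [hv v hv1.le, ← closedBall_prod_same] at this
    have h2 := this.2
    simp only [Metric.mem_closedBall, dist_eq_norm] at h2
    have h3 := norm_sub_norm_le (fderiv ℝ (euler μ s h n) y v) v
    linarith
  refine (convex_closedBall y₀ (3 * r)).norm_image_sub_le_of_norm_fderiv_le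
    (fun x hx => (key x hx).1) (fun x hx => ?_) hy hy'
  exact ContinuousLinearMap.opNorm_le_of_unit_norm (by norm_num) (key x hx).2

/-- Short time existence of paths that follow an approximate flow, and their characterization as
limits of Euler schemes (hence their uniqueness), with uniform constants. -/
theorem exists_local_flow_constants (E : Type) [NormedAddCommGroup E] [NormedSpace ℝ E]
    [ProperSpace E] {c α r : ℝ} (hc : 0 ≤ c) (hα : 1 / 3 < α) (hr : 0 < r) :
    ∃ δ > 0, ∃ C ≥ 0, ∀ (μ : ℝ → ℝ → E → E) (ν : ℝ → ℝ → E × E → E × E) (y₀ : E) (a b : ℝ),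
      a ≤ b → b - a ≤ δ → TangentApproxFlow μ ν y₀ r a b c α →
      (∀ y₁ ∈ Metric.closedBall y₀ r, ∃ y : ℝ → E, y a = y₁ ∧
        (∀ s, a ≤ s → s ≤ b → y s ∈ Metric.closedBall y₀ (2 * r)) ∧
        ∀ s t, a ≤ s → s ≤ t → t ≤ b → ‖y t - μ s t (y s)‖ ≤ C * (t - s) ^ (3 * α)) ∧
      (∀ y₁ ∈ Metric.closedBall y₀ r, ∀ (h : ℝ) (n : ℕ), 0 ≤ h → a + n * h ≤ b → ∀ k ≤ n,
        euler μ a h k y₁ ∈ Metric.closedBall y₀ (2 * r)) ∧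
      ∀ (y : ℝ → E) (D : ℝ), (∀ s, a ≤ s → s ≤ b → y s ∈ Metric.closedBall y₀ (2 * r)) →
        (∀ s t, a ≤ s → s ≤ t → t ≤ b → ‖y t - μ s t (y s)‖ ≤ D * (t - s) ^ (3 * α)) →
        ∀ n : ℕ, 0 < n → ‖y b - euler μ a ((b - a) / n) n (y a)‖ ≤
          n * (2 * (D * ((b - a) / n) ^ (3 * α))) := by
  have hα0 : 0 < α := by linarith
  obtain ⟨δ₁, hδ₁, C, hC, H₁⟩ := exists_davie_constants E hc hα hr
  obtain ⟨δ₂, hδ₂, H₂⟩ := exists_euler_lipschitz E hc hα hr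
  obtain ⟨δ₃, hδ₃, H₃⟩ := exists_forall_mul_rpow_le hα0 c hr
  refine ⟨min δ₁ (min δ₂ δ₃), by positivity, C, hC, ?_⟩
  intro μ ν y₀ a b hab hδ hμ
  have hb1 : b - a ≤ δ₁ := hδ.trans (min_le_left _ _)
  have hb2 : b - a ≤ δ₂ := hδ.trans ((min_le_right _ _).trans (min_le_left _ _))
  have hb3 : b - a ≤ δ₃ := hδ.trans ((min_le_right _ _).trans (min_le_right _ _))
  refine ⟨?_, ?_, ?_⟩
  · intro y₁ hy₁
    have hd : dist y₁ y₀ ≤ r := hy₁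
    have H := fun h n => H₁ μ y₁ a b hb1 (hμ.flow.mono
      (Metric.closedBall_subset_closedBall' (by linarith)) le_rfl le_rfl) h n
    obtain ⟨y, h1, h2, h3⟩ := exists_path_of_euler hab (by linarith : 0 < 3 * α)
      (hμ.continuousOn.mono fun p hp => ⟨hp.1, hp.2.1, hp.2.2.1,
        Metric.closedBall_subset_closedBall' (by linarith) hp.2.2.2⟩)
      (fun h n k hh hn hk => (H h n hh hn).1 k hk)
      (fun h n hh hn => (H h n hh hn).2)
    exact ⟨y, h1, fun s hs hs' => Metric.closedBall_subset_closedBall' (by linarith)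
      (h2 s hs hs'), h3⟩
  · intro y₁ hy₁ h n hh hn k hk
    have hd : dist y₁ y₀ ≤ r := hy₁
    exact Metric.closedBall_subset_closedBall' (by linarith) ((H₁ μ y₁ a b hb1 (hμ.flow.mono
      (Metric.closedBall_subset_closedBall' (by linarith)) le_rfl le_rfl) h n hh hn).1 k hk)
  · intro y D hy hD n hn
    have hn0 : (0 : ℝ) < n := by exact_mod_cast hn
    have hh : 0 ≤ (b - a) / n := div_nonneg (by linarith) hn0.le
    have hnh : a + n * ((b - a) / n) = b := by field_simp; ring
    have hhb : (b - a) / n ≤ b - a :=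
      div_le_self (by linarith) (by exact_mod_cast hn)
    have h23 : Metric.closedBall y₀ (2 * r) ⊆ Metric.closedBall y₀ (3 * r) :=
      Metric.closedBall_subset_closedBall (by linarith)
    have := norm_sub_euler_le (μ := μ) (B := Metric.closedBall y₀ (3 * r)) (a := a) (b := b)
      (L := 2) (e := D * ((b - a) / n) ^ (3 * α)) hh
      (fun s k hs hk y hy y' hy' => H₂ μ ν y₀ a b hb2 hμ s _ k hh hs hk y hy y' hy') (by norm_num)
      (fun s h1 h2 => h23 (hy s h1 h2)) (fun s h1 h2 => ?_) (fun s h1 h2 => ?_) n a le_rfl hnh.le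
    · rwa [hnh] at this
    · have e1 := hy s h1 (by linarith)
      have e2 := (hμ.flow.disp s (s + (b - a) / n) (y s) h1 (by linarith) h2
        (Metric.closedBall_subset_closedBall (by linarith) e1)).trans
        (H₃ _ (by linarith) (by linarith))
      rw [Metric.mem_closedBall] at e1 ⊢
      rw [← dist_eq_norm] at e2
      linarith [dist_triangle (μ s (s + (b - a) / n) (y s)) (y s) y₀]
    · have := hD s (s + (b - a) / n) h1 (by linarith) h2
      rwa [add_sub_cancel_left] at this

end ApproxFlow

/-! ### Drivers and second order expansions -/

/-- A (time-extended) weakly geometric `α`-Hölder rough path on `[a, b]`, with constant `R`. The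
drift component is only required to be of the size of the second level. -/
structure IsDriver {d : ℕ} (A : ℝ → ℝ → Inc d) (α R a b : ℝ) : Prop where
  chen : ∀ s u t, a ≤ s → s ≤ u → u ≤ t → t ≤ b → A s t = (A s u).chen (A u t)
  size : ∀ s t, a ≤ s → s ≤ t → t ≤ b → (A s t).Size R ((t - s) ^ α)
  geometric : ∀ s t, a ≤ s → s ≤ t → t ≤ b → ∀ j k,
    (A s t).2.1 j k + (A s t).2.1 k j = (A s t).1 j * (A s t).1 k
  continuousOn : ContinuousOn (fun p : ℝ × ℝ => A p.1 p.2) {p | a ≤ p.1 ∧ p.1 ≤ p.2 ∧ p.2 ≤ b}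

theorem Inc.Size.mono {d : ℕ} {a : Inc d} {R κ κ' : ℝ} (h : a.Size R κ) (hR : 0 ≤ R) (hκ : 0 ≤ κ)
    (hκκ : κ ≤ κ') : a.Size R κ' where
  fst i := (h.fst i).trans (mul_le_mul_of_nonneg_left hκκ hR)
  snd j k := (h.snd j k).trans (mul_le_mul_of_nonneg_left (pow_le_pow_left₀ hκ hκκ 2) hR)
  drift := h.drift.trans (mul_le_mul_of_nonneg_left (pow_le_pow_left₀ hκ hκκ 2) hR)

theorem rpow_pow_three {x : ℝ} (hx : 0 ≤ x) (α : ℝ) : (x ^ α) ^ 3 = x ^ (3 * α) := by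
  rw [← Real.rpow_natCast, ← Real.rpow_mul hx]
  congr 1
  push_cast
  ring

namespace IsDriver

variable {d : ℕ} {A : ℝ → ℝ → Inc d} {α R a b : ℝ}

theorem mono (h : IsDriver A α R a b) {a' b' : ℝ} (ha : a ≤ a') (hb : b' ≤ b) :
    IsDriver A α R a' b' where
  chen s u t h1 h2 h3 h4 := h.chen s u t (ha.trans h1) h2 h3 (h4.trans hb)
  size s t h1 h2 h3 := h.size s t (ha.trans h1) h2 (h3.trans hb)
  geometric s t h1 h2 h3 := h.geometric s t (ha.trans h1) h2 (h3.trans hb)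
  continuousOn := h.continuousOn.mono fun _ hp => ⟨ha.trans hp.1, hp.2.1, hp.2.2.trans hb⟩

/-- Running a driver backwards from time `S`. -/
theorem reverse (h : IsDriver A α R a b) (S : ℝ) :
    IsDriver (fun s t => (A (S - t) (S - s)).chenInv) α (R + R ^ 2) (S - b) (S - a) where
  chen s u t h1 h2 h3 h4 := by
    rw [h.chen (S - t) (S - u) (S - s) (by linarith) (by linarith) (by linarith) (by linarith)]
    refine Prod.ext ?_ (Prod.ext ?_ ?_)
    · simp [Inc.chen, Inc.chenInv]
    · funext j k
      simp [Inc.chen, Inc.chenInv]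
      ring
    · simp [Inc.chen, Inc.chenInv]
  size s t h1 h2 h3 := by
    have := (h.size (S - t) (S - s) (by linarith) (by linarith) (by linarith)).chenInv
      (Real.rpow_nonneg (by linarith) α)
    rwa [sub_sub_sub_cancel_left] at this
  geometric s t h1 h2 h3 j k := by
    have := h.geometric (S - t) (S - s) (by linarith) (by linarith) (by linarith) j k
    simp only [Inc.chenInv, Pi.neg_apply]
    linarith
  continuousOn := by
    have h1 : ContinuousOn (fun p : ℝ × ℝ => A (S - p.2) (S - p.1))
        {p | S - b ≤ p.1 ∧ p.1 ≤ p.2 ∧ p.2 ≤ S - a} :=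
      h.continuousOn.comp (f := fun p : ℝ × ℝ => (S - p.2, S - p.1)) (by fun_prop)
        fun p hp => ⟨by linarith [hp.2.2], by linarith [hp.2.1], by linarith [hp.1]⟩
    have h2 : Continuous (Inc.chenInv (d := d)) := by
      unfold Inc.chenInv
      fun_prop
    exact h2.comp_continuousOn h1

end IsDriver

section Expansion

variable {E : Type} [NormedAddCommGroup E] [NormedSpace ℝ E] {d : ℕ}
  {V : Fin d → E → E} {V₀ : E → E} {U : Set E} {K R : ℝ}

/-- The one-step maps along a driver form an approximate flow, with a constant that depends only on
the bounds for the vector fields and for the driver. -/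
theorem FieldBound.approxFlowOn (h : FieldBound V V₀ U K) (hU : Convex ℝ U) (hR : 0 ≤ R)
    (hK : 0 ≤ K) {A : ℝ → ℝ → Inc d} {α a b c : ℝ} (hα : 0 < α) (hA : IsDriver A α R a b)
    (hab : b - a ≤ 1) (hc : c = R * (d * K + 2 * d ^ 2 * K ^ 2 + K)) :
    ApproxFlowOn (fun s t => rdeStep V V₀ (A s t)) U a b
      (c + (d * R * K * (c ^ 2 + c) + c ^ 2)) α := by
  have hc0 : 0 ≤ c := by rw [hc]; positivity
  have hc1 : 0 ≤ d * R * K * (c ^ 2 + c) + c ^ 2 := by positivity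
  have h01 : ∀ s t, a ≤ s → s ≤ t → t ≤ b → 0 ≤ (t - s) ^ α ∧ (t - s) ^ α ≤ 1 :=
    fun s t h1 h2 h3 => ⟨Real.rpow_nonneg (by linarith) _,
      Real.rpow_le_one (by linarith) (by linarith) hα.le⟩
  refine ⟨fun s t y h1 h2 h3 hy => ?_, fun s t y y' h1 h2 h3 hy hy' => ?_,
    fun s u t y h1 h2 h3 h4 hy hy' => ?_⟩
  · obtain ⟨k0, k1⟩ := h01 s t h1 h2 h3
    have := h.norm_rdeIncr_le hR k0 k1 (hA.size s t h1 h2 h3) hy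
    rw [← hc] at this
    simp only [rdeStep, add_sub_cancel_left]
    nlinarith
  · obtain ⟨k0, k1⟩ := h01 s t h1 h2 h3
    have := h.norm_rdeIncr_sub_le hU hR k0 k1 (hA.size s t h1 h2 h3) hy hy'
    rw [← hc] at this
    have e : rdeStep V V₀ (A s t) y' - rdeStep V V₀ (A s t) y =
        (y' - y) + (rdeIncr V V₀ (A s t) y' - rdeIncr V V₀ (A s t) y) := by
      simp only [rdeStep]; abel
    rw [e]
    refine (norm_add_le _ _).trans ?_
    have h5 : 0 ≤ (d * R * K * (c ^ 2 + c) + c ^ 2) * (t - s) ^ α * ‖y' - y‖ := by positivity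
    nlinarith
  · obtain ⟨k0, k1⟩ := h01 s t h1 (h2.trans h3) h4
    have m1 : (u - s) ^ α ≤ (t - s) ^ α := Real.rpow_le_rpow (by linarith) (by linarith) hα.le
    have m2 : (t - u) ^ α ≤ (t - s) ^ α := Real.rpow_le_rpow (by linarith) (by linarith) hα.le
    have := h.norm_rdeStep_chen_le hU hR k0 k1
      ((hA.size s u h1 h2 (h3.trans h4)).mono hR (Real.rpow_nonneg (by linarith) _) m1)
      ((hA.size u t (h1.trans h2) h3 h4).mono hR (Real.rpow_nonneg (by linarith) _) m2) hy hy' hc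
    rw [← hA.chen s u t h1 h2 h3 h4, rpow_pow_three (by linarith)] at this
    refine this.trans (mul_le_mul_of_nonneg_right (by linarith) (Real.rpow_nonneg (by linarith) _))

/-- Taylor's formula of order three for a scalar function. -/
theorem abs_sub_taylor_two_le {F : E → ℝ} (hU : Convex ℝ U)
    (hF : ∀ y ∈ U, DifferentiableAt ℝ F y) (hF2 : HasC2Bound (fderiv ℝ F) U K) {y y' : E}
    (hsymm : ∀ u v, fderiv ℝ (fderiv ℝ F) y u v = fderiv ℝ (fderiv ℝ F) y v u)
    (hy : y ∈ U) (hy' : y' ∈ U) :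
    |F y' - F y - (fderiv ℝ F y (y' - y) + 1 / 2 * fderiv ℝ (fderiv ℝ F) y (y' - y) (y' - y))| ≤
      K * ‖y' - y‖ ^ 3 := by
  have hseg : segment ℝ y y' ⊆ U := hU.segment_subset hy hy'
  have hK : 0 ≤ K := (norm_nonneg _).trans (hF2.norm_le y hy)
  set B := fderiv ℝ (fderiv ℝ F) y with hB
  set G : E → ℝ := fun x => F x - (fderiv ℝ F y (x - y) + 1 / 2 * B (x - y) (x - y)) with hG
  have hsub : ∀ x, HasFDerivAt (fun x : E => x - y) (ContinuousLinearMap.id ℝ E) x := fun x =>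
    (hasFDerivAt_id x).sub_const y
  have hGd : ∀ x ∈ segment ℝ y y', HasFDerivAt G
      (fderiv ℝ F x - (fderiv ℝ F y + B (x - y))) x := by
    intro x hx
    have h1 := (fderiv ℝ F y).hasFDerivAt.comp x (hsub x)
    have h2 := (B.hasFDerivAt_of_bilinear (hsub x) (hsub x)).const_mul (1 / 2 : ℝ)
    have h3 := (hF x (hseg hx)).hasFDerivAt.sub (h1.add h2)
    refine h3.congr_fderiv ?_
    ext v
    have s1 := hsymm v x
    have s2 := hsymm v y
    simp
    linarith
  have := (convex_segment y y').norm_image_sub_le_of_norm_hasFDerivWithin_le (f := G)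
    (C := K * ‖y' - y‖ ^ 2) (fun x hx => (hGd x hx).hasFDerivWithinAt) (fun x hx => ?_)
    (left_mem_segment ℝ y y') (right_mem_segment ℝ y y')
  · have e : G y' - G y = F y' - F y - (fderiv ℝ F y (y' - y) +
        1 / 2 * B (y' - y) (y' - y)) := by simp [hG]; ring
    rw [e, Real.norm_eq_abs] at this
    calc _ ≤ _ := this
      _ = _ := by ring
  · rw [← sub_sub]
    refine (hF2.taylor hU hy (hseg hx)).trans (mul_le_mul_of_nonneg_left ?_ hK)
    exact pow_le_pow_left₀ (norm_nonneg _) (norm_sub_le_of_mem_segment hx) 2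

/-- The change of variables formula: a function of a point that follows the one-step map up to the
third order. The geometricity of the increment accounts for the second derivative of `F`. -/
theorem FieldBound.abs_sub_expansion_le (h : FieldBound V V₀ U K) (hU : Convex ℝ U) (hR : 0 ≤ R)
    {F : E → ℝ} (hF : ∀ y ∈ U, DifferentiableAt ℝ F y) (hF2 : HasC2Bound (fderiv ℝ F) U K)
    (hsymm : ∀ y ∈ U, ∀ u v, fderiv ℝ (fderiv ℝ F) y u v = fderiv ℝ (fderiv ℝ F) y v u)
    {C B κ : ℝ} (hC : 0 ≤ C) (hB : B = R * (d * K + 2 * d ^ 2 * K ^ 2 + K) + C) (hκ : 0 ≤ κ)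
    (hκ1 : κ ≤ 1) {a : Inc d} (ha : a.Size R κ)
    (hgeo : ∀ j k, a.2.1 j k + a.2.1 k j = a.1 j * a.1 k) {y y' : E} (hy : y ∈ U) (hy' : y' ∈ U)
    (hyy' : ‖y' - rdeStep V V₀ a y‖ ≤ C * κ ^ 3) :
    |F y' - F y - (fderiv ℝ F y (rdeIncr V V₀ a y) +
      ∑ j, ∑ k, a.2.1 j k * fderiv ℝ (fderiv ℝ F) y (V j y) (V k y))| ≤
      (K * B ^ 3 + K * C + 2 * K * B ^ 2) * κ ^ 3 := by
  have hK := h.nonneg hy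
  set D := fderiv ℝ (fderiv ℝ F) y with hD
  set P := ∑ i, a.1 i • V i y with hP
  set c := R * (d * K + 2 * d ^ 2 * K ^ 2 + K) with hc
  have hc0 : 0 ≤ c := by positivity
  have hB0 : 0 ≤ B := by rw [hB]; positivity
  have hκ3 : κ ^ 3 ≤ κ ^ 2 := by nlinarith [mul_nonneg (sq_nonneg κ) (sub_nonneg.2 hκ1)]
  have hκ2 : κ ^ 2 ≤ κ := by nlinarith
  set ρ := y' - rdeStep V V₀ a y with hρ
  have e1 : y' - y = rdeIncr V V₀ a y + ρ := by simp only [hρ, rdeStep]; abel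
  have n1 : ‖y' - y‖ ≤ B * κ := by
    rw [e1, hB, add_mul]
    refine (norm_add_le _ _).trans (add_le_add (h.norm_rdeIncr_le hR hκ hκ1 ha hy) ?_)
    exact hyy'.trans (mul_le_mul_of_nonneg_left (hκ3.trans hκ2) hC)
  have n2 : ‖y' - y - P‖ ≤ B * κ ^ 2 := by
    have e2 : y' - y - P = (∑ j, ∑ k, a.2.1 j k • fderiv ℝ (V k) y (V j y) + a.2.2 • V₀ y) + ρ := by
      rw [e1, rdeIncr, hP]; abel
    rw [e2, hB, add_mul]
    refine (norm_add_le _ _).trans (add_le_add ((h.norm_second_order_le ha hy).trans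
      (mul_le_mul_of_nonneg_right ?_ (sq_nonneg _)))
      (hyy'.trans (mul_le_mul_of_nonneg_left hκ3 hC)))
    rw [hc]
    refine mul_le_mul_of_nonneg_left ?_ hR
    have : 0 ≤ (d : ℝ) * K := by positivity
    have : 0 ≤ (d : ℝ) ^ 2 * K ^ 2 := by positivity
    linarith
  have n3 : ‖P‖ ≤ 2 * B * κ := by
    have : P = (y' - y) - (y' - y - P) := by abel
    rw [this]
    refine (norm_sub_le _ _).trans ?_
    have := mul_le_mul_of_nonneg_left hκ2 hB0
    linarith
  have hDle : ∀ u v, |D u v| ≤ K * ‖u‖ * ‖v‖ := fun u v => by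
    rw [← Real.norm_eq_abs]
    exact (D.le_opNorm₂ u v).trans (by gcongr; exact hF2.norm_fderiv_le y hy)
  have hquad : 1 / 2 * D P P = ∑ j, ∑ k, a.2.1 j k * D (V j y) (V k y) := by
    have hPP : D P P = ∑ j, ∑ k, a.1 j * a.1 k * D (V j y) (V k y) := by
      simp only [hP, map_sum, map_smul, sum_apply, smul_apply, smul_eq_mul, Finset.mul_sum]
      refine Finset.sum_congr rfl fun j _ => Finset.sum_congr rfl fun k _ => ?_
      have := hsymm y hy (V k y) (V j y)
      rw [← hD] at this
      rw [this]
      ring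
    have hsw : ∑ j, ∑ k, a.2.1 j k * D (V j y) (V k y) =
        ∑ j, ∑ k, a.2.1 k j * D (V j y) (V k y) := by
      rw [Finset.sum_comm]
      refine Finset.sum_congr rfl fun j _ => Finset.sum_congr rfl fun k _ => ?_
      rw [hsymm y hy]
    have : D P P = ∑ j, ∑ k, a.2.1 j k * D (V j y) (V k y) +
        ∑ j, ∑ k, a.2.1 k j * D (V j y) (V k y) := by
      rw [hPP, ← Finset.sum_add_distrib]
      refine Finset.sum_congr rfl fun j _ => ?_
      rw [← Finset.sum_add_distrib]
      refine Finset.sum_congr rfl fun k _ => ?_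
      rw [← hgeo j k]
      ring
    rw [this, ← hsw]
    ring
  have hT := abs_sub_taylor_two_le hU hF hF2 (hsymm y hy) hy hy'
  rw [← hD] at hT
  have e3 : F y' - F y - (fderiv ℝ F y (rdeIncr V V₀ a y) +
      ∑ j, ∑ k, a.2.1 j k * D (V j y) (V k y)) =
      (F y' - F y - (fderiv ℝ F y (y' - y) + 1 / 2 * D (y' - y) (y' - y))) +
      fderiv ℝ F y ρ + 1 / 2 * (D (y' - y) (y' - y - P) + D (y' - y - P) P) := by
    rw [← hquad]
    have e4 : fderiv ℝ F y (y' - y) = fderiv ℝ F y (rdeIncr V V₀ a y) + fderiv ℝ F y ρ := by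
      rw [e1, map_add]
    have e5 : D (y' - y) (y' - y - P) + D (y' - y - P) P = D (y' - y) (y' - y) - D P P := by
      simp only [map_sub, sub_apply]
      ring
    rw [e4, e5]
    ring
  have b1 : K * ‖y' - y‖ ^ 3 ≤ K * B ^ 3 * κ ^ 3 := by
    rw [mul_assoc, ← mul_pow]
    exact mul_le_mul_of_nonneg_left (pow_le_pow_left₀ (norm_nonneg _) n1 3) hK
  have b2 : |fderiv ℝ F y ρ| ≤ K * C * κ ^ 3 := by
    rw [← Real.norm_eq_abs, mul_assoc]
    exact (ContinuousLinearMap.le_opNorm _ _).trans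
      (mul_le_mul (hF2.norm_le y hy) hyy' (norm_nonneg _) hK)
  have b3 : |D (y' - y) (y' - y - P)| ≤ K * B ^ 2 * κ ^ 3 := by
    refine (hDle _ _).trans ?_
    calc _ ≤ K * (B * κ) * (B * κ ^ 2) := by gcongr
      _ = _ := by ring
  have b4 : |D (y' - y - P) P| ≤ 2 * K * B ^ 2 * κ ^ 3 := by
    refine (hDle _ _).trans ?_
    calc _ ≤ K * (B * κ ^ 2) * (2 * B * κ) := by gcongr
      _ = _ := by ring
  rw [e3]
  refine (abs_add_three _ _ _).trans ?_
  have b5 : |1 / 2 * (D (y' - y) (y' - y - P) + D (y' - y - P) P)| ≤ 2 * K * B ^ 2 * κ ^ 3 := by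
    rw [abs_mul, abs_of_pos (by norm_num : (0 : ℝ) < 1 / 2)]
    have := abs_add_le (D (y' - y) (y' - y - P)) (D (y' - y - P) P)
    have : 0 ≤ K * B ^ 2 * κ ^ 3 := by positivity
    linarith
  linarith

end Expansion

/-! ### Functions and vector fields in foliated charts -/

section Charts

variable {p d : ℕ} {Z M : Type*} [TopologicalSpace Z] [TopologicalSpace M]
  {𝓕 : FoliatedAtlas p Z M}

theorem FoliatedAtlas.LeafwiseCk.leafwiseCkRec {k : ℕ} {f : M → ℝ} (hf : 𝓕.LeafwiseCk k f)
    {φ : OpenPartialHomeomorph M (EuclideanSpace ℝ (Fin p) × Z)} (hφ : φ ∈ 𝓕.charts) :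
    LeafwiseCkRec k (fun q => f (φ.symm q)) φ.target :=
  (leafwiseCkOn_iff φ.open_target).1 (hf φ hφ)

theorem LeafwiseVectorField.leafwiseCkRec {k : ℕ} (V : LeafwiseVectorField 𝓕 k)
    {φ : OpenPartialHomeomorph M (EuclideanSpace ℝ (Fin p) × Z)} (hφ : φ ∈ 𝓕.charts) :
    LeafwiseCkRec k (V.comp φ) φ.target :=
  (leafwiseCkOn_iff φ.open_target).1 (V.leafwiseCk φ hφ)

/-- Near each point, a change of charts is `q ↦ (h q, g q.2)` with `h` leafwise smooth and `g`
continuous. -/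
theorem FoliatedAtlas.exists_transition (𝓕 : FoliatedAtlas p Z M)
    {φ ψ : OpenPartialHomeomorph M (EuclideanSpace ℝ (Fin p) × Z)} (hφ : φ ∈ 𝓕.charts)
    (hψ : ψ ∈ 𝓕.charts) {q : EuclideanSpace ℝ (Fin p) × Z} (hq : q ∈ φ.target)
    (hq' : φ.symm q ∈ ψ.source) :
    ∃ O : Set (EuclideanSpace ℝ (Fin p) × Z), IsOpen O ∧ q ∈ O ∧ O ⊆ φ.target ∧
      (∀ r ∈ O, φ.symm r ∈ ψ.source) ∧
      (∀ k : ℕ, LeafwiseCkRec k (fun r => (ψ (φ.symm r)).1) O) ∧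
      ∃ g : Z → Z, ContinuousOn (fun r : EuclideanSpace ℝ (Fin p) × Z => g r.2) O ∧
        ∀ r ∈ O, ψ (φ.symm r) = ((ψ (φ.symm r)).1, g r.2) := by
  obtain ⟨O, hO, hqO, hOs, hk, g, hg, hg'⟩ := 𝓕.leafwiseSmooth_transition φ hφ ψ hψ q
    (by rw [OpenPartialHomeomorph.trans_source]; exact ⟨hq, hq'⟩)
  rw [OpenPartialHomeomorph.trans_source] at hOs
  refine ⟨O, hO, hqO, fun r hr => (hOs hr).1, fun r hr => (hOs hr).2,
    fun k => (leafwiseCkOn_iff hO).1 (hk k), g, ?_, fun r hr => Prod.ext rfl (hg' r hr)⟩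
  exact hg.comp continuous_snd.continuousOn fun r hr => ⟨r, hr, rfl⟩

/-- The derivative of a function along a vector field may be computed in any chart. -/
theorem LeafwiseVectorField.lieDeriv_eq {k : ℕ} (V : LeafwiseVectorField 𝓕 k) {f : M → ℝ}
    (hf : 𝓕.LeafwiseCk 1 f) {φ : OpenPartialHomeomorph M (EuclideanSpace ℝ (Fin p) × Z)}
    (hφ : φ ∈ 𝓕.charts) {m : M} (hm : m ∈ φ.source) :
    V.lieDeriv f m = leafDeriv (fun q => f (φ.symm q)) (φ m) (V.comp φ (φ m)) := by
  unfold LeafwiseVectorField.lieDeriv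
  set ψ := 𝓕.chartAt m with hψdef
  obtain ⟨hψ, hmψ⟩ : ψ ∈ 𝓕.charts ∧ m ∈ ψ.source := (𝓕.exists_chart m).choose_spec
  have hsymm : φ.symm (φ m) = m := φ.left_inv hm
  have hq : φ m ∈ φ.target := φ.map_source hm
  obtain ⟨O, hO, hqO, hOt, hOs, hk, g, -, hg⟩ := 𝓕.exists_transition hφ hψ hq (by rwa [hsymm])
  have hcomp := V.compatible φ hφ ψ hψ (φ m)
    (by rw [OpenPartialHomeomorph.trans_source]; exact ⟨hq, by change φ.symm (φ m) ∈ ψ.source; rwa [hsymm]⟩)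
  rw [hsymm] at hcomp
  have hd1 : DifferentiableAt ℝ (fun y => (ψ (φ.symm (y, (φ m).2))).1) (φ m).1 :=
    (hk 1).2.1 (φ m) hqO
  have hd2 : DifferentiableAt ℝ (fun y => f (ψ.symm (y, (ψ m).2))) (ψ m).1 :=
    (hf.leafwiseCkRec hψ).2.1 (ψ m) (ψ.map_source hmψ)
  have hgm : g (φ m).2 = (ψ m).2 := by
    have := congrArg Prod.snd (hg (φ m) hqO)
    rw [hsymm] at this
    exact this.symm
  have hev : (fun y => f (φ.symm (y, (φ m).2))) =ᶠ[nhds (φ m).1]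
      (fun y => f (ψ.symm (y, (ψ m).2))) ∘ fun y => (ψ (φ.symm (y, (φ m).2))).1 := by
    filter_upwards [(isOpen_slice hO (φ m).2).mem_nhds hqO] with y hy
    have h1 := hg (y, (φ m).2) hy
    simp only [hgm] at h1
    simp only [Function.comp]
    rw [← h1, ψ.left_inv (hOs _ hy)]
  have hd2' : HasFDerivAt (fun y => f (ψ.symm (y, (ψ m).2)))
      (fderiv ℝ (fun y => f (ψ.symm (y, (ψ m).2))) (ψ m).1)
      ((fun y => (ψ (φ.symm (y, (φ m).2))).1) (φ m).1) := by
    have : (fun y => (ψ (φ.symm (y, (φ m).2))).1) (φ m).1 = (ψ m).1 := by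
      change (ψ (φ.symm (φ m))).1 = _
      rw [hsymm]
    rw [this]
    exact hd2.hasFDerivAt
  have := (hd2'.comp (φ m).1 hd1.hasFDerivAt).congr_of_eventuallyEq hev
  unfold leafDeriv
  rw [this.fderiv, hcomp]
  rfl

theorem LeafwiseVectorField.leafwiseCk_lieDeriv {k l : ℕ} (V : LeafwiseVectorField 𝓕 k)
    {f : M → ℝ} (hf : 𝓕.LeafwiseCk (l + 1) f) (hl : l ≤ k) : 𝓕.LeafwiseCk l (V.lieDeriv f) := by
  intro φ hφ
  rw [leafwiseCkOn_iff φ.open_target]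
  refine (LeafwiseCkRec.leafDeriv_apply φ.open_target (hf.leafwiseCkRec hφ)
    ((V.leafwiseCkRec hφ).of_le hl)).congr φ.open_target fun q hq => ?_
  have hf1 : 𝓕.LeafwiseCk 1 f := fun ψ hψ => (leafwiseCkOn_iff ψ.open_target).2
    ((hf.leafwiseCkRec hψ).of_le (by omega))
  have := V.lieDeriv_eq hf1 hφ (φ.map_target hq)
  rwa [φ.right_inv hq] at this

theorem FoliatedAtlas.LeafwiseCk.continuous {k : ℕ} {f : M → ℝ} (hf : 𝓕.LeafwiseCk k f) :
    Continuous f := by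
  rw [continuous_iff_continuousAt]
  intro m
  obtain ⟨φ, hφ, hm⟩ := 𝓕.exists_chart m
  have h1 := (hf.leafwiseCkRec hφ).continuousOn.continuousAt (φ.open_target.mem_nhds (φ.map_source hm))
  refine (h1.comp (φ.continuousAt hm)).congr ?_
  filter_upwards [φ.open_source.mem_nhds hm] with x hx
  simp [φ.left_inv hx]

/-- The second order expansion of `f` along an increment: the right-hand side of the equation that
defines solutions of rough differential equations. -/
noncomputable def rdeExpansion (V : Fin d → LeafwiseVectorField 𝓕 3)
    (V₀ : LeafwiseVectorField 𝓕 3) (f : M → ℝ) (a : Inc d) (m : M) : ℝ :=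
  ∑ i, (V i).lieDeriv f m * a.1 i +
    ∑ j, ∑ k, (V j).lieDeriv ((V k).lieDeriv f) m * a.2.1 j k + V₀.lieDeriv f m * a.2.2

variable (V : Fin d → LeafwiseVectorField 𝓕 3) (V₀ : LeafwiseVectorField 𝓕 3)

/-- The displacement of the one-step map in the chart `φ` on the plaque with transverse
coordinate `z`. -/
noncomputable def chartIncr (φ : OpenPartialHomeomorph M (EuclideanSpace ℝ (Fin p) × Z)) (z : Z)
    (a : Inc d) (y : EuclideanSpace ℝ (Fin p)) : EuclideanSpace ℝ (Fin p) :=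
  rdeIncr (fun i y => (V i).comp φ (y, z)) (fun y => V₀.comp φ (y, z)) a y

/-- The one-step map in the chart `φ` on the plaque with transverse coordinate `z`. -/
noncomputable def chartStep (φ : OpenPartialHomeomorph M (EuclideanSpace ℝ (Fin p) × Z)) (z : Z)
    (a : Inc d) (y : EuclideanSpace ℝ (Fin p)) : EuclideanSpace ℝ (Fin p) :=
  rdeStep (fun i y => (V i).comp φ (y, z)) (fun y => V₀.comp φ (y, z)) a y

theorem rdeExpansion_eq {f : M → ℝ} (hf : 𝓕.LeafwiseCk 3 f)
    {φ : OpenPartialHomeomorph M (EuclideanSpace ℝ (Fin p) × Z)} (hφ : φ ∈ 𝓕.charts) {m : M}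
    (hm : m ∈ φ.source) (a : Inc d) {F : EuclideanSpace ℝ (Fin p) → ℝ}
    (hF : F = fun y => f (φ.symm (y, (φ m).2))) :
    rdeExpansion V V₀ f a m =
      fderiv ℝ F (φ m).1 (chartIncr V V₀ φ (φ m).2 a (φ m).1) +
      ∑ j, ∑ k, a.2.1 j k *
        fderiv ℝ (fderiv ℝ F) (φ m).1 ((V j).comp φ (φ m)) ((V k).comp φ (φ m)) := by
  have hle : ∀ l ≤ 3, 𝓕.LeafwiseCk l f := fun l hl ψ hψ =>
    (leafwiseCkOn_iff ψ.open_target).2 ((hf.leafwiseCkRec hψ).of_le hl)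
  have hmt : φ m ∈ φ.target := φ.map_source hm
  have h1 : ∀ W : LeafwiseVectorField 𝓕 3, W.lieDeriv f m =
      fderiv ℝ F (φ m).1 (W.comp φ (φ m)) := fun W => by
    rw [W.lieDeriv_eq (hle 1 (by norm_num)) hφ hm, hF]
    rfl
  have h2 : ∀ j k, (V j).lieDeriv ((V k).lieDeriv f) m =
      fderiv ℝ (fderiv ℝ F) (φ m).1 ((V j).comp φ (φ m)) ((V k).comp φ (φ m)) +
      fderiv ℝ F (φ m).1 (fderiv ℝ (fun y => (V k).comp φ (y, (φ m).2)) (φ m).1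
        ((V j).comp φ (φ m))) := by
    intro j k
    rw [(V j).lieDeriv_eq ((V k).leafwiseCk_lieDeriv (hle 2 (by norm_num)) (by norm_num)) hφ hm]
    have hev : (fun y => (V k).lieDeriv f (φ.symm (y, (φ m).2))) =ᶠ[nhds (φ m).1]
        fun y => fderiv ℝ F y ((V k).comp φ (y, (φ m).2)) := by
      filter_upwards [(isOpen_slice φ.open_target (φ m).2).mem_nhds hmt] with y hy
      have hy' : (y, (φ m).2) ∈ φ.target := hy
      rw [(V k).lieDeriv_eq (hle 1 (by norm_num)) hφ (φ.map_target hy'), φ.right_inv hy', hF]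
      rfl
    have hdF : DifferentiableAt ℝ (fderiv ℝ F) (φ m).1 := by
      rw [hF]
      exact (hf.leafwiseCkRec hφ).2.2.2.1 (φ m) hmt
    have hdV : DifferentiableAt ℝ (fun y => (V k).comp φ (y, (φ m).2)) (φ m).1 :=
      ((V k).leafwiseCkRec hφ).2.1 (φ m) hmt
    have := (hdF.hasFDerivAt.clm_apply hdV.hasFDerivAt).congr_of_eventuallyEq hev
    unfold leafDeriv
    rw [this.fderiv]
    simp [add_comm]
  unfold rdeExpansion chartIncr rdeIncr
  simp only [h1, h2, map_add, map_sum, map_smul, smul_eq_mul]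
  have e : ∀ j k : Fin d, (fderiv ℝ (fderiv ℝ F) (φ m).1 ((V j).comp φ (φ m))
      ((V k).comp φ (φ m)) + fderiv ℝ F (φ m).1
      (fderiv ℝ (fun y => (V k).comp φ (y, (φ m).2)) (φ m).1 ((V j).comp φ (φ m)))) * a.2.1 j k =
      a.2.1 j k * fderiv ℝ (fderiv ℝ F) (φ m).1 ((V j).comp φ (φ m)) ((V k).comp φ (φ m)) +
      a.2.1 j k * fderiv ℝ F (φ m).1
      (fderiv ℝ (fun y => (V k).comp φ (y, (φ m).2)) (φ m).1 ((V j).comp φ (φ m))) := by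
    intro j k; ring
  simp only [e, Finset.sum_add_distrib, mul_comm _ (a.1 _), mul_comm _ a.2.2]
  ring

end Charts

section TestFunctions

variable {p : ℕ} {Z M : Type*} [TopologicalSpace Z] [TopologicalSpace M]
  {𝓕 : FoliatedAtlas p Z M}

/-- A peak function on the transversal: compactly supported in `B` and equal to one only at `z₀`. -/
theorem exists_peak_function [LocallyCompactSpace Z] [TopologicalSpace.MetrizableSpace Z]
    {B : Set Z} (hB : IsOpen B) {z₀ : Z} (hz₀ : z₀ ∈ B) :
    ∃ η : Z → ℝ, Continuous η ∧ η z₀ = 1 ∧ (∀ z, η z = 1 → z = z₀) ∧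
      ∃ C : Set Z, IsCompact C ∧ C ⊆ B ∧ ∀ z ∉ C, η z = 0 := by
  let := TopologicalSpace.metrizableSpaceMetric Z
  obtain ⟨C, hC, hCB, hCc⟩ := local_compact_nhds (hB.mem_nhds hz₀)
  obtain ⟨ρ, hρ, hρC⟩ := Metric.mem_nhds_iff.1 hC
  refine ⟨fun z => max 0 (1 - dist z z₀ / ρ), by fun_prop, by simp, fun z hz => ?_, C, hCc, hCB,
    fun z hz => ?_⟩
  · rcases max_choice 0 (1 - dist z z₀ / ρ) with h | h
    · simp only at hz; rw [h] at hz; norm_num at hz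
    · simp only at hz
      rw [h] at hz
      have : dist z z₀ / ρ = 0 := by linarith
      rcases div_eq_zero_iff.1 this with h0 | h0
      · exact dist_eq_zero.1 h0
      · exact absurd h0 hρ.ne'
  · have : ρ ≤ dist z z₀ := by
      by_contra hlt
      exact hz (hρC (Metric.mem_ball.2 (not_le.1 hlt)))
    have := (one_le_div hρ).2 this
    exact max_eq_left (by linarith)

/-- Extension by zero of a compactly supported function from a chart to `M`. -/
theorem exists_leafwiseCk_extension [T2Space M] {k : ℕ}
    {φ : OpenPartialHomeomorph M (EuclideanSpace ℝ (Fin p) × Z)} (hφ : φ ∈ 𝓕.charts)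
    {F : EuclideanSpace ℝ (Fin p) × Z → ℝ} (hF : LeafwiseCkRec k F Set.univ)
    {C : Set (EuclideanSpace ℝ (Fin p) × Z)} (hC : IsCompact C) (hCt : C ⊆ φ.target)
    (hF0 : ∀ q ∉ C, F q = 0) :
    ∃ f : M → ℝ, 𝓕.LeafwiseCk k f ∧ ∀ m ∈ φ.source, f m = F (φ m) := by
  classical
  refine ⟨fun m => if m ∈ φ.source then F (φ m) else 0, fun ψ hψ => ?_, fun m hm => if_pos hm⟩
  rw [leafwiseCkOn_iff ψ.open_target]
  refine LeafwiseCkRec.of_local fun q hq => ?_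
  by_cases hqs : ψ.symm q ∈ φ.source
  · obtain ⟨O, hO, hqO, hOt, hOs, hk, g, hgc, hg⟩ := 𝓕.exists_transition hψ hφ hq hqs
    refine ⟨O, hO, hqO, (LeafwiseCkRec.comp hO hF (hk k) hgc fun _ _ => Set.mem_univ _).congr hO
      fun r hr => ?_⟩
    simp only
    rw [if_pos (hOs r hr), hg r hr]
  · have hcl : IsClosed (φ.symm '' C) :=
      (hC.image_of_continuousOn (φ.continuousOn_symm.mono hCt)).isClosed
    have hO : IsOpen (ψ.target ∩ ψ.symm ⁻¹' (φ.symm '' C)ᶜ) :=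
      ψ.continuousOn_symm.isOpen_inter_preimage ψ.open_target hcl.isOpen_compl
    refine ⟨_, hO, ⟨hq, ?_⟩, ?_⟩
    · rintro ⟨r, hr, hrq⟩
      exact hqs (hrq ▸ φ.map_target (hCt hr))
    · refine (LeafwiseCkRec.of_contDiff (χ := fun _ => (0 : ℝ)) contDiff_const _).congr hO
        fun r hr => ?_
      simp only
      split_ifs with hs
      · refine hF0 _ fun hmem => hr.2 ⟨_, hmem, φ.left_inv hs⟩
      · rfl

/-- Test functions that in a chart around `(y₀, z₀)` are products of a given function of `y` and of
a peak function of `z`. -/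
theorem exists_test_function [T2Space M] [LocallyCompactSpace Z]
    [TopologicalSpace.MetrizableSpace Z]
    {φ : OpenPartialHomeomorph M (EuclideanSpace ℝ (Fin p) × Z)} (hφ : φ ∈ 𝓕.charts)
    {y₀ : EuclideanSpace ℝ (Fin p)} {z₀ : Z} (h₀ : (y₀, z₀) ∈ φ.target) :
    ∃ r > 0, ∃ η : Z → ℝ, η z₀ = 1 ∧ (∀ z, η z = 1 → z = z₀) ∧
      ∀ g : EuclideanSpace ℝ (Fin p) → ℝ, ContDiff ℝ 3 g → ∃ f : M → ℝ, 𝓕.LeafwiseCk 3 f ∧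
        ∀ m ∈ φ.source, (φ m).1 ∈ Metric.ball y₀ r → f m = g (φ m).1 * η (φ m).2 := by
  obtain ⟨B₁, B₂, hB₁, -, hB₂, ht⟩ := 𝓕.target_eq_prod φ hφ
  have h₀' : y₀ ∈ B₁ ∧ z₀ ∈ B₂ := by rw [ht] at h₀; exact h₀
  obtain ⟨η, hη, hη1, hη2, C, hC, hCB, hC0⟩ := exists_peak_function hB₂ h₀'.2
  obtain ⟨ρ, hρ, hρB⟩ := Metric.mem_nhds_iff.1 (hB₁.mem_nhds h₀'.1)
  let χ : ContDiffBump y₀ := ⟨ρ / 3, ρ / 2, by linarith, by linarith⟩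
  refine ⟨ρ / 3, by linarith, η, hη1, hη2, fun g hg => ?_⟩
  have hχ : ContDiff ℝ 3 (fun y => χ y * g y) := χ.contDiff.mul hg
  obtain ⟨f, hf, hfφ⟩ := exists_leafwiseCk_extension (𝓕 := 𝓕) hφ
    (F := fun q => (χ q.1 * g q.1) * η q.2)
    (LeafwiseCkRec.bilin isOpen_univ (ContinuousLinearMap.mul ℝ ℝ)
      (LeafwiseCkRec.of_contDiff hχ _) (LeafwiseCkRec.of_transverse hη _))
    (C := Metric.closedBall y₀ (ρ / 2) ×ˢ C) ((isCompact_closedBall _ _).prod hC)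
    (by rw [ht]; exact Set.prod_mono ((Metric.closedBall_subset_ball (by linarith)).trans hρB) hCB)
    (fun q hq => by
      by_cases h1 : q.1 ∈ Metric.closedBall y₀ (ρ / 2)
      · rw [hC0 q.2 fun h2 => hq ⟨h1, h2⟩, mul_zero]
      · rw [χ.zero_of_le_dist (not_le.1 h1).le, zero_mul, zero_mul])
  refine ⟨f, hf, fun m hm hr => ?_⟩
  rw [hfφ m hm]
  rw [χ.one_of_mem_closedBall (Metric.ball_subset_closedBall hr), one_mul]

end TestFunctions

/-! ### Solutions and their local description in charts -/

/-- A path whose increments are of order greater than one is constant. -/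
theorem eq_of_abs_sub_le_rpow {u : ℝ → ℝ} {a b C θ : ℝ} (hθ : 1 < θ) (hab : a ≤ b)
    (h : ∀ s t, a ≤ s → s ≤ t → t ≤ b → |u t - u s| ≤ C * (t - s) ^ θ) : u b = u a := by
  have hid : ∀ (n : ℕ) (s h y : ℝ), euler (fun _ _ y : ℝ => y) s h n y = y := by
    intro n
    induction n with
    | zero => intro s h y; rfl
    | succ n ih => intro s h y; rw [euler]; exact ih _ _ _
  have key : ∀ n : ℕ, 0 < n → ‖u b - u a‖ ≤ n * (C * ((b - a) / n) ^ θ) := by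
    intro n hn
    have hn0 : (0 : ℝ) < n := by exact_mod_cast hn
    have hnh : a + n * ((b - a) / n) = b := by field_simp; ring
    have hh : 0 ≤ (b - a) / n := div_nonneg (by linarith) hn0.le
    have := norm_sub_euler_le (μ := fun _ _ y : ℝ => y) (B := Set.univ) (L := 1) (a := a) (b := b)
      (e := C * ((b - a) / n) ^ θ) hh
      (fun s n _ _ y _ y' _ => by simp [hid]) (by norm_num) (y := u)
      (fun _ _ _ => Set.mem_univ _) (fun _ _ _ => Set.mem_univ _)
      (fun s h1 h2 => by
        have := h s (s + (b - a) / n) h1 (by linarith) h2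
        rwa [add_sub_cancel_left] at this) n a le_rfl hnh.le
    rwa [hnh, hid, one_mul] at this
  have h0 := ge_of_tendsto (tendsto_nat_mul_div_rpow hθ (sub_nonneg.2 hab) C)
    ((Filter.eventually_gt_atTop 0).mono key)
  exact sub_eq_zero.1 (norm_le_zero_iff.1 h0)

/-- A continuous function on the simplex that is of order `θ` near each point of the diagonal is of
order `θ` uniformly. -/
theorem exists_forall_abs_le_rpow {e : ℝ → ℝ → ℝ} {a b θ : ℝ} (hθ : 0 < θ)
    (hc : ContinuousOn (fun q : ℝ × ℝ => e q.1 q.2) {q | a ≤ q.1 ∧ q.1 ≤ q.2 ∧ q.2 ≤ b})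
    (hdiag : ∀ t₀ ∈ Set.Icc a b, ∃ δ > 0, ∃ C ≥ 0, ∀ s t, a ≤ s → s ≤ t → t ≤ b →
      |s - t₀| < δ → |t - t₀| < δ → |e s t| ≤ C * (t - s) ^ θ) :
    ∃ C, ∀ s t, a ≤ s → s ≤ t → t ≤ b → |e s t| ≤ C * (t - s) ^ θ := by
  set S : Set (ℝ × ℝ) := {q | a ≤ q.1 ∧ q.1 ≤ q.2 ∧ q.2 ≤ b} with hS
  have hScomp : IsCompact S := by
    refine (isCompact_Icc (a := (a, a)) (b := (b, b))).of_isClosed_subset ?_ ?_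
    · exact (isClosed_le continuous_const continuous_fst).inter
        ((isClosed_le continuous_fst continuous_snd).inter
        (isClosed_le continuous_snd continuous_const))
    · rintro ⟨s, t⟩ ⟨h1, h2, h3⟩
      exact ⟨⟨h1, h1.trans h2⟩, ⟨h2.trans h3, h3⟩⟩
  obtain ⟨B, hB⟩ := hScomp.exists_bound_of_continuousOn hc
  have hloc : ∀ q ∈ S, ∃ O ∈ nhdsWithin q S, ∃ C, ∀ r ∈ O, r ∈ S →
      |e r.1 r.2| ≤ C * (r.2 - r.1) ^ θ := by
    rintro ⟨s₀, t₀⟩ ⟨has, hst, htb⟩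
    simp only at has hst htb
    rcases hst.lt_or_eq with hlt | rfl
    · have hB0 : 0 ≤ B := (norm_nonneg _).trans (hB (s₀, t₀) ⟨has, hst, htb⟩)
      set τ := (t₀ - s₀) / 2 with hτ
      have hτ0 : 0 < τ := by rw [hτ]; linarith
      have hop : IsOpen {q : ℝ × ℝ | τ < q.2 - q.1} :=
        isOpen_lt continuous_const (continuous_snd.sub continuous_fst)
      refine ⟨_, mem_nhdsWithin_of_mem_nhds (hop.mem_nhds (by
        change τ < t₀ - s₀
        rw [hτ]; linarith)), B / τ ^ θ, fun r hr hrS => ?_⟩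
      have hr' : τ < r.2 - r.1 := hr
      refine (hB r hrS).trans ?_
      rw [div_mul_eq_mul_div, le_div_iff₀ (by positivity)]
      exact mul_le_mul_of_nonneg_left (Real.rpow_le_rpow hτ0.le hr'.le hθ.le) hB0
    · obtain ⟨δ, hδ, C, -, hC⟩ := hdiag s₀ ⟨has, htb⟩
      refine ⟨_, mem_nhdsWithin_of_mem_nhds (Metric.ball_mem_nhds (s₀, s₀) hδ), C, ?_⟩
      rintro ⟨s, t⟩ hst ⟨h1, h2, h3⟩
      rw [← ball_prod_same] at hst
      exact hC s t h1 h2 h3 hst.1 hst.2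
  obtain ⟨C, hC⟩ := hScomp.induction_on
    (p := fun O => ∃ C, ∀ r ∈ O, r ∈ S → |e r.1 r.2| ≤ C * (r.2 - r.1) ^ θ)
    ⟨0, fun r hr => absurd hr (Set.notMem_empty r)⟩
    (fun O O' hO ⟨C, h⟩ => ⟨C, fun r hr => h r (hO hr)⟩)
    (fun O O' ⟨C, h⟩ ⟨C', h'⟩ => ⟨max C C', fun r hr hrS => by
      have : 0 ≤ (r.2 - r.1) ^ θ := Real.rpow_nonneg (sub_nonneg.2 hrS.2.1) _
      rcases hr with hr | hr
      · exact (h r hr hrS).trans (mul_le_mul_of_nonneg_right (le_max_left _ _) this)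
      · exact (h' r hr hrS).trans (mul_le_mul_of_nonneg_right (le_max_right _ _) this)⟩)
    (fun q hq => by
      obtain ⟨O, hO, C, h⟩ := hloc q hq
      exact ⟨O, hO, C, h⟩)
  exact ⟨C, fun s t h1 h2 h3 => hC (s, t) ⟨h1, h2, h3⟩ ⟨h1, h2, h3⟩⟩

theorem norm_le_sum_abs {p : ℕ} (v : EuclideanSpace ℝ (Fin p)) : ‖v‖ ≤ ∑ i, |v i| := by
  conv_lhs => rw [← (EuclideanSpace.basisFun (Fin p) ℝ).sum_repr v]
  refine (norm_sum_le _ _).trans (le_of_eq (Finset.sum_congr rfl fun i _ => ?_))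
  rw [norm_smul, (EuclideanSpace.basisFun (Fin p) ℝ).norm_eq_one, mul_one, Real.norm_eq_abs]
  simp

section Solutions

variable {p d : ℕ} {Z M : Type*} [TopologicalSpace Z] [TopologicalSpace M]
  {𝓕 : FoliatedAtlas p Z M} (V : Fin d → LeafwiseVectorField 𝓕 3)
  (V₀ : LeafwiseVectorField 𝓕 3)

/-- `x` solves, on the interval `[a, b]`, the equation driven by `A`. -/
def IsSolOn (A : ℝ → ℝ → Inc d) (α : ℝ) (x : ℝ → M) (a b : ℝ) : Prop :=
  ContinuousOn x (Set.Icc a b) ∧ ∀ f : M → ℝ, 𝓕.LeafwiseCk 3 f →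
    ∃ C : ℝ, ∀ s t, a ≤ s → s ≤ t → t ≤ b →
      |f (x t) - f (x s) - rdeExpansion V V₀ f (A s t) (x s)| ≤ C * (t - s) ^ (3 * α)

/-- On the times in `I`, the path `x` stays in one plaque of the chart `φ` and follows the one-step
maps of the equation up to an error of order `3 α`. -/
def DavieOn (A : ℝ → ℝ → Inc d) (α : ℝ)
    (φ : OpenPartialHomeomorph M (EuclideanSpace ℝ (Fin p) × Z)) (z : Z) (x : ℝ → M)
    (I : Set ℝ) : Prop :=
  (∀ s ∈ I, x s ∈ φ.source ∧ (φ (x s)).2 = z) ∧ ∃ C ≥ 0, ∀ s ∈ I, ∀ t ∈ I, s ≤ t →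
    ‖(φ (x t)).1 - chartStep V V₀ φ z (A s t) (φ (x s)).1‖ ≤ C * (t - s) ^ (3 * α)

variable {V V₀} {A : ℝ → ℝ → Inc d} {α R : ℝ} {x : ℝ → M} {a b : ℝ}

theorem IsSolOn.mono (h : IsSolOn V V₀ A α x a b) {a' b' : ℝ} (ha : a ≤ a') (hb : b' ≤ b) :
    IsSolOn V V₀ A α x a' b' := by
  refine ⟨h.1.mono (Set.Icc_subset_Icc ha hb), fun f hf => ?_⟩
  obtain ⟨C, hC⟩ := h.2 f hf
  exact ⟨C, fun s t h1 h2 h3 => hC s t (ha.trans h1) h2 (h3.trans hb)⟩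

theorem DavieOn.mono {φ : OpenPartialHomeomorph M (EuclideanSpace ℝ (Fin p) × Z)} {z : Z}
    {I J : Set ℝ} (h : DavieOn V V₀ A α φ z x I) (hJ : J ⊆ I) : DavieOn V V₀ A α φ z x J := by
  obtain ⟨h1, C, hC, h2⟩ := h
  exact ⟨fun s hs => h1 s (hJ hs), C, hC, fun s hs t ht => h2 s (hJ hs) t (hJ ht)⟩

/-- A neighbourhood of `t₀` in `[a, b]`. -/
theorem mem_Icc_inter_ball {a b t₀ ε s : ℝ} :
    s ∈ Set.Icc a b ∩ Metric.ball t₀ ε ↔ (a ≤ s ∧ s ≤ b) ∧ |s - t₀| < ε := by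
  rw [Set.mem_inter_iff, Set.mem_Icc, Metric.mem_ball, Real.dist_eq]

theorem exists_mapsTo_of_continuousOn {x : ℝ → M} {a b t₀ : ℝ}
    (hx : ContinuousOn x (Set.Icc a b)) (ht₀ : t₀ ∈ Set.Icc a b) {U : Set M} (hU : U ∈ nhds (x t₀)) :
    ∃ ε > 0, ∀ s ∈ Set.Icc a b ∩ Metric.ball t₀ ε, x s ∈ U := by
  have := hx t₀ ht₀ hU
  rw [Filter.mem_map, Metric.mem_nhdsWithin_iff] at this
  obtain ⟨ε, hε, h⟩ := this
  exact ⟨ε, hε, fun s hs => h ⟨hs.2, hs.1⟩⟩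

theorem chartBox_mem_nhds {φ : OpenPartialHomeomorph M (EuclideanSpace ℝ (Fin p) × Z)} {m : M}
    (hm : m ∈ φ.source) {O : Set (EuclideanSpace ℝ (Fin p) × Z)} (hO : O ∈ nhds (φ m)) :
    φ.source ∩ φ ⁻¹' O ∈ nhds m :=
  Filter.inter_mem (φ.open_source.mem_nhds hm) ((φ.continuousAt hm) hO)

/-- Solutions stay in the plaques of charts, and follow the one-step maps there. -/
theorem IsSolOn.davieOn [T2Space M] [LocallyCompactSpace Z] [TopologicalSpace.MetrizableSpace Z]
    (hα : 1 / 3 < α) (h : IsSolOn V V₀ A α x a b) {t₀ : ℝ} (ht₀ : t₀ ∈ Set.Icc a b)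
    {φ : OpenPartialHomeomorph M (EuclideanSpace ℝ (Fin p) × Z)} (hφ : φ ∈ 𝓕.charts)
    (hm : x t₀ ∈ φ.source) :
    ∃ ε > 0, DavieOn V V₀ A α φ (φ (x t₀)).2 x (Set.Icc a b ∩ Metric.ball t₀ ε) := by
  obtain ⟨r, hr, η, hη1, hη2, H⟩ := exists_test_function (𝓕 := 𝓕) hφ
    (y₀ := (φ (x t₀)).1) (z₀ := (φ (x t₀)).2) (φ.map_source hm)
  set z₀ := (φ (x t₀)).2 with hz₀
  obtain ⟨ε, hε, hxε⟩ := exists_mapsTo_of_continuousOn h.1 ht₀ (chartBox_mem_nhds hm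
    (continuous_fst.continuousAt (Metric.ball_mem_nhds (φ (x t₀)).1 hr)))
  have hsrc : ∀ s ∈ Set.Icc a b ∩ Metric.ball t₀ ε, x s ∈ φ.source := fun s hs => (hxε s hs).1
  have hball : ∀ s ∈ Set.Icc a b ∩ Metric.ball t₀ ε, (φ (x s)).1 ∈ Metric.ball (φ (x t₀)).1 r :=
    fun s hs => (hxε s hs).2
  have hslice : ∀ s ∈ Set.Icc a b ∩ Metric.ball t₀ ε, ∀ (g : EuclideanSpace ℝ (Fin p) → ℝ)
      (f : M → ℝ), (∀ m ∈ φ.source, (φ m).1 ∈ Metric.ball (φ (x t₀)).1 r →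
        f m = g (φ m).1 * η (φ m).2) →
      (fun y => f (φ.symm (y, (φ (x s)).2))) =ᶠ[nhds (φ (x s)).1]
        fun y => g y * η (φ (x s)).2 := by
    intro s hs g f hf
    filter_upwards [(isOpen_slice φ.open_target (φ (x s)).2).mem_nhds (φ.map_source (hsrc s hs)),
      Metric.isOpen_ball.mem_nhds (hball s hs)] with y hy hy'
    have hy : (y, (φ (x s)).2) ∈ φ.target := hy
    have e := φ.right_inv hy
    rw [hf _ (φ.map_target hy) (by rw [e]; exact hy'), e]
  have hz : ∀ s ∈ Set.Icc a b ∩ Metric.ball t₀ ε, (φ (x s)).2 = z₀ := by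
    obtain ⟨f, hf, hfφ⟩ := H (fun _ => 1) contDiff_const
    obtain ⟨C, hC⟩ := h.2 f hf
    have hexp : ∀ s ∈ Set.Icc a b ∩ Metric.ball t₀ ε, ∀ a' : Inc d,
        rdeExpansion V V₀ f a' (x s) = 0 := by
      intro s hs a'
      rw [rdeExpansion_eq V V₀ hf hφ (hsrc s hs) a' rfl]
      have e1 := hslice s hs (fun _ => 1) f hfφ
      have e2 : fderiv ℝ (fun y => f (φ.symm (y, (φ (x s)).2))) =ᶠ[nhds (φ (x s)).1]
          fun _ => 0 := by
        refine e1.fderiv.trans (Filter.Eventually.of_forall fun y => ?_)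
        exact fderiv_const_apply _
      have e3 : fderiv ℝ (fderiv ℝ (fun y => f (φ.symm (y, (φ (x s)).2)))) (φ (x s)).1 = 0 := by
        rw [e2.fderiv_eq]
        exact fderiv_const_apply _
      rw [e3, e2.eq_of_nhds]
      simp
    have hconst : ∀ s ∈ Set.Icc a b ∩ Metric.ball t₀ ε, ∀ t ∈ Set.Icc a b ∩ Metric.ball t₀ ε,
        s ≤ t → f (x t) = f (x s) := by
      intro s hs t ht hst
      rw [mem_Icc_inter_ball, abs_lt] at hs ht
      refine eq_of_abs_sub_le_rpow (u := fun s => f (x s)) (C := C) (θ := 3 * α) (by linarith) hst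
        fun s' t' h1 h2 h3 => ?_
      have := hC s' t' (by linarith) h2 (by linarith)
      rwa [hexp s' (by rw [mem_Icc_inter_ball, abs_lt]; constructor <;> constructor <;> linarith),
        sub_zero] at this
    have ht₀' : t₀ ∈ Set.Icc a b ∩ Metric.ball t₀ ε := ⟨ht₀, Metric.mem_ball_self hε⟩
    intro s hs
    refine hη2 _ ?_
    have e1 := hfφ _ (hsrc s hs) (hball s hs)
    have e2 := hfφ _ hm (Metric.mem_ball_self hr)
    rw [← hz₀, hη1] at e2
    rw [one_mul] at e1 e2
    rw [← e1, ← e2]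
    rcases le_total s t₀ with hst | hst
    · exact (hconst s hs t₀ ht₀' hst).symm
    · exact hconst t₀ ht₀' s hs hst
  have hcoord : ∀ i : Fin p, ∃ C : ℝ, ∀ s ∈ Set.Icc a b ∩ Metric.ball t₀ ε,
      ∀ t ∈ Set.Icc a b ∩ Metric.ball t₀ ε, s ≤ t →
      |((φ (x t)).1 - chartStep V V₀ φ z₀ (A s t) (φ (x s)).1) i| ≤ C * (t - s) ^ (3 * α) := by
    intro i
    set ℓ : EuclideanSpace ℝ (Fin p) →L[ℝ] ℝ := EuclideanSpace.proj i with hℓ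
    obtain ⟨f, hf, hfφ⟩ := H ℓ ℓ.contDiff
    obtain ⟨C, hC⟩ := h.2 f hf
    have hval : ∀ s ∈ Set.Icc a b ∩ Metric.ball t₀ ε, f (x s) = ℓ (φ (x s)).1 := fun s hs => by
      rw [hfφ _ (hsrc s hs) (hball s hs), hz s hs, hη1, mul_one]
    refine ⟨C, fun s hs t ht hst => ?_⟩
    have hexp : rdeExpansion V V₀ f (A s t) (x s) =
        ℓ (chartIncr V V₀ φ z₀ (A s t) (φ (x s)).1) := by
      rw [rdeExpansion_eq V V₀ hf hφ (hsrc s hs) (A s t) rfl]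
      have e1 := hslice s hs _ f hfφ
      rw [hz s hs, hη1] at e1
      rw [hz s hs]
      have e2 : fderiv ℝ (fun y => f (φ.symm (y, z₀))) =ᶠ[nhds (φ (x s)).1] fun _ => ℓ := by
        refine e1.fderiv.trans (Filter.Eventually.of_forall fun y => ?_)
        simp only [mul_one]
        exact ℓ.fderiv
      have e3 : fderiv ℝ (fderiv ℝ (fun y => f (φ.symm (y, z₀)))) (φ (x s)).1 = 0 := by
        rw [e2.fderiv_eq]
        exact fderiv_const_apply _
      rw [e3, e2.eq_of_nhds]
      simp
    have := hC s t hs.1.1 hst ht.1.2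
    rw [hval s hs, hval t ht, hexp] at this
    have e : ((φ (x t)).1 - chartStep V V₀ φ z₀ (A s t) (φ (x s)).1) i =
        ℓ (φ (x t)).1 - ℓ (φ (x s)).1 - ℓ (chartIncr V V₀ φ z₀ (A s t) (φ (x s)).1) := by
      simp [hℓ, chartStep, rdeStep, chartIncr]
      ring
    rwa [e]
  choose C hC using hcoord
  refine ⟨ε, hε, fun s hs => ⟨hsrc s hs, hz s hs⟩, ∑ i, |C i|, by positivity,
    fun s hs t ht hst => ?_⟩
  refine (norm_le_sum_abs _).trans ?_
  rw [Finset.sum_mul]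
  refine Finset.sum_le_sum fun i _ => (hC i s hs t ht hst).trans ?_
  exact mul_le_mul_of_nonneg_right (le_abs_self _) (Real.rpow_nonneg (by linarith) _)

theorem exists_fieldBound (V : Fin d → LeafwiseVectorField 𝓕 3) (V₀ : LeafwiseVectorField 𝓕 3)
    {φ : OpenPartialHomeomorph M (EuclideanSpace ℝ (Fin p) × Z)} (hφ : φ ∈ 𝓕.charts)
    {D : Set (EuclideanSpace ℝ (Fin p))} {C : Set Z} (hD : IsCompact D) (hDc : Convex ℝ D)
    (hC : IsCompact C) (hDC : D ×ˢ C ⊆ φ.target) :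
    ∃ K ≥ 0, ∀ z ∈ C, FieldBound (fun i y => (V i).comp φ (y, z)) (fun y => V₀.comp φ (y, z)) D K := by
  have h2 : ∀ W : LeafwiseVectorField 𝓕 3, LeafwiseCkRec 2 (W.comp φ) φ.target := fun W =>
    (W.leafwiseCkRec hφ).of_succ
  choose K hK using fun i => (h2 (V i)).exists_hasC2Bound hD hDc hC hDC
  obtain ⟨K₀, hK₀⟩ := (h2 V₀).exists_hasC2Bound hD hDc hC hDC
  have hle : ∀ i, K i ≤ ∑ i, |K i| + |K₀| := fun i => by
    have := Finset.single_le_sum (f := fun i => |K i|) (fun i _ => abs_nonneg _)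
      (Finset.mem_univ i)
    linarith [le_abs_self (K i), abs_nonneg K₀]
  refine ⟨∑ i, |K i| + |K₀|, by positivity, fun z hz => ⟨fun i => (hK i z hz).mono le_rfl (hle i),
    (hK₀ z hz).mono le_rfl ?_⟩⟩
  have : 0 ≤ ∑ i, |K i| := by positivity
  linarith [le_abs_self K₀]

theorem exists_closedBall_slice_subset
    {φ : OpenPartialHomeomorph M (EuclideanSpace ℝ (Fin p) × Z)} {q : EuclideanSpace ℝ (Fin p) × Z}
    (hq : q ∈ φ.target) : ∃ r > 0, Metric.closedBall q.1 r ×ˢ {q.2} ⊆ φ.target := by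
  obtain ⟨r, hr, h⟩ := Metric.nhds_basis_closedBall.mem_iff.1
    ((isOpen_slice φ.open_target q.2).mem_nhds hq)
  refine ⟨r, hr, ?_⟩
  rintro ⟨y, z⟩ ⟨hy, rfl⟩
  exact h hy

theorem continuous_rdeExpansion {f : M → ℝ} (hf : 𝓕.LeafwiseCk 3 f) :
    Continuous fun q : Inc d × M => rdeExpansion V V₀ f q.1 q.2 := by
  have h2 : ∀ l ≤ 3, 𝓕.LeafwiseCk l f := fun l hl ψ hψ =>
    (leafwiseCkOn_iff ψ.open_target).2 ((hf.leafwiseCkRec hψ).of_le hl)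
  have c1 : ∀ W : LeafwiseVectorField 𝓕 3, Continuous (W.lieDeriv f) := fun W =>
    (W.leafwiseCk_lieDeriv (l := 2) hf (by norm_num)).continuous
  have c2 : ∀ j k, Continuous ((V j).lieDeriv ((V k).lieDeriv f)) := fun j k =>
    ((V j).leafwiseCk_lieDeriv (l := 1) ((V k).leafwiseCk_lieDeriv (l := 2) hf (by norm_num))
      (by norm_num)).continuous
  have c1' : ∀ W : LeafwiseVectorField 𝓕 3, Continuous fun q : Inc d × M => W.lieDeriv f q.2 :=
    fun W => (c1 W).comp continuous_snd
  have c2' : ∀ j k, Continuous fun q : Inc d × M => (V j).lieDeriv ((V k).lieDeriv f) q.2 :=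
    fun j k => (c2 j k).comp continuous_snd
  unfold rdeExpansion
  refine Continuous.add (Continuous.add ?_ ?_) ?_
  · exact continuous_finsetSum _ fun i _ => (c1' (V i)).mul (by fun_prop)
  · exact continuous_finsetSum _ fun j _ => continuous_finsetSum _ fun k _ =>
      (c2' j k).mul (by fun_prop)
  · exact (c1' V₀).mul (by fun_prop)

/-- Near a time at which the path follows the one-step maps in a chart, it satisfies the expansion
that defines solutions. -/
theorem DavieOn.exists_abs_expansion_le (hα : 0 < α) (hR : 0 ≤ R) (hA : IsDriver A α R a b)
    (hx : ContinuousOn x (Set.Icc a b)) {f : M → ℝ} (hf : 𝓕.LeafwiseCk 3 f)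
    {φ : OpenPartialHomeomorph M (EuclideanSpace ℝ (Fin p) × Z)} (hφ : φ ∈ 𝓕.charts) {z : Z}
    {s₀ ε : ℝ} (hs₀I : s₀ ∈ Set.Icc a b) (hε : 0 < ε)
    (h : DavieOn V V₀ A α φ z x (Set.Icc a b ∩ Metric.ball s₀ ε)) :
    ∃ δ > 0, ∃ C ≥ 0, ∀ s t, a ≤ s → s ≤ t → t ≤ b → |s - s₀| < δ → |t - s₀| < δ →
      |f (x t) - f (x s) - rdeExpansion V V₀ f (A s t) (x s)| ≤ C * (t - s) ^ (3 * α) := by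
  obtain ⟨hsrc, C, hC, hD⟩ := h
  have hs₀ := hsrc s₀ ⟨hs₀I, Metric.mem_ball_self hε⟩
  obtain ⟨r, hr, hrt⟩ := exists_closedBall_slice_subset (φ.map_source hs₀.1)
  rw [hs₀.2] at hrt
  obtain ⟨ε', hε', hxε⟩ := exists_mapsTo_of_continuousOn hx hs₀I (chartBox_mem_nhds hs₀.1
    (continuous_fst.continuousAt (Metric.closedBall_mem_nhds (φ (x s₀)).1 hr)))
  obtain ⟨K₁, hK₁, hV⟩ := exists_fieldBound V V₀ hφ (isCompact_closedBall _ r)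
    (convex_closedBall _ _) isCompact_singleton hrt
  have hF := hf.leafwiseCkRec hφ
  obtain ⟨K₂, hK₂⟩ := hF.2.2.exists_hasC2Bound (isCompact_closedBall _ r)
    (convex_closedBall _ _) isCompact_singleton hrt
  set F : EuclideanSpace ℝ (Fin p) → ℝ := fun y => f (φ.symm (y, z)) with hFdef
  set K := max K₁ K₂ with hK
  have hV' := (hV z rfl).mono (le_refl (Metric.closedBall (φ (x s₀)).1 r)) (le_max_left K₁ K₂)
  have hF2 : HasC2Bound (fderiv ℝ F) (Metric.closedBall (φ (x s₀)).1 r) K :=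
    (hK₂ z rfl).mono le_rfl (le_max_right _ _)
  have hK0 : 0 ≤ K := hK₁.trans (le_max_left _ _)
  obtain ⟨B, hB⟩ : ∃ B, B = R * (d * K + 2 * d ^ 2 * K ^ 2 + K) + C := ⟨_, rfl⟩
  have hB0 : 0 ≤ B := by rw [hB]; positivity
  refine ⟨min (min ε ε') (1 / 2), lt_min (lt_min hε hε') (by norm_num),
    K * B ^ 3 + K * C + 2 * K * B ^ 2, by positivity, fun s t h1 h2 h3 hs ht => ?_⟩
  simp only [lt_min_iff] at hs ht
  have hsI : s ∈ Set.Icc a b ∩ Metric.ball s₀ ε :=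
    mem_Icc_inter_ball.2 ⟨⟨h1, h2.trans h3⟩, hs.1.1⟩
  have htI : t ∈ Set.Icc a b ∩ Metric.ball s₀ ε :=
    mem_Icc_inter_ball.2 ⟨⟨h1.trans h2, h3⟩, ht.1.1⟩
  have hys := (hxε s (mem_Icc_inter_ball.2 ⟨⟨h1, h2.trans h3⟩, hs.1.2⟩)).2
  have hyt := (hxε t (mem_Icc_inter_ball.2 ⟨⟨h1.trans h2, h3⟩, ht.1.2⟩)).2
  have hlen : t - s ≤ 1 := by
    have := (abs_lt.1 hs.2).1
    have := (abs_lt.1 ht.2).2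
    linarith
  have hκ0 : 0 ≤ (t - s) ^ α := Real.rpow_nonneg (by linarith) _
  have hκ1 : (t - s) ^ α ≤ 1 := Real.rpow_le_one (by linarith) hlen hα.le
  have hfs : ∀ s ∈ Set.Icc a b ∩ Metric.ball s₀ ε, f (x s) = F (φ (x s)).1 := fun s hs => by
    rw [hFdef]
    simp only
    rw [← (hsrc s hs).2, Prod.mk.eta, φ.left_inv (hsrc s hs).1]
  have hmemt : ∀ y ∈ Metric.closedBall (φ (x s₀)).1 r, (y, z) ∈ φ.target := fun y hy =>
    hrt ⟨hy, rfl⟩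
  have hsymm : ∀ y ∈ Metric.closedBall (φ (x s₀)).1 r, ∀ u v,
      fderiv ℝ (fderiv ℝ F) y u v = fderiv ℝ (fderiv ℝ F) y v u := fun y hy u v =>
    ((hF.contDiffAt φ.open_target (hmemt y hy)).isSymmSndFDerivAt (by simp; norm_num)).eq u v
  have key := hV'.abs_sub_expansion_le (convex_closedBall _ _) hR (F := F)
    (fun y hy => hF.2.1 (y, z) (hmemt y hy)) hF2 hsymm hC hB hκ0 hκ1 (hA.size s t h1 h2 h3)
    (hA.geometric s t h1 h2 h3) hys hyt
    (by rw [rpow_pow_three (by linarith)]; exact hD s hsI t htI h2)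
  rw [rpow_pow_three (by linarith)] at key
  have hexp := rdeExpansion_eq V V₀ hf hφ (hsrc s hsI).1 (A s t) (F := F)
    (by rw [(hsrc s hsI).2])
  have hφs : φ (x s) = ((φ (x s)).1, z) := Prod.ext rfl (hsrc s hsI).2
  rw [hφs] at hexp
  rw [hexp, hfs s hsI, hfs t htI]
  exact key

/-- A continuous path that follows the one-step maps in some chart near each time is a solution. -/
theorem isSolOn_of_davieOn (hα : 0 < α) (hR : 0 ≤ R) (hA : IsDriver A α R a b)
    (hx : ContinuousOn x (Set.Icc a b))
    (h : ∀ t₀ ∈ Set.Icc a b, ∃ φ ∈ 𝓕.charts, ∃ z, ∃ ε > 0,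
      DavieOn V V₀ A α φ z x (Set.Icc a b ∩ Metric.ball t₀ ε)) :
    IsSolOn V V₀ A α x a b := by
  refine ⟨hx, fun f hf => ?_⟩
  refine exists_forall_abs_le_rpow (by linarith : 0 < 3 * α) (e := fun s t =>
    f (x t) - f (x s) - rdeExpansion V V₀ f (A s t) (x s)) ?_ fun t₀ ht₀ => ?_
  · have x1 : ContinuousOn (fun q : ℝ × ℝ => x q.1) {q | a ≤ q.1 ∧ q.1 ≤ q.2 ∧ q.2 ≤ b} :=
      hx.comp continuous_fst.continuousOn fun q hq => ⟨hq.1, hq.2.1.trans hq.2.2⟩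
    have x2 : ContinuousOn (fun q : ℝ × ℝ => x q.2) {q | a ≤ q.1 ∧ q.1 ≤ q.2 ∧ q.2 ≤ b} :=
      hx.comp continuous_snd.continuousOn fun q hq => ⟨hq.1.trans hq.2.1, hq.2.2⟩
    have x3 : ContinuousOn (fun q : ℝ × ℝ => ((A q.1 q.2, x q.1) : Inc d × M))
        {q | a ≤ q.1 ∧ q.1 ≤ q.2 ∧ q.2 ≤ b} := hA.continuousOn.prodMk x1
    refine ContinuousOn.sub (ContinuousOn.sub ?_ ?_) ?_
    · exact hf.continuous.comp_continuousOn x2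
    · exact hf.continuous.comp_continuousOn x1
    · have x4 := continuous_rdeExpansion (V := V) (V₀ := V₀) hf
      have x5 := Continuous.comp_continuousOn (g := fun q : Inc d × M => rdeExpansion V V₀ f q.1 q.2)
        (f := fun q : ℝ × ℝ => ((A q.1 q.2, x q.1) : Inc d × M)) x4 x3
      exact x5
  · obtain ⟨φ, hφ, z, ε, hε, hD⟩ := h t₀ ht₀
    exact hD.exists_abs_expansion_le hα hR hA hx hf hφ ht₀ hε

end Solutions

/-! ### Concatenation and reversal of solutions -/

section GlueReverse

variable {p d : ℕ} {Z M : Type*} [TopologicalSpace Z] [TopologicalSpace M]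
  {𝓕 : FoliatedAtlas p Z M} {V : Fin d → LeafwiseVectorField 𝓕 3}
  {V₀ : LeafwiseVectorField 𝓕 3} {A : ℝ → ℝ → Inc d} {α R : ℝ} {x : ℝ → M} {a b c : ℝ}

theorem IsSolOn.glue [T2Space M] [LocallyCompactSpace Z] [TopologicalSpace.MetrizableSpace Z]
    (hα : 1 / 3 < α) (hR : 0 ≤ R) (hA : IsDriver A α R a c) (hab : a ≤ b) (hbc : b ≤ c)
    (h : IsSolOn V V₀ A α x a b) (h' : IsSolOn V V₀ A α x b c) : IsSolOn V V₀ A α x a c := by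
  have hα0 : 0 < α := by linarith
  have hx : ContinuousOn x (Set.Icc a c) := by
    rw [← Set.Icc_union_Icc_eq_Icc hab hbc]
    exact h.1.union_of_isClosed h'.1 isClosed_Icc isClosed_Icc
  refine isSolOn_of_davieOn hα0 hR hA hx fun t₀ ht₀ => ?_
  obtain ⟨φ, hφ, hm⟩ := 𝓕.exists_chart (x t₀)
  refine ⟨φ, hφ, (φ (x t₀)).2, ?_⟩
  rcases lt_trichotomy t₀ b with hlt | rfl | hgt
  · obtain ⟨ε, hε, hD⟩ := h.davieOn hα (t₀ := t₀) ⟨ht₀.1, hlt.le⟩ hφ hm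
    refine ⟨min ε (b - t₀), lt_min hε (by linarith), hD.mono fun s hs => ?_⟩
    rw [mem_Icc_inter_ball, lt_min_iff] at hs
    rw [mem_Icc_inter_ball]
    exact ⟨⟨hs.1.1, by linarith [(abs_lt.1 hs.2.2).2]⟩, hs.2.1⟩
  · obtain ⟨ε₁, hε₁, hsrc₁, C₁, hC₁, hD₁⟩ := h.davieOn hα (t₀ := t₀) ⟨hab, le_rfl⟩ hφ hm
    obtain ⟨ε₂, hε₂, hsrc₂, C₂, hC₂, hD₂⟩ := h'.davieOn hα (t₀ := t₀) ⟨le_rfl, hbc⟩ hφ hm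
    obtain ⟨r, hr, hrt⟩ := exists_closedBall_slice_subset (φ.map_source hm)
    obtain ⟨K, hK, hV⟩ := exists_fieldBound V V₀ hφ (isCompact_closedBall _ r)
      (convex_closedBall _ _) isCompact_singleton hrt
    set z := (φ (x t₀)).2 with hz
    obtain ⟨ε₃, hε₃, hxε⟩ := exists_mapsTo_of_continuousOn hx ht₀ (chartBox_mem_nhds hm
      (continuous_fst.continuousAt (Metric.closedBall_mem_nhds (φ (x t₀)).1 (half_pos hr))))
    obtain ⟨κ, hκ0, hμ⟩ : ∃ κ ≥ 0, ∀ a' b', a ≤ a' → b' ≤ c → b' - a' ≤ 1 → ApproxFlowOn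
        (fun s t => chartStep V V₀ φ z (A s t)) (Metric.closedBall (φ (x t₀)).1 r) a' b' κ α :=
      ⟨_, by positivity, fun a' b' ha hb hab => (hV z rfl).approxFlowOn (convex_closedBall _ _) hR
        hK hα0 (hA.mono ha hb) hab rfl⟩
    obtain ⟨δ, hδ, hδr⟩ := exists_forall_mul_rpow_le hα0 κ (half_pos hr)
    refine ⟨min (min ε₁ ε₂) (min ε₃ (min δ (1 / 2))), by positivity, ?_, C₂ + (1 + κ) * C₁ + κ,
      by positivity, ?_⟩
    · intro s hs
      simp only [mem_Icc_inter_ball, lt_min_iff] at hs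
      rcases le_total s t₀ with hst | hst
      · exact hsrc₁ s (mem_Icc_inter_ball.2 ⟨⟨hs.1.1, hst⟩, hs.2.1.1⟩)
      · exact hsrc₂ s (mem_Icc_inter_ball.2 ⟨⟨hst, hs.1.2⟩, hs.2.1.2⟩)
    · intro s hs t ht hst
      simp only [mem_Icc_inter_ball, lt_min_iff] at hs ht
      have hθ : 0 ≤ (t - s) ^ (3 * α) := Real.rpow_nonneg (by linarith) _
      rcases le_total t t₀ with htt | htt
      · refine (hD₁ s (mem_Icc_inter_ball.2 ⟨⟨hs.1.1, hst.trans htt⟩, hs.2.1.1⟩) t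
          (mem_Icc_inter_ball.2 ⟨⟨ht.1.1, htt⟩, ht.2.1.1⟩) hst).trans
          (mul_le_mul_of_nonneg_right ?_ hθ)
        nlinarith [mul_nonneg hκ0 hC₁]
      rcases le_total t₀ s with hss | hss
      · refine (hD₂ s (mem_Icc_inter_ball.2 ⟨⟨hss, hs.1.2⟩, hs.2.1.2⟩) t
          (mem_Icc_inter_ball.2 ⟨⟨htt, ht.1.2⟩, ht.2.1.2⟩) hst).trans
          (mul_le_mul_of_nonneg_right ?_ hθ)
        nlinarith [mul_nonneg hκ0 hC₁]
      have d₁ := hD₁ s (mem_Icc_inter_ball.2 ⟨⟨hs.1.1, hss⟩, hs.2.1.1⟩) t₀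
        (mem_Icc_inter_ball.2 ⟨⟨hab, le_rfl⟩, by simpa using hε₁⟩) hss
      have d₂ := hD₂ t₀ (mem_Icc_inter_ball.2 ⟨⟨le_rfl, hbc⟩, by simpa using hε₂⟩) t
        (mem_Icc_inter_ball.2 ⟨⟨htt, ht.1.2⟩, ht.2.1.2⟩) htt
      have hs2 := abs_lt.1 hs.2.2.2.2
      have ht2 := abs_lt.1 ht.2.2.2.2
      have hs3 := abs_lt.1 hs.2.2.2.1
      have hμ' := hμ s t hs.1.1 ht.1.2 (by linarith)
      have m₁ : (φ (x s)).1 ∈ Metric.closedBall (φ (x t₀)).1 (r / 2) :=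
        (hxε s (mem_Icc_inter_ball.2 ⟨hs.1, hs.2.2.1⟩)).2
      have m₁' : (φ (x s)).1 ∈ Metric.closedBall (φ (x t₀)).1 r :=
        Metric.closedBall_subset_closedBall (by linarith) m₁
      have m₂ : chartStep V V₀ φ z (A s t₀) (φ (x s)).1 ∈ Metric.closedBall (φ (x t₀)).1 r := by
        have e := (hμ'.disp s t₀ _ le_rfl hss htt m₁').trans (hδr _ (by linarith) (by linarith))
        rw [Metric.mem_closedBall] at m₁ ⊢
        rw [← dist_eq_norm] at e
        linarith [dist_triangle (chartStep V V₀ φ z (A s t₀) (φ (x s)).1) (φ (x s)).1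
          (φ (x t₀)).1]
      have l₁ := hμ'.lip t₀ t _ _ hss htt le_rfl m₂ (Metric.mem_closedBall_self hr.le)
      have l₂ := hμ'.comp s t₀ t _ le_rfl hss htt le_rfl m₁' m₂
      have k₁ : (t - t₀) ^ α ≤ 1 := Real.rpow_le_one (by linarith) (by linarith) hα0.le
      have k₂ : (t - t₀) ^ (3 * α) ≤ (t - s) ^ (3 * α) :=
        Real.rpow_le_rpow (by linarith) (by linarith) (by linarith)
      have k₃ : (t₀ - s) ^ (3 * α) ≤ (t - s) ^ (3 * α) :=
        Real.rpow_le_rpow (by linarith) (by linarith) (by linarith)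
      have e : (φ (x t)).1 - chartStep V V₀ φ z (A s t) (φ (x s)).1 =
          ((φ (x t)).1 - chartStep V V₀ φ z (A t₀ t) (φ (x t₀)).1) +
          (chartStep V V₀ φ z (A t₀ t) (φ (x t₀)).1 -
            chartStep V V₀ φ z (A t₀ t) (chartStep V V₀ φ z (A s t₀) (φ (x s)).1)) +
          (chartStep V V₀ φ z (A t₀ t) (chartStep V V₀ φ z (A s t₀) (φ (x s)).1) -
            chartStep V V₀ φ z (A s t) (φ (x s)).1) := by abel
      rw [e]
      refine norm_add₃_le.trans ?_
      calc _ ≤ C₂ * (t - t₀) ^ (3 * α) + (1 + κ * (t - t₀) ^ α) * (C₁ * (t₀ - s) ^ (3 * α)) +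
            κ * (t - s) ^ (3 * α) := by
            refine add_le_add (add_le_add d₂ (l₁.trans (mul_le_mul_of_nonneg_left d₁ ?_))) l₂
            have := Real.rpow_nonneg (by linarith : 0 ≤ t - t₀) α
            positivity
        _ ≤ C₂ * (t - s) ^ (3 * α) + (1 + κ * 1) * (C₁ * (t - s) ^ (3 * α)) +
            κ * (t - s) ^ (3 * α) := by
            have := Real.rpow_nonneg (by linarith : 0 ≤ t₀ - s) (3 * α)
            gcongr
        _ = _ := by ring
  · obtain ⟨ε, hε, hD⟩ := h'.davieOn hα (t₀ := t₀) ⟨hgt.le, ht₀.2⟩ hφ hm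
    refine ⟨min ε (t₀ - b), lt_min hε (by linarith), hD.mono fun s hs => ?_⟩
    rw [mem_Icc_inter_ball, lt_min_iff] at hs
    rw [mem_Icc_inter_ball]
    exact ⟨⟨by linarith [(abs_lt.1 hs.2.2).1], hs.1.2⟩, hs.2.1⟩

/-- Running a solution backwards solves the equation driven by the reversed driver. -/
theorem IsSolOn.reverse [T2Space M] [LocallyCompactSpace Z] [TopologicalSpace.MetrizableSpace Z]
    (hα : 1 / 3 < α) (hR : 0 ≤ R) (hA : IsDriver A α R a b)
    (h : IsSolOn V V₀ A α x a b) (S : ℝ) :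
    IsSolOn V V₀ (fun s t => (A (S - t) (S - s)).chenInv) α (fun s => x (S - s)) (S - b) (S - a) := by
  have hα0 : 0 < α := by linarith
  have hx : ContinuousOn (fun s => x (S - s)) (Set.Icc (S - b) (S - a)) :=
    h.1.comp (f := fun s => S - s) (by fun_prop) fun s hs => ⟨by linarith [hs.2], by linarith [hs.1]⟩
  have hR' : 0 ≤ R + R ^ 2 := by positivity
  refine isSolOn_of_davieOn hα0 hR' (hA.reverse S) hx fun t₀ ht₀ => ?_
  obtain ⟨φ, hφ, hm⟩ := 𝓕.exists_chart (x (S - t₀))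
  have ht₀' : S - t₀ ∈ Set.Icc a b := ⟨by linarith [ht₀.2], by linarith [ht₀.1]⟩
  obtain ⟨ε, hε, hsrc, C, hC, hD⟩ := h.davieOn hα ht₀' hφ hm
  obtain ⟨r, hr, hrt⟩ := exists_closedBall_slice_subset (φ.map_source hm)
  obtain ⟨K, hK, hV⟩ := exists_fieldBound V V₀ hφ (isCompact_closedBall _ r)
    (convex_closedBall _ _) isCompact_singleton hrt
  set z := (φ (x (S - t₀))).2 with hz
  set y₀ := (φ (x (S - t₀))).1 with hy₀
  obtain ⟨ε₃, hε₃, hxε⟩ := exists_mapsTo_of_continuousOn h.1 ht₀' (chartBox_mem_nhds hm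
    (continuous_fst.continuousAt (Metric.closedBall_mem_nhds y₀ (half_pos hr))))
  obtain ⟨c, hc⟩ : ∃ c, c = (R + R ^ 2) * (d * K + 2 * d ^ 2 * K ^ 2 + K) := ⟨_, rfl⟩
  have hc0 : 0 ≤ c := by rw [hc]; positivity
  obtain ⟨δ, hδ, hδr⟩ := exists_forall_mul_rpow_le hα0 c (half_pos hr)
  have hmem : ∀ s ∈ Set.Icc (S - b) (S - a) ∩
      Metric.ball t₀ (min ε (min ε₃ (min (δ / 2) (1 / 2)))),
      S - s ∈ Set.Icc a b ∩ Metric.ball (S - t₀) ε ∧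
      S - s ∈ Set.Icc a b ∩ Metric.ball (S - t₀) ε₃ ∧ |s - t₀| < δ / 2 ∧ |s - t₀| < 1 / 2 := by
    intro s hs
    simp only [mem_Icc_inter_ball, lt_min_iff] at hs ⊢
    have e : |S - s - (S - t₀)| = |s - t₀| := by rw [abs_sub_comm]; congr 1; ring
    rw [e]
    have : a ≤ S - s ∧ S - s ≤ b := ⟨by linarith, by linarith⟩
    tauto
  refine ⟨φ, hφ, z, min ε (min ε₃ (min (δ / 2) (1 / 2))), by positivity, fun s hs => ?_,
    (1 + c) * C + (d * (R + R ^ 2) * K * (c ^ 2 + c) + c ^ 2), by positivity,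
    fun s hs t ht hst => ?_⟩
  · exact hsrc _ (hmem s hs).1
  obtain ⟨s1, s2, s3, s4⟩ := hmem s hs
  obtain ⟨t1, t2, t3, t4⟩ := hmem t ht
  rw [abs_lt] at s3 s4 t3 t4
  have hlen : S - s - (S - t) = t - s := by ring
  have hκ0 : 0 ≤ (t - s) ^ α := Real.rpow_nonneg (by linarith) _
  have hκ1 : (t - s) ^ α ≤ 1 := Real.rpow_le_one (by linarith) (by linarith) hα0.le
  have hsize : (A (S - t) (S - s)).Size R ((t - s) ^ α) := by
    have := hA.size (S - t) (S - s) t1.1.1 (by linarith) s1.1.2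
    rwa [hlen] at this
  have hsize' : (A (S - t) (S - s)).Size (R + R ^ 2) ((t - s) ^ α) := by
    refine ⟨fun i => (hsize.fst i).trans ?_, fun j k => (hsize.snd j k).trans ?_,
      hsize.drift.trans ?_⟩ <;>
    exact mul_le_mul_of_nonneg_right (by nlinarith) (by positivity)
  have hinv := hsize.chenInv hκ0
  have hDD := hD (S - t) t1 (S - s) s1 (by linarith)
  rw [hlen] at hDD
  have m₀ : (φ (x (S - t))).1 ∈ Metric.closedBall y₀ (r / 2) := (hxε _ t2).2
  have m₁ : (φ (x (S - t))).1 ∈ Metric.closedBall y₀ r :=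
    Metric.closedBall_subset_closedBall (by linarith) m₀
  have m₃ : (φ (x (S - s))).1 ∈ Metric.closedBall y₀ r :=
    Metric.closedBall_subset_closedBall (by linarith) (hxε _ s2).2
  have hVz := hV z rfl
  have m₂ : chartStep V V₀ φ z (A (S - t) (S - s)) (φ (x (S - t))).1 ∈
      Metric.closedBall y₀ r := by
    have e := (hVz.norm_rdeIncr_le hR' hκ0 hκ1 hsize' m₁)
    rw [← hc] at e
    have e' := e.trans (hδr _ (by linarith) (by linarith))
    rw [Metric.mem_closedBall, dist_eq_norm] at m₀ ⊢
    have e2 : chartStep V V₀ φ z (A (S - t) (S - s)) (φ (x (S - t))).1 - y₀ =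
        chartIncr V V₀ φ z (A (S - t) (S - s)) (φ (x (S - t))).1 + ((φ (x (S - t))).1 - y₀) := by
      simp only [chartStep, chartIncr, rdeStep]; abel
    rw [e2]
    have e3 := add_le_add e' m₀
    rw [add_halves] at e3
    exact (norm_add_le _ _).trans e3
  have n1 := hVz.norm_rdeStep_chen_le (convex_closedBall _ _) hR' hκ0 hκ1 hsize' hinv m₁ m₂ hc
  have n2 := hVz.norm_rdeIncr_sub_le (convex_closedBall _ _) hR' hκ0 hκ1 hinv m₂ m₃
  rw [Inc.chen_chenInv, rdeStep_zero] at n1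
  rw [← hc] at n2
  set a' := A (S - t) (S - s) with ha'
  set y := (φ (x (S - t))).1 with hy
  set y' := (φ (x (S - s))).1 with hy'
  change ‖y - chartStep V V₀ φ z a'.chenInv y'‖ ≤ _
  have e : y - chartStep V V₀ φ z a'.chenInv y' =
      -(chartStep V V₀ φ z a'.chenInv (chartStep V V₀ φ z a' y) - y) -
      ((y' - chartStep V V₀ φ z a' y) + (chartIncr V V₀ φ z a'.chenInv y' -
        chartIncr V V₀ φ z a'.chenInv (chartStep V V₀ φ z a' y))) := by
    simp only [chartStep, chartIncr, rdeStep]; abel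
  have n2' : ‖chartIncr V V₀ φ z a'.chenInv y' -
      chartIncr V V₀ φ z a'.chenInv (chartStep V V₀ φ z a' y)‖ ≤
      c * 1 * (C * (t - s) ^ (3 * α)) :=
    n2.trans (mul_le_mul (mul_le_mul_of_nonneg_left hκ1 hc0) hDD (norm_nonneg _) (by positivity))
  rw [rpow_pow_three (by linarith)] at n1
  rw [e]
  refine (norm_sub_le _ _).trans ?_
  rw [norm_neg]
  refine (add_le_add n1 ((norm_add_le _ _).trans (add_le_add hDD n2'))).trans (le_of_eq ?_)
  ring

end GlueReverse

/-! ### Short time solutions in a chart -/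

section LocalTheory

variable {p d : ℕ} {Z M : Type*} [TopologicalSpace Z] [TopologicalSpace M]
  {𝓕 : FoliatedAtlas p Z M} (V : Fin d → LeafwiseVectorField 𝓕 3)
  (V₀ : LeafwiseVectorField 𝓕 3)

theorem LeafwiseCkRec.tangentField {E : Type} [NormedAddCommGroup E] [NormedSpace ℝ E]
    {W : Type*} [TopologicalSpace W] {k : ℕ} {f : E × W → E} {U : Set (E × W)} (hU : IsOpen U)
    (hf : LeafwiseCkRec (k + 1) f U) :
    LeafwiseCkRec k (fun Q : (E × E) × W => _root_.tangentField (fun y => f (y, Q.2)) Q.1)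
      {Q | (Q.1.1, Q.2) ∈ U} := by
  have hU' : IsOpen {Q : (E × E) × W | (Q.1.1, Q.2) ∈ U} :=
    hU.preimage (by fun_prop : Continuous fun Q : (E × E) × W => (Q.1.1, Q.2))
  have hfst : LeafwiseCkRec k (fun Q : (E × E) × W => Q.1.1) {Q | (Q.1.1, Q.2) ∈ U} :=
    of_contDiff contDiff_fst _
  have hsnd : LeafwiseCkRec k (fun Q : (E × E) × W => Q.1.2) {Q | (Q.1.1, Q.2) ∈ U} :=
    of_contDiff contDiff_snd _
  have h1 := hf.of_succ.comp hU' (c := id) hfst continuousOn_snd fun Q hQ => hQ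
  have h2 := LeafwiseCkRec.comp hU' (c := id) hf.2.2 hfst continuousOn_snd fun Q hQ => hQ
  exact h1.prodMk hU' (h2.bilin hU' (ContinuousLinearMap.id ℝ (E →L[ℝ] E)) hsnd)

/-- The lifts of the vector fields to the tangent spaces of the leaves are bounded on compact
sets. -/
theorem exists_fieldBound_tangentField
    {φ : OpenPartialHomeomorph M (EuclideanSpace ℝ (Fin p) × Z)} (hφ : φ ∈ 𝓕.charts)
    {D : Set (EuclideanSpace ℝ (Fin p) × EuclideanSpace ℝ (Fin p))} {C : Set Z} (hD : IsCompact D)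
    (hDc : Convex ℝ D) (hC : IsCompact C) (hDC : ∀ v ∈ D, ∀ z ∈ C, (v.1, z) ∈ φ.target) :
    ∃ K ≥ 0, ∀ z ∈ C, FieldBound (fun i => tangentField fun y => (V i).comp φ (y, z))
      (tangentField fun y => V₀.comp φ (y, z)) D K := by
  have hsub : D ×ˢ C ⊆ {Q : (EuclideanSpace ℝ (Fin p) × EuclideanSpace ℝ (Fin p)) × Z |
      (Q.1.1, Q.2) ∈ φ.target} := fun Q hQ => hDC _ hQ.1 _ hQ.2
  have h2 := fun W : LeafwiseVectorField 𝓕 3 =>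
    LeafwiseCkRec.tangentField φ.open_target (W.leafwiseCkRec hφ)
  choose K hK using fun i => (h2 (V i)).exists_hasC2Bound hD hDc hC hsub
  obtain ⟨K₀, hK₀⟩ := (h2 V₀).exists_hasC2Bound hD hDc hC hsub
  have hle : ∀ i, K i ≤ ∑ i, |K i| + |K₀| := fun i => by
    have := Finset.single_le_sum (f := fun i => |K i|) (fun i _ => abs_nonneg _)
      (Finset.mem_univ i)
    linarith [le_abs_self (K i), abs_nonneg K₀]
  refine ⟨∑ i, |K i| + |K₀|, by positivity, fun z hz => ⟨fun i => (hK i z hz).mono le_rfl (hle i),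
    (hK₀ z hz).mono le_rfl ?_⟩⟩
  have : 0 ≤ ∑ i, |K i| := by positivity
  linarith [le_abs_self K₀]

theorem continuousOn_chartStep
    {φ : OpenPartialHomeomorph M (EuclideanSpace ℝ (Fin p) × Z)} (hφ : φ ∈ 𝓕.charts) :
    ContinuousOn (fun Q : Inc d × EuclideanSpace ℝ (Fin p) × Z =>
      chartStep V V₀ φ Q.2.2 Q.1 Q.2.1) {Q | Q.2 ∈ φ.target} := by
  have hm : Set.MapsTo (fun Q : Inc d × EuclideanSpace ℝ (Fin p) × Z => Q.2)
    {Q | Q.2 ∈ φ.target} φ.target := fun Q hQ => hQ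
  have h0 : ∀ W : LeafwiseVectorField 𝓕 3, ContinuousOn
      (fun Q : Inc d × EuclideanSpace ℝ (Fin p) × Z => W.comp φ (Q.2.1, Q.2.2))
      {Q | Q.2 ∈ φ.target} := fun W =>
    (W.leafwiseCkRec hφ).continuousOn.comp continuousOn_snd hm
  have h1 : ∀ W : LeafwiseVectorField 𝓕 3, ContinuousOn
      (fun Q : Inc d × EuclideanSpace ℝ (Fin p) × Z =>
        fderiv ℝ (fun y => W.comp φ (y, Q.2.2)) Q.2.1)
      {Q | Q.2 ∈ φ.target} := fun W =>
    (W.leafwiseCkRec hφ).2.2.continuousOn.comp continuousOn_snd hm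
  have e1 : ∀ i, Continuous (fun Q : Inc d × EuclideanSpace ℝ (Fin p) × Z => Q.1.1 i) := fun i => by
    fun_prop
  have e2 : ∀ j k, Continuous (fun Q : Inc d × EuclideanSpace ℝ (Fin p) × Z => Q.1.2.1 j k) :=
    fun j k => by fun_prop
  have e3 : Continuous (fun Q : Inc d × EuclideanSpace ℝ (Fin p) × Z => Q.1.2.2) := by fun_prop
  have e4 : Continuous (fun Q : Inc d × EuclideanSpace ℝ (Fin p) × Z => Q.2.1) := by fun_prop
  refine e4.continuousOn.add (ContinuousOn.add (ContinuousOn.add ?_ ?_) ?_)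
  · exact continuousOn_finsetSum _ fun i _ => (e1 i).continuousOn.smul (h0 (V i))
  · exact continuousOn_finsetSum _ fun j _ => continuousOn_finsetSum _ fun k _ =>
      (e2 j k).continuousOn.smul ((h1 (V k)).clm_apply (h0 (V j)))
  · exact e3.continuousOn.smul (h0 V₀)

/-- Near each point of a chart the one-step maps and their tangent maps form approximate flows,
with constants that are uniform over the nearby plaques and over drivers of bounded size. -/
theorem exists_tangentApproxFlow [LocallyCompactSpace Z]
    {φ : OpenPartialHomeomorph M (EuclideanSpace ℝ (Fin p) × Z)} (hφ : φ ∈ 𝓕.charts)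
    {q : EuclideanSpace ℝ (Fin p) × Z} (hq : q ∈ φ.target) {α R : ℝ} (hα : 0 < α) (hR : 0 ≤ R) :
    ∃ r > 0, ∃ c ≥ 0, ∃ N ∈ nhds q.2, Metric.closedBall q.1 (4 * r) ×ˢ N ⊆ φ.target ∧
      ∀ z ∈ N, ∀ (A : ℝ → ℝ → Inc d) (a b : ℝ), b - a ≤ 1 → IsDriver A α R a b →
        TangentApproxFlow (fun s t => chartStep V V₀ φ z (A s t))
          (fun s t => rdeStep (fun i => tangentField fun y => (V i).comp φ (y, z))
            (tangentField fun y => V₀.comp φ (y, z)) (A s t)) q.1 r a b c α := by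
  obtain ⟨U, hU, O, hO, hUO⟩ := mem_nhds_prod_iff.1 (φ.open_target.mem_nhds hq)
  obtain ⟨N, hN, hNO, hNc⟩ := local_compact_nhds hO
  obtain ⟨r₀, hr₀, hr₀U⟩ := Metric.nhds_basis_closedBall.mem_iff.1 hU
  obtain ⟨r, hr⟩ : ∃ r, r = r₀ / 4 := ⟨_, rfl⟩
  have h4 : 4 * r = r₀ := by rw [hr]; ring
  have hsub : Metric.closedBall q.1 (4 * r) ×ˢ N ⊆ φ.target := by
    rw [h4]
    exact (Set.prod_mono hr₀U hNO).trans hUO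
  obtain ⟨K₁, hK₁, H₁⟩ := exists_fieldBound V V₀ hφ (isCompact_closedBall q.1 (4 * r))
    (convex_closedBall _ _) hNc hsub
  obtain ⟨K₂, hK₂, H₂⟩ := exists_fieldBound_tangentField V V₀ hφ
    ((isCompact_closedBall q.1 (4 * r)).prod
      (isCompact_closedBall (0 : EuclideanSpace ℝ (Fin p)) 3))
    ((convex_closedBall _ _).prod (convex_closedBall _ _)) hNc
    (fun v hv z hz => hsub ⟨hv.1, hz⟩)
  obtain ⟨K, hK⟩ : ∃ K, K = max K₁ K₂ := ⟨_, rfl⟩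
  have hK0 : 0 ≤ K := by rw [hK]; exact hK₁.trans (le_max_left _ _)
  obtain ⟨c, hc⟩ : ∃ c, c = R * (d * K + 2 * d ^ 2 * K ^ 2 + K) := ⟨_, rfl⟩
  have hc0 : 0 ≤ c := by rw [hc]; positivity
  refine ⟨r, by rw [hr]; positivity, c + (d * R * K * (c ^ 2 + c) + c ^ 2), by positivity, N, hN,
    hsub, fun z hz A a b hab hA => ⟨?_, ?_, ?_, ?_, ?_⟩⟩
  · exact ((H₁ z hz).mono le_rfl (by rw [hK]; exact le_max_left _ _)).approxFlowOn
      (convex_closedBall _ _) hR hK0 hα hA hab hc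
  · exact ((H₂ z hz).mono le_rfl (by rw [hK]; exact le_max_right _ _)).approxFlowOn
      ((convex_closedBall _ _).prod (convex_closedBall _ _)) hR hK0 hα hA hab hc
  · intro s t y _ _ _ hy
    have hy' : (y, z) ∈ φ.target := hsub ⟨hy, hz⟩
    exact (rdeStep_tangentField (fun i => (((V i).leafwiseCkRec hφ).contDiffAt φ.open_target
      hy').of_le (by norm_num)) ((V₀.leafwiseCkRec hφ).2.1 _ hy') (A s t) 0).1
  · intro s t y v _ _ _ hy
    have hy' : (y, z) ∈ φ.target := hsub ⟨hy, hz⟩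
    exact (rdeStep_tangentField (fun i => (((V i).leafwiseCkRec hφ).contDiffAt φ.open_target
      hy').of_le (by norm_num)) ((V₀.leafwiseCkRec hφ).2.1 _ hy') (A s t) v).2
  · have h1 : ContinuousOn (fun P : ℝ × ℝ × EuclideanSpace ℝ (Fin p) => A P.1 P.2.1)
        {P | a ≤ P.1 ∧ P.1 ≤ P.2.1 ∧ P.2.1 ≤ b ∧ P.2.2 ∈ Metric.closedBall q.1 (4 * r)} :=
      hA.continuousOn.comp (f := fun P : ℝ × ℝ × EuclideanSpace ℝ (Fin p) => (P.1, P.2.1))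
        (by fun_prop) fun P hP => ⟨hP.1, hP.2.1, hP.2.2.1⟩
    exact (continuousOn_chartStep V V₀ hφ).comp
      (f := fun P : ℝ × ℝ × EuclideanSpace ℝ (Fin p) => (A P.1 P.2.1, P.2.2, z))
      (h1.prodMk (by fun_prop)) fun P hP => hsub ⟨hP.2.2.2, hz⟩

end LocalTheory

/-! ### Existence, uniqueness and Euler approximation of solutions -/

theorem continuousOn_of_norm_sub_le_rpow {E : Type} [NormedAddCommGroup E] {y : ℝ → E}
    {a b C c α θ : ℝ} (hα : 0 < α) (hθ : 0 < θ)
    (h : ∀ s t, a ≤ s → s ≤ t → t ≤ b → ‖y t - y s‖ ≤ C * (t - s) ^ θ + c * (t - s) ^ α) :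
    ContinuousOn y (Set.Icc a b) := by
  intro s hs
  have hg : ContinuousAt (fun t : ℝ => C * |t - s| ^ θ + c * |t - s| ^ α) s := by
    have h1 : ContinuousAt (fun t : ℝ => |t - s|) s := by fun_prop
    exact (continuousAt_const.mul (h1.rpow_const (Or.inr hθ.le))).add
      (continuousAt_const.mul (h1.rpow_const (Or.inr hα.le)))
  have hg0 : Filter.Tendsto (fun t : ℝ => C * |t - s| ^ θ + c * |t - s| ^ α)
      (nhdsWithin s (Set.Icc a b)) (nhds 0) := by
    have := hg.tendsto.mono_left (nhdsWithin_le_nhds (s := Set.Icc a b))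
    simpa [Real.zero_rpow hα.ne', Real.zero_rpow hθ.ne'] using this
  refine tendsto_iff_norm_sub_tendsto_zero.2
    (squeeze_zero' (Filter.Eventually.of_forall fun t => norm_nonneg _) ?_ hg0)
  filter_upwards [self_mem_nhdsWithin] with t ht
  rcases le_total s t with hst | hst
  · rw [abs_of_nonneg (by linarith)]
    exact h s t hs.1 hst ht.2
  · rw [abs_sub_comm, abs_of_nonneg (by linarith), norm_sub_rev]
    exact h t s ht.1 hst hs.2

section SolutionTheory

variable {p d : ℕ} {Z M : Type*} [TopologicalSpace Z] [TopologicalSpace M]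
  {𝓕 : FoliatedAtlas p Z M} {V : Fin d → LeafwiseVectorField 𝓕 3}
  {V₀ : LeafwiseVectorField 𝓕 3} {A : ℝ → ℝ → Inc d} {α R : ℝ} {x x' : ℝ → M} {a b c : ℝ}

theorem IsSolOn.congr (h : IsSolOn V V₀ A α x a b) (hx : ∀ t, a ≤ t → t ≤ b → x' t = x t) :
    IsSolOn V V₀ A α x' a b := by
  refine ⟨h.1.congr fun t ht => hx t ht.1 ht.2, fun f hf => ?_⟩
  obtain ⟨C, hC⟩ := h.2 f hf
  refine ⟨C, fun s t h1 h2 h3 => ?_⟩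
  rw [hx s h1 (h2.trans h3), hx t (h1.trans h2) h3]
  exact hC s t h1 h2 h3

/-- Two solutions that agree at some time agree a little later: in a chart, both are limits of the
same Euler schemes. -/
theorem IsSolOn.exists_eqOn_right [T2Space M] [LocallyCompactSpace Z]
    [TopologicalSpace.MetrizableSpace Z] (hα : 1 / 3 < α) (hR : 0 ≤ R) (hA : IsDriver A α R a b)
    (h : IsSolOn V V₀ A α x a b) (h' : IsSolOn V V₀ A α x' a b) {t₀ : ℝ} (ht₀ : t₀ ∈ Set.Icc a b)
    (heq : x t₀ = x' t₀) : ∃ ε > 0, ∀ t, t₀ ≤ t → t ≤ b → t - t₀ < ε → x t = x' t := by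
  have hα0 : 0 < α := by linarith
  obtain ⟨φ, hφ, hm⟩ := 𝓕.exists_chart (x t₀)
  obtain ⟨r, hr, c, hc, N, hN, -, hflow⟩ := exists_tangentApproxFlow V V₀ hφ (φ.map_source hm) hα0 hR
  obtain ⟨δ, hδ, C, -, H⟩ := exists_local_flow_constants (EuclideanSpace ℝ (Fin p)) hc hα hr
  obtain ⟨ε₁, hε₁, hsrc₁, D₁, hD₁, hdav₁⟩ := h.davieOn hα ht₀ hφ hm
  obtain ⟨ε₂, hε₂, hsrc₂, D₂, hD₂, hdav₂⟩ := h'.davieOn hα ht₀ hφ (heq ▸ hm)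
  rw [← heq] at hsrc₂ hdav₂
  have hball := chartBox_mem_nhds hm
    (continuous_fst.continuousAt (Metric.closedBall_mem_nhds (φ (x t₀)).1 (by linarith : 0 < 2 * r)))
  obtain ⟨ε₃, hε₃, hb₁⟩ := exists_mapsTo_of_continuousOn h.1 ht₀ hball
  obtain ⟨ε₄, hε₄, hb₂⟩ := exists_mapsTo_of_continuousOn h'.1 ht₀ (U := φ.source ∩ φ ⁻¹' (Prod.fst ⁻¹'
    Metric.closedBall (φ (x t₀)).1 (2 * r))) (by rw [← heq]; exact hball)
  refine ⟨min (min ε₁ ε₂) (min (min ε₃ ε₄) (min δ 1)), by positivity, fun t h1 h2 h3 => ?_⟩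
  simp only [lt_min_iff] at h3
  have hI : ∀ ε, t - t₀ < ε → ∀ s, t₀ ≤ s → s ≤ t → s ∈ Set.Icc a b ∩ Metric.ball t₀ ε :=
    fun ε hε s hs hs' => mem_Icc_inter_ball.2 ⟨⟨ht₀.1.trans hs, hs'.trans h2⟩, by
      rw [abs_of_nonneg (by linarith)]; linarith⟩
  have hμ := hflow _ (mem_of_mem_nhds hN) A t₀ t h3.2.2.2.le (hA.mono ht₀.1 h2)
  obtain ⟨-, -, Hu⟩ := H _ _ _ t₀ t h1 h3.2.2.1.le hμ
  have u₁ := Hu (fun s => (φ (x s)).1) D₁ (fun s hs hs' => (hb₁ s (hI ε₃ h3.2.1.1 s hs hs')).2)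
    fun s s' hs hss hs' => hdav₁ s (hI ε₁ h3.1.1 s hs (hss.trans hs')) s'
      (hI ε₁ h3.1.1 s' (hs.trans hss) hs') hss
  have u₂ := Hu (fun s => (φ (x' s)).1) D₂ (fun s hs hs' => (hb₂ s (hI ε₄ h3.2.1.2 s hs hs')).2)
    fun s s' hs hss hs' => hdav₂ s (hI ε₂ h3.1.2 s hs (hss.trans hs')) s'
      (hI ε₂ h3.1.2 s' (hs.trans hss) hs') hss
  -- both paths are compared with the Euler scheme of step `(t - t₀) / n` from their common value
  have hle : ∀ n : ℕ, 0 < n → ‖(φ (x t)).1 - (φ (x' t)).1‖ ≤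
      n * ((2 * D₁ + 2 * D₂) * ((t - t₀) / n) ^ (3 * α)) := by
    intro n hn
    have e₁ := u₁ n hn
    have e₂ := u₂ n hn
    simp only [← heq] at e₂
    rw [← dist_eq_norm] at e₁ e₂ ⊢
    refine (dist_triangle_right _ _ _).trans ((add_le_add e₁ e₂).trans (le_of_eq ?_))
    ring
  have hlim := ge_of_tendsto (tendsto_nat_mul_div_rpow (by linarith : 1 < 3 * α)
    (by linarith : 0 ≤ t - t₀) _) ((Filter.eventually_gt_atTop 0).mono hle)
  have hs₁ := hsrc₁ t (hI ε₁ h3.1.1 t h1 le_rfl)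
  have hs₂ := hsrc₂ t (hI ε₂ h3.1.2 t h1 le_rfl)
  refine φ.injOn hs₁.1 hs₂.1 (Prod.ext (sub_eq_zero.1 (norm_le_zero_iff.1 hlim)) ?_)
  rw [hs₁.2, hs₂.2]

/-- Solutions are determined by their initial value. -/
theorem IsSolOn.eq_of_eq_left [T2Space M] [LocallyCompactSpace Z]
    [TopologicalSpace.MetrizableSpace Z] (hα : 1 / 3 < α) (hR : 0 ≤ R) (hA : IsDriver A α R a b)
    (h : IsSolOn V V₀ A α x a b) (h' : IsSolOn V V₀ A α x' a b) (heq : x a = x' a)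
    {t : ℝ} (hat : a ≤ t) (htb : t ≤ b) : x t = x' t := by
  have hcl : IsClosed ({t | x t = x' t} ∩ Set.Icc a b) := by
    rw [Set.inter_comm]
    exact (h.1.prodMk h'.1).preimage_isClosed_of_isClosed isClosed_Icc isClosed_diagonal
  refine hcl.Icc_subset_of_forall_exists_gt heq (fun s hs u hu => ?_) ⟨hat, htb⟩
  have hu : s < u := hu
  obtain ⟨ε, hε, H⟩ := h.exists_eqOn_right hα hR hA h' ⟨hs.2.1, hs.2.2.le⟩ hs.1
  have hsb := hs.2.2
  refine ⟨min u (min b (s + ε / 2)), H _ ?_ ?_ ?_, ?_, min_le_left _ _⟩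
  · exact le_min hu.le (le_min hsb.le (by linarith))
  · exact (min_le_right _ _).trans (min_le_left _ _)
  · have : min u (min b (s + ε / 2)) ≤ s + ε / 2 := (min_le_right _ _).trans (min_le_right _ _)
    linarith
  · exact lt_min hu (lt_min hsb (by linarith))

variable (V V₀)

/-- Solutions that start in `O` and are driven by drivers with constant `R` exist on time intervals
of length `δ`, end in the same plaque of the chart `φ` and are approximated by Euler schemes in this
chart, with a rate given by `C`. -/
structure IsLocalFlowChart (α R : ℝ)
    (φ : OpenPartialHomeomorph M (EuclideanSpace ℝ (Fin p) × Z)) (O : Set M) (δ C : ℝ) : Prop where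
  mem_charts : φ ∈ 𝓕.charts
  subset_source : O ⊆ φ.source
  exists_solution : ∀ (A : ℝ → ℝ → Inc d) (a b : ℝ), a ≤ b → b - a ≤ δ → IsDriver A α R a b →
    ∀ m ∈ O, ∃ x : ℝ → M, x a = m ∧ IsSolOn V V₀ A α x a b ∧ x b ∈ φ.source ∧
      (φ (x b)).2 = (φ m).2 ∧ ∀ n : ℕ, 0 < n →
        ‖(φ (x b)).1 - euler (fun s t => chartStep V V₀ φ (φ m).2 (A s t)) a ((b - a) / n) n
          (φ m).1‖ ≤ n * (C * ((b - a) / n) ^ (3 * α))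
  euler_mem : ∀ (A : ℝ → ℝ → Inc d) (a b : ℝ), a ≤ b → b - a ≤ δ → IsDriver A α R a b →
    ∀ m ∈ O, ∀ n : ℕ, 0 < n → ∀ k ≤ n,
      (euler (fun s t => chartStep V V₀ φ (φ m).2 (A s t)) a ((b - a) / n) k (φ m).1,
        (φ m).2) ∈ φ.target

theorem exists_isLocalFlowChart [T2Space M] [LocallyCompactSpace Z]
    [TopologicalSpace.MetrizableSpace Z] (hα : 1 / 3 < α) (hR : 0 ≤ R) (m₀ : M) :
    ∃ φ, ∃ O ∈ nhds m₀, ∃ δ > 0, ∃ C ≥ 0, IsLocalFlowChart V V₀ α R φ O δ C := by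
  have hα0 : 0 < α := by linarith
  obtain ⟨φ, hφ, hm₀⟩ := 𝓕.exists_chart m₀
  obtain ⟨r, hr, c, hc, N, hN, hsub, hflow⟩ :=
    exists_tangentApproxFlow V V₀ hφ (φ.map_source hm₀) hα0 hR
  obtain ⟨δ, hδ, C, hC, H⟩ := exists_local_flow_constants (EuclideanSpace ℝ (Fin p)) hc hα hr
  have hball : Metric.closedBall (φ m₀).1 r ×ˢ N ∈ nhds (φ m₀) := by
    rw [← Prod.mk.eta (p := φ m₀)]
    exact prod_mem_nhds (Metric.closedBall_mem_nhds _ hr) hN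
  have hsub' : ∀ y ∈ Metric.closedBall (φ m₀).1 (2 * r), ∀ z ∈ N, (y, z) ∈ φ.target :=
    fun y hy z hz => hsub ⟨Metric.closedBall_subset_closedBall (by linarith) hy, hz⟩
  have hloc : ∀ (A : ℝ → ℝ → Inc d) (a b : ℝ), b - a ≤ min δ 1 → IsDriver A α R a b → ∀ m,
      (φ m).2 ∈ N → TangentApproxFlow (fun s t => chartStep V V₀ φ (φ m).2 (A s t))
        (fun s t => rdeStep (fun i => tangentField fun y => (V i).comp φ (y, (φ m).2))
          (tangentField fun y => V₀.comp φ (y, (φ m).2)) (A s t)) (φ m₀).1 r a b c α :=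
    fun A a b hδ' hA m hm => hflow _ hm A a b (hδ'.trans (min_le_right _ _)) hA
  refine ⟨φ, _, chartBox_mem_nhds hm₀ hball, min δ 1, by positivity, 2 * C, by positivity, hφ,
    Set.inter_subset_left, fun A a b hab hδ' hA m ⟨hmφ, hmy, hmz⟩ => ?_,
    fun A a b hab hδ' hA m ⟨hmφ, hmy, hmz⟩ n hn k hk => ?_⟩
  · have hμ := hloc A a b hδ' hA m hmz
    obtain ⟨H₁, -, H₃⟩ := H _ _ _ a b hab (hδ'.trans (min_le_left _ _)) hμ
    set z := (φ m).2 with hz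
    obtain ⟨y, hya, hyb, hyD⟩ := H₁ _ hmy
    have htar : ∀ s, a ≤ s → s ≤ b → (y s, z) ∈ φ.target := fun s hs hs' =>
      hsub' _ (hyb s hs hs') z hmz
    have hφx : ∀ s, a ≤ s → s ≤ b → φ (φ.symm (y s, z)) = (y s, z) := fun s hs hs' =>
      φ.right_inv (htar s hs hs')
    have hyc : ContinuousOn y (Set.Icc a b) := by
      refine continuousOn_of_norm_sub_le_rpow (C := C) (c := c) hα0 (by linarith : 0 < 3 * α)
        fun s t h1 h2 h3 => ?_
      have e1 := hyD s t h1 h2 h3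
      have e2 := hμ.flow.disp s t (y s) h1 h2 h3
        (Metric.closedBall_subset_closedBall (by linarith) (hyb s h1 (h2.trans h3)))
      have e := norm_sub_le_norm_sub_add_norm_sub (y t) (chartStep V V₀ φ z (A s t) (y s)) (y s)
      exact e.trans (add_le_add e1 e2)
    refine ⟨fun s => φ.symm (y s, z), ?_, ?_, φ.map_target (htar b hab le_rfl), ?_, ?_⟩
    · simp only [hya, hz, Prod.mk.eta]
      exact φ.left_inv hmφ
    · refine isSolOn_of_davieOn hα0 hR hA ?_ fun t₀ ht₀ => ⟨φ, hφ, z, 1, one_pos, ?_⟩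
      · exact φ.symm.continuousOn.comp (hyc.prodMk continuousOn_const)
          fun s hs => htar s hs.1 hs.2
      · refine ⟨fun s hs => ⟨φ.map_target (htar s hs.1.1 hs.1.2), ?_⟩, C, hC,
          fun s hs t ht hst => ?_⟩
        · rw [hφx s hs.1.1 hs.1.2]
        · rw [hφx s hs.1.1 hs.1.2, hφx t ht.1.1 ht.1.2]
          exact hyD s t hs.1.1 hst ht.1.2
    · rw [hφx b hab le_rfl]
    · intro n hn
      rw [hφx b hab le_rfl]
      have := H₃ y C hyb hyD n hn
      rw [hya] at this
      refine this.trans (le_of_eq ?_)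
      ring
  · obtain ⟨-, H₂, -⟩ := H _ _ _ a b hab (hδ'.trans (min_le_left _ _)) (hloc A a b hδ' hA m hmz)
    refine hsub' _ (H₂ _ hmy _ n (div_nonneg (by linarith) (Nat.cast_nonneg n)) ?_ k hk) _ hmz
    have hn0 : (n : ℝ) ≠ 0 := by positivity
    rw [mul_div_cancel₀ _ hn0]
    linarith

/-- By compactness, the length of the time intervals can be chosen uniformly on `M`. -/
theorem exists_uniform_isLocalFlowChart [T2Space M] [CompactSpace M] [LocallyCompactSpace Z]
    [TopologicalSpace.MetrizableSpace Z] (hα : 1 / 3 < α) (hR : 0 ≤ R) :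
    ∃ δ > 0, ∀ m : M, ∃ φ, ∃ O ∈ nhds m, ∃ C ≥ 0, IsLocalFlowChart V V₀ α R φ O δ C := by
  have hmono : ∀ {φ : OpenPartialHomeomorph M (EuclideanSpace ℝ (Fin p) × Z)} {O δ δ' C},
      δ' ≤ δ → IsLocalFlowChart V V₀ α R φ O δ C → IsLocalFlowChart V V₀ α R φ O δ' C :=
    fun hδ h => ⟨h.1, h.2, fun A a b hab hb => h.3 A a b hab (hb.trans hδ),
      fun A a b hab hb => h.4 A a b hab (hb.trans hδ)⟩
  obtain ⟨δ, hδ, H⟩ := (isCompact_univ (X := M)).induction_on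
    (p := fun B => ∃ δ > 0, ∀ m ∈ B, ∃ φ, ∃ O ∈ nhds m, ∃ C ≥ 0, IsLocalFlowChart V V₀ α R φ O δ C)
    ⟨1, one_pos, fun m hm => absurd hm (Set.notMem_empty m)⟩
    (fun B B' hB ⟨δ, hδ, h⟩ => ⟨δ, hδ, fun m hm => h m (hB hm)⟩)
    (fun B B' ⟨δ, hδ, h⟩ ⟨δ', hδ', h'⟩ => ⟨min δ δ', lt_min hδ hδ', fun m hm => by
      rcases hm with hm | hm
      · obtain ⟨φ, O, hO, C, hC, hF⟩ := h m hm
        exact ⟨φ, O, hO, C, hC, hmono (min_le_left _ _) hF⟩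
      · obtain ⟨φ, O, hO, C, hC, hF⟩ := h' m hm
        exact ⟨φ, O, hO, C, hC, hmono (min_le_right _ _) hF⟩⟩)
    (fun m₀ _ => by
      obtain ⟨φ, O, hO, δ, hδ, C, hC, h⟩ := exists_isLocalFlowChart V V₀ hα hR m₀
      exact ⟨interior O, mem_nhdsWithin_of_mem_nhds (interior_mem_nhds.2 hO), δ, hδ,
        fun m hm => ⟨φ, O, mem_interior_iff_mem_nhds.1 hm, C, hC, h⟩⟩)
  exact ⟨δ, hδ, fun m => H m (Set.mem_univ m)⟩

theorem FoliatedAtlas.mem_leaf_of_chart {φ : OpenPartialHomeomorph M (EuclideanSpace ℝ (Fin p) × Z)}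
    (hφ : φ ∈ 𝓕.charts) {m m' : M} (hm : m ∈ φ.source) (hm' : m' ∈ φ.source)
    (h : (φ m').2 = (φ m).2) : m' ∈ 𝓕.leaf m :=
  Relation.TransGen.single ⟨{x : M | x ∈ φ.source ∧ (φ x).2 = (φ m).2},
    ⟨⟨m, hm, rfl⟩, φ, hφ, _, rfl⟩, ⟨hm, rfl⟩, ⟨hm', h⟩⟩

theorem FoliatedAtlas.mem_leaf_symm {m m' : M} (h : m' ∈ 𝓕.leaf m) : m ∈ 𝓕.leaf m' := by
  induction h with
  | single h =>
    obtain ⟨P, hP, ha, hb⟩ := h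
    exact Relation.TransGen.single ⟨P, hP, hb, ha⟩
  | tail _ h ih =>
    obtain ⟨P, hP, ha, hb⟩ := h
    exact Relation.TransGen.head ⟨P, hP, hb, ha⟩ ih

theorem FoliatedAtlas.mem_leaf_trans {m m' m'' : M} (h : m' ∈ 𝓕.leaf m) (h' : m'' ∈ 𝓕.leaf m') :
    m'' ∈ 𝓕.leaf m :=
  Relation.TransGen.trans h h'

/-- Existence of solutions, which stay in the leaf of the initial point. -/
theorem exists_isSolOn [T2Space M] [CompactSpace M] [LocallyCompactSpace Z]
    [TopologicalSpace.MetrizableSpace Z] (hα : 1 / 3 < α) (hR : 0 ≤ R) (hab : a ≤ b)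
    (hA : IsDriver A α R a b) (m : M) :
    ∃ x : ℝ → M, x a = m ∧ IsSolOn V V₀ A α x a b ∧ x b ∈ 𝓕.leaf m := by
  obtain ⟨δ, hδ, hloc⟩ := exists_uniform_isLocalFlowChart V V₀ hα hR
  have H : ∀ m : M, ∀ (A : ℝ → ℝ → Inc d) (a b : ℝ), a ≤ b → b - a ≤ δ → IsDriver A α R a b →
      ∃ x : ℝ → M, x a = m ∧ IsSolOn V V₀ A α x a b ∧ x b ∈ 𝓕.leaf m := by
    intro m A a b hab hb hA
    obtain ⟨φ, O, hO, C, hC, h⟩ := hloc m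
    obtain ⟨x, h1, h2, h3, h4, -⟩ := h.exists_solution A a b hab hb hA m (mem_of_mem_nhds hO)
    exact ⟨x, h1, h2, FoliatedAtlas.mem_leaf_of_chart h.mem_charts
      (h.subset_source (mem_of_mem_nhds hO)) h3 h4⟩
  have key : ∀ n : ℕ, ∀ b, a ≤ b → b - a ≤ (n + 1) * δ → IsDriver A α R a b →
      ∃ x : ℝ → M, x a = m ∧ IsSolOn V V₀ A α x a b ∧ x b ∈ 𝓕.leaf m := by
    intro n
    induction n with
    | zero => exact fun b hab hb hA => H m A a b hab (by simpa using hb) hA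
    | succ n ih =>
      intro b hab hb hA
      rcases le_total (b - a) δ with hs | hs
      · exact H m A a b hab hs hA
      · obtain ⟨x, h1, h2, h3⟩ := ih (b - δ) (by linarith) (by push_cast at hb; linarith)
          (hA.mono le_rfl (by linarith))
        obtain ⟨x', h1', h2', h3'⟩ := H (x (b - δ)) A (b - δ) b (by linarith) (by linarith)
          (hA.mono (by linarith) le_rfl)
        refine ⟨fun t => if t ≤ b - δ then x t else x' t, ?_, ?_, ?_⟩
        · exact (if_pos (by linarith)).trans h1
        · refine IsSolOn.glue hα hR hA (b := b - δ) (by linarith) (by linarith)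
            (h2.congr fun t _ ht => if_pos ht) (h2'.congr fun t ht _ => ?_)
          rcases ht.eq_or_lt with rfl | hlt
          · exact (if_pos le_rfl).trans h1'.symm
          · exact if_neg (not_le.2 hlt)
        · dsimp only
          rw [if_neg (by linarith)]
          exact FoliatedAtlas.mem_leaf_trans h3 h3'
  obtain ⟨n, hn⟩ := exists_nat_ge ((b - a) / δ)
  refine key n b hab ?_ hA
  rw [div_le_iff₀ hδ] at hn
  linarith

end SolutionTheory

/-! ### Geometric rough paths as drivers -/

section RoughPathDriver

variable {α : ℝ} {d : ℕ} {T : ℝ}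

namespace TimeSimplex

/-- The point `(s, t)` of the simplex. -/
def mk' (s t : ℝ) (h : 0 ≤ s ∧ s ≤ t ∧ t ≤ T) : TimeSimplex T :=
  ⟨(⟨s, h.1, h.2.1.trans h.2.2⟩, ⟨t, h.1.trans h.2.1, h.2.2⟩), Subtype.mk_le_mk.2 h.2.1⟩

theorem len_mk' (s t : ℝ) (h : 0 ≤ s ∧ s ≤ t ∧ t ≤ T) : (mk' s t h).len = t - s := rfl

theorem len_nonneg (q : TimeSimplex T) : 0 ≤ q.len :=
  sub_nonneg.2 (Subtype.coe_le_coe.2 q.2)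

theorem continuous_len : Continuous (len : TimeSimplex T → ℝ) := by
  unfold len
  fun_prop

end TimeSimplex

namespace RoughPath

theorem norm_lvl1_sub_le (w w' : RoughPath α d T) (q : TimeSimplex T) :
    ‖w.lvl1 q - w'.lvl1 q‖ ≤ dist w w' * q.len ^ α := by
  rcases q.2.lt_or_eq with h | h
  · exact (norm_le_simplexHolderNorm (exists_bound_sub w.holder1 w'.holder1) q h).trans
      (mul_le_mul_of_nonneg_right (le_max_left _ _) (Real.rpow_nonneg q.len_nonneg _))
  · obtain ⟨⟨s, t⟩, hst⟩ := q
    obtain rfl : s = t := h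
    rw [lvl1_diag, lvl1_diag, sub_zero, norm_zero]
    exact mul_nonneg dist_nonneg (Real.rpow_nonneg (TimeSimplex.len_nonneg _) _)

theorem norm_lvl2_sub_le (w w' : RoughPath α d T) (q : TimeSimplex T) :
    ‖w.lvl2 q - w'.lvl2 q‖ ≤ dist w w' * q.len ^ (2 * α) := by
  rcases q.2.lt_or_eq with h | h
  · exact (norm_le_simplexHolderNorm (exists_bound_sub w.holder2 w'.holder2) q h).trans
      (mul_le_mul_of_nonneg_right (le_max_right _ _) (Real.rpow_nonneg q.len_nonneg _))
  · obtain ⟨⟨s, t⟩, hst⟩ := q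
    obtain rfl : s = t := h
    rw [lvl2_diag, lvl2_diag, sub_zero, norm_zero]
    exact mul_nonneg dist_nonneg (Real.rpow_nonneg (TimeSimplex.len_nonneg _) _)

theorem continuous_uncurry_lvl1 (hα : 0 < α) :
    Continuous fun P : RoughPath α d T × TimeSimplex T => P.1.lvl1 P.2 := by
  refine continuous_iff_continuousAt.2 fun P₀ => tendsto_iff_norm_sub_tendsto_zero.2 ?_
  have hg : Continuous fun P : RoughPath α d T × TimeSimplex T =>
      dist P.1 P₀.1 * P.2.len ^ α + ‖P₀.1.lvl1 P.2 - P₀.1.lvl1 P₀.2‖ :=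
    ((continuous_fst.dist continuous_const).mul
      ((TimeSimplex.continuous_len.comp continuous_snd).rpow_const fun _ => Or.inr hα.le)).add
      ((P₀.1.continuous_lvl1.comp continuous_snd).sub continuous_const).norm
  refine squeeze_zero (fun P => norm_nonneg _) (fun P => ?_)
    ((hg.tendsto P₀).trans_eq (by simp))
  exact (norm_sub_le_norm_sub_add_norm_sub _ (P₀.1.lvl1 P.2) _).trans
    (add_le_add_left (norm_lvl1_sub_le _ _ _) _)

theorem continuous_uncurry_lvl2 (hα : 0 < α) :
    Continuous fun P : RoughPath α d T × TimeSimplex T => P.1.lvl2 P.2 := by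
  refine continuous_iff_continuousAt.2 fun P₀ => tendsto_iff_norm_sub_tendsto_zero.2 ?_
  have hg : Continuous fun P : RoughPath α d T × TimeSimplex T =>
      dist P.1 P₀.1 * P.2.len ^ (2 * α) + ‖P₀.1.lvl2 P.2 - P₀.1.lvl2 P₀.2‖ :=
    ((continuous_fst.dist continuous_const).mul
      ((TimeSimplex.continuous_len.comp continuous_snd).rpow_const fun _ =>
        Or.inr (by linarith))).add
      ((P₀.1.continuous_lvl2.comp continuous_snd).sub continuous_const).norm
  refine squeeze_zero (fun P => norm_nonneg _) (fun P => ?_)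
    ((hg.tendsto P₀).trans_eq (by simp))
  exact (norm_sub_le_norm_sub_add_norm_sub _ (P₀.1.lvl2 P.2) _).trans
    (add_le_add_left (norm_lvl2_sub_le _ _ _) _)

/-- The increment of a rough path at a point of the simplex, extended by the time increment. -/
def inc (w : RoughPath α d T) (q : TimeSimplex T) : Inc d :=
  (fun i => w.lvl1 q i, fun j k => w.lvl2 q (j, k), q.len)

theorem continuous_uncurry_inc (hα : 0 < α) :
    Continuous fun P : RoughPath α d T × TimeSimplex T => P.1.inc P.2 := by
  have h1 := continuous_uncurry_lvl1 (d := d) (T := T) hα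
  have h2 := continuous_uncurry_lvl2 (d := d) (T := T) hα
  have h3 : Continuous fun P : RoughPath α d T × TimeSimplex T => P.2.len :=
    TimeSimplex.continuous_len.comp continuous_snd
  unfold inc
  fun_prop

open Classical in
/-- The increments of a rough path as a function of two real times (with value `0` off the
simplex). -/
noncomputable def driver (w : RoughPath α d T) (s t : ℝ) : Inc d :=
  if h : 0 ≤ s ∧ s ≤ t ∧ t ≤ T then w.inc (TimeSimplex.mk' s t h) else 0

theorem driver_eq (w : RoughPath α d T) {s t : ℝ} (h : 0 ≤ s ∧ s ≤ t ∧ t ≤ T) :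
    w.driver s t = w.inc (TimeSimplex.mk' s t h) := dif_pos h

theorem continuousOn_uncurry_driver (hα : 0 < α) :
    ContinuousOn (fun P : RoughPath α d T × ℝ × ℝ => P.1.driver P.2.1 P.2.2)
      {P | 0 ≤ P.2.1 ∧ P.2.1 ≤ P.2.2 ∧ P.2.2 ≤ T} := by
  rw [continuousOn_iff_continuous_domRestrict]
  have h : Continuous fun P : {P : RoughPath α d T × ℝ × ℝ |
      0 ≤ P.2.1 ∧ P.2.1 ≤ P.2.2 ∧ P.2.2 ≤ T} =>
      ((P.1.1, TimeSimplex.mk' P.1.2.1 P.1.2.2 P.2) : RoughPath α d T × TimeSimplex T) := by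
    unfold TimeSimplex.mk'
    fun_prop
  exact ((continuous_uncurry_inc hα).comp h).congr fun P => (P.1.1.driver_eq P.2).symm

/-- The symmetric part of the second level is determined by the first level. -/
def IsWeaklyGeometric (w : RoughPath α d T) : Prop :=
  ∀ (q : TimeSimplex T) (j k : Fin d),
    w.lvl2 q (j, k) + w.lvl2 q (k, j) = w.lvl1 q j * w.lvl1 q k

/-- Integration by parts. -/
theorem _root_.HasRiemannStieltjesIntegral.add_swap {f g : ℝ → ℝ} {a b K I J : ℝ} (hab : a ≤ b)
    (hf : ∀ x ∈ Set.Icc a b, ∀ y ∈ Set.Icc a b, |f x - f y| ≤ K * |x - y|)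
    (hg : ∀ x ∈ Set.Icc a b, ∀ y ∈ Set.Icc a b, |g x - g y| ≤ K * |x - y|)
    (hI : HasRiemannStieltjesIntegral (fun u => f u - f a) g a b I)
    (hJ : HasRiemannStieltjesIntegral (fun u => g u - g a) f a b J) :
    I + J = (f b - f a) * (g b - g a) := by
  refine eq_of_abs_sub_le_all fun ε hε => ?_
  obtain ⟨δ₁, hδ₁, H₁⟩ := hI (ε / 3) (by linarith)
  obtain ⟨δ₂, hδ₂, H₂⟩ := hJ (ε / 3) (by linarith)
  have l1 : ∀ c : ℝ, Filter.Tendsto (fun n : ℕ => c / (n : ℝ)) Filter.atTop (nhds 0) := fun c =>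
    tendsto_const_div_atTop_nhds_zero_nat c
  -- uniform partitions, tagged at their left end points
  obtain ⟨n, hn1, hn2, hn3, hn⟩ := (((l1 (b - a)).eventually_lt_const hδ₁).and
    (((l1 (b - a)).eventually_lt_const hδ₂).and
    (((l1 (K ^ 2 * (b - a) ^ 2)).eventually_lt_const (by linarith : 0 < ε / 3)).and
    (Filter.eventually_gt_atTop 0)))).exists
  have hn0 : (0 : ℝ) < n := by exact_mod_cast hn
  set h := (b - a) / n with hh
  have h0 : 0 ≤ h := div_nonneg (by linarith) hn0.le
  set τ : ℕ → ℝ := fun k => a + k * h with hτ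
  have hstep : ∀ k, τ (k + 1) - τ k = h := fun k => by simp only [hτ]; push_cast; ring
  have hmono : Monotone τ := fun i j hij => by
    have : (i : ℝ) ≤ j := by exact_mod_cast hij
    simp only [hτ]
    nlinarith
  have hτ0 : τ 0 = a := by simp [hτ]
  have hτn : τ n = b := by simp only [hτ, hh]; field_simp; ring
  have hmem : ∀ k ≤ n, τ k ∈ Set.Icc a b := fun k hk =>
    ⟨by rw [← hτ0]; exact hmono (Nat.zero_le k), by rw [← hτn]; exact hmono hk⟩
  have s₁ := H₁ n τ τ hmono hτ0 hτn (fun i _ => by rw [hstep]; exact hn1)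
    fun i _ => ⟨le_rfl, hmono (Nat.le_succ i)⟩
  have s₂ := H₂ n τ τ hmono hτ0 hτn (fun i _ => by rw [hstep]; exact hn2)
    fun i _ => ⟨le_rfl, hmono (Nat.le_succ i)⟩
  have hsum : ∑ i ∈ Finset.range n, (f (τ i) - f a) * (g (τ (i + 1)) - g (τ i)) +
      ∑ i ∈ Finset.range n, (g (τ i) - g a) * (f (τ (i + 1)) - f (τ i)) =
      (f b - f a) * (g b - g a) -
        ∑ i ∈ Finset.range n, (f (τ (i + 1)) - f (τ i)) * (g (τ (i + 1)) - g (τ i)) := by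
    have := Finset.sum_range_sub (fun i => (f (τ i) - f a) * (g (τ i) - g a)) n
    simp only [hτ0, hτn] at this
    rw [sub_self, zero_mul, sub_zero] at this
    rw [← this, ← Finset.sum_add_distrib, ← Finset.sum_sub_distrib]
    exact Finset.sum_congr rfl fun i _ => by ring
  have hcov : |∑ i ∈ Finset.range n, (f (τ (i + 1)) - f (τ i)) * (g (τ (i + 1)) - g (τ i))| ≤
      K ^ 2 * (b - a) ^ 2 / n := by
    refine (Finset.abs_sum_le_sum_abs _ _).trans ?_
    refine (Finset.sum_le_card_nsmul _ _ ((K * h) * (K * h)) fun i hi => ?_).trans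
      (le_of_eq ?_)
    · have hi' := Finset.mem_range.1 hi
      have e1 := hf _ (hmem _ hi') _ (hmem _ hi'.le)
      have e2 := hg _ (hmem _ hi') _ (hmem _ hi'.le)
      rw [hstep, abs_of_nonneg h0] at e1 e2
      rw [abs_mul]
      exact mul_le_mul e1 e2 (abs_nonneg _) ((abs_nonneg _).trans e1)
    · rw [Finset.card_range, nsmul_eq_mul, hh]
      field_simp
  rw [abs_lt] at s₁ s₂
  rw [abs_le] at hcov
  rw [abs_le]
  constructor <;> linarith [hcov.1, hcov.2, s₁.1, s₁.2, s₂.1, s₂.2]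

theorem IsLipschitzLift.isWeaklyGeometric {γ : ℝ → EuclideanSpace ℝ (Fin d)}
    {w : RoughPath α d T} (h : IsLipschitzLift γ w) : w.IsWeaklyGeometric := by
  obtain ⟨⟨K, hK⟩, -, hq⟩ := h
  intro q j k
  have hlip : ∀ i : Fin d, ∀ x ∈ Set.Icc (q.1.1 : ℝ) q.1.2, ∀ y ∈ Set.Icc (q.1.1 : ℝ) q.1.2,
      |γ x i - γ y i| ≤ K * |x - y| := by
    intro i x hx y hy
    have sub : ∀ x ∈ Set.Icc (q.1.1 : ℝ) q.1.2, x ∈ Set.Icc (0 : ℝ) T := fun x hx =>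
      ⟨q.1.1.2.1.trans hx.1, hx.2.trans q.1.2.2.2⟩
    have h1 := hK.dist_le_mul _ (sub x hx) _ (sub y hy)
    rw [dist_eq_norm, Real.dist_eq] at h1
    exact (PiLp.norm_apply_le (γ x - γ y) i).trans h1
  rw [(hq q).1]
  exact HasRiemannStieltjesIntegral.add_swap (f := fun u => γ u j) (g := fun u => γ u k)
    (Subtype.coe_le_coe.2 q.2) (hlip j) (hlip k) ((hq q).2 j k) ((hq q).2 k j)

theorem isClosed_isWeaklyGeometric (hα : 0 < α) :
    IsClosed {w : RoughPath α d T | w.IsWeaklyGeometric} := by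
  simp only [IsWeaklyGeometric, Set.ofPred_forall]
  refine isClosed_iInter fun q => isClosed_iInter fun j => isClosed_iInter fun k => ?_
  have h1 : Continuous fun w : RoughPath α d T => w.lvl1 q :=
    (continuous_uncurry_lvl1 hα).comp (continuous_id.prodMk continuous_const)
  have h2 : Continuous fun w : RoughPath α d T => w.lvl2 q :=
    (continuous_uncurry_lvl2 hα).comp (continuous_id.prodMk continuous_const)
  exact isClosed_eq (by fun_prop) (by fun_prop)

theorem _root_.GeometricRoughPath.isWeaklyGeometric (hα : 0 < α) (w : GeometricRoughPath α d T) :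
    w.1.IsWeaklyGeometric := by
  have h : {w : RoughPath α d T | ∃ γ, IsLipschitzLift γ w} ⊆ {w | w.IsWeaklyGeometric} :=
    fun _ ⟨_, h⟩ => h.isWeaklyGeometric
  exact closure_minimal h (isClosed_isWeaklyGeometric hα) w.2

/-- Geometric rough paths are drivers, with a constant that is locally uniform. -/
theorem _root_.GeometricRoughPath.exists_isDriver (hα : 0 < α) (hα2 : α < 1 / 2)
    (w₀ : GeometricRoughPath α d T) :
    ∃ R ≥ 0, ∀ w : GeometricRoughPath α d T, dist w w₀ ≤ 1 → IsDriver w.1.driver α R 0 T := by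
  obtain ⟨C₁, hC₁⟩ := w₀.1.holder1
  obtain ⟨C₂, hC₂⟩ := w₀.1.holder2
  have hb₁ : ∀ q, ‖w₀.1.lvl1 q‖ ≤ |C₁| * q.len ^ α := fun q => by
    rcases q.2.lt_or_eq with h | h
    · exact (hC₁ q h).trans (mul_le_mul_of_nonneg_right (le_abs_self _)
        (Real.rpow_nonneg q.len_nonneg _))
    · obtain ⟨⟨s, t⟩, hst⟩ := q
      obtain rfl : s = t := h
      rw [lvl1_diag, norm_zero]
      exact mul_nonneg (abs_nonneg _) (Real.rpow_nonneg (TimeSimplex.len_nonneg _) _)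
  have hb₂ : ∀ q, ‖w₀.1.lvl2 q‖ ≤ |C₂| * q.len ^ (2 * α) := fun q => by
    rcases q.2.lt_or_eq with h | h
    · exact (hC₂ q h).trans (mul_le_mul_of_nonneg_right (le_abs_self _)
        (Real.rpow_nonneg q.len_nonneg _))
    · obtain ⟨⟨s, t⟩, hst⟩ := q
      obtain rfl : s = t := h
      rw [lvl2_diag, norm_zero]
      exact mul_nonneg (abs_nonneg _) (Real.rpow_nonneg (TimeSimplex.len_nonneg _) _)
  have hT : 0 ≤ |T| ^ (1 - 2 * α) := Real.rpow_nonneg (abs_nonneg _) _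
  refine ⟨|C₁| + |C₂| + 1 + |T| ^ (1 - 2 * α), by positivity, fun w hw => ⟨?_, ?_, ?_, ?_⟩⟩
  · intro s u t h1 h2 h3 h4
    rw [w.1.driver_eq ⟨h1, h2.trans h3, h4⟩, w.1.driver_eq ⟨h1, h2, h3.trans h4⟩,
      w.1.driver_eq ⟨h1.trans h2, h3, h4⟩]
    refine Prod.ext ?_ (Prod.ext ?_ ?_)
    · funext i
      exact congrArg (fun v : EuclideanSpace ℝ (Fin d) => v i)
        (w.1.chen1 ⟨s, h1, h2.trans (h3.trans h4)⟩ ⟨u, h1.trans h2, h3.trans h4⟩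
          ⟨t, h1.trans (h2.trans h3), h4⟩ h2 h3)
    · funext j k
      exact w.1.chen2 ⟨s, h1, h2.trans (h3.trans h4)⟩ ⟨u, h1.trans h2, h3.trans h4⟩
          ⟨t, h1.trans (h2.trans h3), h4⟩ h2 h3 j k
    · simp only [inc, Inc.chen, TimeSimplex.len_mk']
      ring
  · intro s t h1 h2 h3
    rw [w.1.driver_eq ⟨h1, h2, h3⟩]
    set q := TimeSimplex.mk' s t ⟨h1, h2, h3⟩ with hq
    have hlen : q.len = t - s := rfl
    have hts : 0 ≤ t - s := by linarith
    have hsq : ((t - s) ^ α) ^ 2 = (t - s) ^ (2 * α) := by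
      rw [← Real.rpow_natCast, ← Real.rpow_mul hts]
      congr 1
      push_cast
      ring
    have k₁ : 0 ≤ (t - s) ^ α := Real.rpow_nonneg hts _
    have k₂ : 0 ≤ (t - s) ^ (2 * α) := Real.rpow_nonneg hts _
    have hw' : dist w.1 w₀.1 ≤ 1 := hw
    have n₁ : ‖w.1.lvl1 q‖ ≤ (1 + |C₁|) * (t - s) ^ α := by
      have e := norm_lvl1_sub_le w.1 w₀.1 q
      have e' := hb₁ q
      rw [hlen] at e e'
      have := norm_le_norm_sub_add (w.1.lvl1 q) (w₀.1.lvl1 q)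
      nlinarith
    have n₂ : ‖w.1.lvl2 q‖ ≤ (1 + |C₂|) * (t - s) ^ (2 * α) := by
      have e := norm_lvl2_sub_le w.1 w₀.1 q
      have e' := hb₂ q
      rw [hlen] at e e'
      have := norm_le_norm_sub_add (w.1.lvl2 q) (w₀.1.lvl2 q)
      nlinarith
    refine ⟨fun i => ((PiLp.norm_apply_le (w.1.lvl1 q) i).trans n₁).trans
      (mul_le_mul_of_nonneg_right (by linarith [abs_nonneg C₂]) k₁), fun j k => ?_, ?_⟩
    · rw [hsq]
      exact ((PiLp.norm_apply_le (w.1.lvl2 q) (j, k)).trans n₂).trans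
        (mul_le_mul_of_nonneg_right (by linarith [abs_nonneg C₁]) k₂)
    · rw [hsq]
      change |t - s| ≤ _
      rw [abs_of_nonneg hts]
      -- since `2 α < 1`, the time increment is at most of the order of the second level
      have e : t - s = (t - s) ^ (1 - 2 * α) * (t - s) ^ (2 * α) := by
        rw [← Real.rpow_add_of_nonneg hts (by linarith) (by linarith)]
        simp
      have e2 : (t - s) ^ (1 - 2 * α) ≤ |T| ^ (1 - 2 * α) :=
        Real.rpow_le_rpow hts (by linarith [le_abs_self T]) (by linarith)
      calc t - s = (t - s) ^ (1 - 2 * α) * (t - s) ^ (2 * α) := e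
        _ ≤ _ := mul_le_mul_of_nonneg_right (by linarith [abs_nonneg C₁, abs_nonneg C₂]) k₂
  · intro s t h1 h2 h3 j k
    rw [w.1.driver_eq ⟨h1, h2, h3⟩]
    exact w.isWeaklyGeometric hα _ j k
  · exact (continuousOn_uncurry_driver hα).comp (f := fun P : ℝ × ℝ => (w.1, P))
      (by fun_prop) fun P hP => hP

/-- The driver of the reversed rough path, with the sign of the drift changed, is the reversed
driver. -/
theorem _root_.GeometricRoughPath.driver_reverse (hα : 0 < α) (w : GeometricRoughPath α d T)
    (S : Set.Icc (0 : ℝ) T) {s t : ℝ} (h : 0 ≤ s ∧ s ≤ t ∧ t ≤ S) :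
    (((w.reverse S).1.driver s t).1, ((w.reverse S).1.driver s t).2.1,
      -((w.reverse S).1.driver s t).2.2) = (w.1.driver (S - t) (S - s)).chenInv := by
  have h' : 0 ≤ (S : ℝ) - t ∧ (S : ℝ) - t ≤ S - s ∧ (S : ℝ) - s ≤ T :=
    ⟨by linarith, by linarith, by linarith [S.2.2]⟩
  rw [RoughPath.driver_eq _ h, RoughPath.driver_eq _ h']
  refine Prod.ext ?_ (Prod.ext ?_ ?_)
  · rfl
  · funext j k
    have := w.isWeaklyGeometric hα (TimeSimplex.mk' _ _ h') j k
    change w.1.lvl2 (TimeSimplex.mk' _ _ h') (k, j) =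
      -w.1.lvl2 (TimeSimplex.mk' _ _ h') (j, k) + w.1.lvl1 (TimeSimplex.mk' _ _ h') j *
        w.1.lvl1 (TimeSimplex.mk' _ _ h') k
    linarith
  · simp only [inc, Inc.chenInv, TimeSimplex.len_mk']
    ring

end RoughPath

end RoughPathDriver

section Translate

variable {p d : ℕ} {Z M : Type*} [TopologicalSpace Z] [TopologicalSpace M]
  {𝓕 : FoliatedAtlas p Z M} {V : Fin d → LeafwiseVectorField 𝓕 3}
  {V₀ : LeafwiseVectorField 𝓕 3} {α T : ℝ} {x : ℝ → M}

theorem isRDESolution_iff (hT : 0 ≤ T) {w : GeometricRoughPath α d T} {m : M}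
    {y : C(Set.Icc (0 : ℝ) T, M)} (hy : ∀ t : Set.Icc (0 : ℝ) T, y t = x t) :
    IsRDESolution V V₀ w m y ↔ x 0 = m ∧ IsSolOn V V₀ w.1.driver α x 0 T := by
  refine and_congr ⟨fun h => ?_, fun h t ht => ?_⟩ ⟨fun h => ⟨?_, fun f hf => ?_⟩, fun h f hf => ?_⟩
  · rw [← h ⟨0, le_rfl, hT⟩ rfl, hy]
  · rw [hy, ht, h]
  · rw [continuousOn_iff_continuous_domRestrict]
    exact y.continuous.congr hy
  · obtain ⟨C, hC⟩ := h f hf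
    refine ⟨C, fun s t h1 h2 h3 => ?_⟩
    have := hC (TimeSimplex.mk' s t ⟨h1, h2, h3⟩)
    simp only [hy] at this
    rw [RoughPath.driver_eq _ ⟨h1, h2, h3⟩]
    exact this
  · obtain ⟨C, hC⟩ := h.2 f hf
    refine ⟨C, fun q => ?_⟩
    have := hC q.1.1 q.1.2 q.1.1.2.1 q.2 q.1.2.2.2
    rw [RoughPath.driver_eq _ ⟨q.1.1.2.1, q.2, q.1.2.2.2⟩] at this
    simp only [hy]
    exact this

theorem LeafwiseVectorField.lieDeriv_neg {k : ℕ} (W : LeafwiseVectorField 𝓕 k) (f : M → ℝ) (m : M) :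
    W.neg.lieDeriv f m = -W.lieDeriv f m :=
  map_neg _ _

/-- Reversing the sign of the drift amounts to reversing the sign of the time increments. -/
theorem isSolOn_reverse_iff (hα : 0 < α) (w : GeometricRoughPath α d T) (S : Set.Icc (0 : ℝ) T) :
    IsSolOn V V₀.neg (w.reverse S).1.driver α x 0 S ↔
      IsSolOn V V₀ (fun s t => (w.1.driver (S - t) (S - s)).chenInv) α x 0 S := by
  have h : ∀ (f : M → ℝ) (s t : ℝ), 0 ≤ s → s ≤ t → t ≤ S →
      rdeExpansion V V₀.neg f ((w.reverse S).1.driver s t) (x s) =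
      rdeExpansion V V₀ f ((w.1.driver (S - t) (S - s)).chenInv) (x s) := by
    intro f s t h1 h2 h3
    rw [← w.driver_reverse hα S ⟨h1, h2, h3⟩]
    simp only [rdeExpansion, LeafwiseVectorField.lieDeriv_neg]
    ring
  refine and_congr_right fun _ => forall₂_congr fun f _ => exists_congr fun C => ?_
  refine forall₂_congr fun s t => forall₃_congr fun h1 h2 h3 => ?_
  rw [h f s t h1 h2 h3]

end Translate

/-! ### The flow and its continuity -/

section Flow

variable {p d : ℕ} {Z M : Type*} [TopologicalSpace Z] [TopologicalSpace M]
  {𝓕 : FoliatedAtlas p Z M} {V : Fin d → LeafwiseVectorField 𝓕 3}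
  {V₀ : LeafwiseVectorField 𝓕 3} {α T : ℝ}

theorem Inc.chenInv_chenInv (a : Inc d) : a.chenInv.chenInv = a := by
  refine Prod.ext ?_ (Prod.ext ?_ ?_)
  · simp [Inc.chenInv]
  · funext j k
    simp [Inc.chenInv]
  · simp [Inc.chenInv]

variable (V V₀) in
theorem existsUnique_isRDESolution [T2Space M] [CompactSpace M] [LocallyCompactSpace Z]
    [TopologicalSpace.MetrizableSpace Z] (hα : α ∈ Set.Ioo (1 / 3 : ℝ) (1 / 2)) (hT : 0 ≤ T)
    (w : GeometricRoughPath α d T) (m : M) : ∃! x, IsRDESolution V V₀ w m x := by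
  have hα0 : 0 < α := by linarith [hα.1]
  obtain ⟨R, hR, hw⟩ := w.exists_isDriver hα0 hα.2
  have hA := hw w (by simp)
  obtain ⟨x, hx0, hx, -⟩ := exists_isSolOn V V₀ hα.1 hR hT hA m
  refine ⟨⟨fun t => x t, hx.1.domRestrict⟩, (isRDESolution_iff hT fun t => rfl).2 ⟨hx0, hx⟩,
    fun y hy => ?_⟩
  obtain ⟨hy0, hy⟩ := (isRDESolution_iff (x := Set.IccExtend hT y) hT
    fun t => (Set.IccExtend_val hT y t).symm).1 hy
  ext t
  have := hy.eq_of_eq_left hα.1 hR hA hx (hy0.trans hx0.symm) t.2.1 t.2.2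
  rwa [Set.IccExtend_val] at this

variable (V V₀) in
/-- The flow as a function of real times: `lyonsIto` is extended by constants off `[0, T]`. -/
noncomputable def flow (hT : 0 ≤ T) (m : M) (w : GeometricRoughPath α d T) : ℝ → M :=
  Set.IccExtend hT (lyonsIto V V₀ m w)

theorem flow_coe (hT : 0 ≤ T) (m : M) (w : GeometricRoughPath α d T) (t : Set.Icc (0 : ℝ) T) :
    flow V V₀ hT m w t = lyonsIto V V₀ m w t := Set.IccExtend_val _ _ _

section

variable [T2Space M] [CompactSpace M] [LocallyCompactSpace Z]
  [TopologicalSpace.MetrizableSpace Z]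

theorem isRDESolution_lyonsIto (hα : α ∈ Set.Ioo (1 / 3 : ℝ) (1 / 2)) (hT : 0 ≤ T)
    (w : GeometricRoughPath α d T) (m : M) : IsRDESolution V V₀ w m (lyonsIto V V₀ m w) := by
  have h := (existsUnique_isRDESolution V V₀ hα hT w m).exists
  rw [lyonsIto, dif_pos h]
  exact h.choose_spec

theorem flow_isSolOn (hα : α ∈ Set.Ioo (1 / 3 : ℝ) (1 / 2)) (hT : 0 ≤ T)
    (w : GeometricRoughPath α d T) (m : M) :
    flow V V₀ hT m w 0 = m ∧ IsSolOn V V₀ w.1.driver α (flow V V₀ hT m w) 0 T :=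
  (isRDESolution_iff hT fun t => (flow_coe hT m w t).symm).1 (isRDESolution_lyonsIto hα hT w m)

theorem flow_mem_leaf (hα : α ∈ Set.Ioo (1 / 3 : ℝ) (1 / 2)) (hT : 0 ≤ T)
    (w : GeometricRoughPath α d T) (m : M) {t : ℝ} (ht : 0 ≤ t) (htT : t ≤ T) :
    flow V V₀ hT m w t ∈ 𝓕.leaf m := by
  obtain ⟨R, hR, hw⟩ := w.exists_isDriver (by linarith [hα.1]) hα.2
  have hA := (hw w (by simp)).mono le_rfl htT
  obtain ⟨x, hx0, hx, hxt⟩ := exists_isSolOn V V₀ hα.1 hR ht hA m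
  obtain ⟨h0, h⟩ := flow_isSolOn (V := V) (V₀ := V₀) hα hT w m
  rwa [(h.mono le_rfl htT).eq_of_eq_left hα.1 hR hA hx (h0.trans hx0.symm) ht le_rfl]

/-- The flow of the reversed equation inverts the flow, on both sides. -/
theorem flow_reverse_flow (hα : α ∈ Set.Ioo (1 / 3 : ℝ) (1 / 2)) (hT : 0 ≤ T)
    (w : GeometricRoughPath α d T) (S : Set.Icc (0 : ℝ) T) (m : M) :
    flow V V₀.neg S.2.1 (flow V V₀ hT m w S) (w.reverse S) S = m ∧
    flow V V₀ hT (flow V V₀.neg S.2.1 m (w.reverse S) S) w S = m := by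
  have hα0 : 0 < α := by linarith [hα.1]
  obtain ⟨R, hR, hw⟩ := w.exists_isDriver hα0 hα.2
  have hA : IsDriver w.1.driver α R 0 S := (hw w (by simp)).mono le_rfl S.2.2
  have hA' : IsDriver (fun s t => (w.1.driver (S - t) (S - s)).chenInv) α (R + R ^ 2) 0 S := by
    simpa using hA.reverse S
  constructor
  · obtain ⟨h0, h⟩ := flow_isSolOn (V := V) (V₀ := V₀) hα hT w m
    have h1 := (h.mono le_rfl S.2.2).reverse hα.1 hR hA S
    rw [sub_self, sub_zero] at h1
    obtain ⟨h0', h'⟩ := flow_isSolOn (V := V) (V₀ := V₀.neg) hα S.2.1 (w.reverse S)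
      (flow V V₀ hT m w S)
    rw [isSolOn_reverse_iff hα0] at h'
    rw [h'.eq_of_eq_left hα.1 (by positivity) hA' h1 (by rw [h0', sub_zero]) S.2.1 le_rfl,
      sub_self, h0]
  · obtain ⟨h0', h'⟩ := flow_isSolOn (V := V) (V₀ := V₀.neg) hα S.2.1 (w.reverse S) m
    rw [isSolOn_reverse_iff hα0] at h'
    have h1 := h'.reverse hα.1 (by positivity) hA' S
    simp only [sub_self, sub_zero, sub_sub_cancel, Inc.chenInv_chenInv] at h1
    obtain ⟨h0, h⟩ := flow_isSolOn (V := V) (V₀ := V₀) hα hT w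
      (flow V V₀.neg S.2.1 m (w.reverse S) S)
    rw [(h.mono le_rfl S.2.2).eq_of_eq_left hα.1 hR hA h1 (by rw [h0, sub_zero]) S.2.1 le_rfl,
      sub_self, h0']

end

/-- Euler schemes depend continuously on the initial value, the plaque, the driver and the step. -/
theorem continuousWithinAt_euler {X : Type*} [TopologicalSpace X] {D : Set X} {P₀ : X}
    {φ : OpenPartialHomeomorph M (EuclideanSpace ℝ (Fin p) × Z)} (hφ : φ ∈ 𝓕.charts)
    {A : X → ℝ → ℝ → Inc d} {h : X → ℝ} {z : X → Z} {y : X → EuclideanSpace ℝ (Fin p)} {s : ℝ}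
    {n : ℕ} (hA : ∀ k < n, ContinuousWithinAt
      (fun P => A P (s + k * h P) (s + (k + 1 : ℕ) * h P)) D P₀)
    (hz : ContinuousWithinAt z D P₀) (hy : ContinuousWithinAt y D P₀)
    (hmem : ∀ k ≤ n, (euler (fun s t => chartStep V V₀ φ (z P₀) (A P₀ s t)) s (h P₀) k (y P₀),
      z P₀) ∈ φ.target) :
    ∀ k ≤ n, ContinuousWithinAt
      (fun P => euler (fun s t => chartStep V V₀ φ (z P) (A P s t)) s (h P) k (y P)) D P₀ := by
  intro k
  induction k with
  | zero => exact fun _ => hy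
  | succ k ih =>
    intro hk
    have hc : ContinuousAt (fun Q : Inc d × EuclideanSpace ℝ (Fin p) × Z =>
        chartStep V V₀ φ Q.2.2 Q.1 Q.2.1)
        (A P₀ (s + k * h P₀) (s + (k + 1 : ℕ) * h P₀),
          euler (fun s t => chartStep V V₀ φ (z P₀) (A P₀ s t)) s (h P₀) k (y P₀), z P₀) :=
      (continuousOn_chartStep V V₀ hφ).continuousAt
        ((φ.open_target.preimage continuous_snd).mem_nhds (hmem k (by omega)))
    refine (hc.comp_continuousWithinAt (f := fun P => (A P (s + k * h P) (s + (k + 1 : ℕ) * h P),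
      euler (fun s t => chartStep V V₀ φ (z P) (A P s t)) s (h P) k (y P), z P))
      ((hA k (by omega)).prodMk ((ih (by omega)).prodMk hz))).congr (fun P _ => ?_) ?_
    · rw [euler_succ]
      rfl
    · rw [euler_succ]
      rfl

variable [T2Space M] [CompactSpace M] [LocallyCompactSpace Z]
  [TopologicalSpace.MetrizableSpace Z]

/-- Continuity of the flow propagates over time intervals of a fixed length: there the flow is a
uniform limit of Euler schemes. -/
theorem flow_continuousWithinAt_of_continuousAt (hα : α ∈ Set.Ioo (1 / 3 : ℝ) (1 / 2)) (hT : 0 ≤ T)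
    {w₀ : GeometricRoughPath α d T} {m₀ : M} {R δ C s t₀ : ℝ} (hR : 0 ≤ R) (hC : 0 ≤ C)
    (hw : ∀ w : GeometricRoughPath α d T, dist w w₀ ≤ 1 → IsDriver w.1.driver α R 0 T)
    {φ : OpenPartialHomeomorph M (EuclideanSpace ℝ (Fin p) × Z)} {O : Set M} (hs : 0 ≤ s)
    (hO : O ∈ nhds (flow V V₀ hT m₀ w₀ s)) (hφ : IsLocalFlowChart V V₀ α R φ O δ C)
    (ht₀ : s ≤ t₀ ∧ t₀ ≤ s + δ ∧ t₀ ≤ T)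
    (hc : ContinuousAt (fun P : M × GeometricRoughPath α d T => flow V V₀ hT P.1 P.2 s) (m₀, w₀)) :
    ContinuousWithinAt
      (fun P : M × GeometricRoughPath α d T × ℝ => flow V V₀ hT P.1 P.2.1 P.2.2)
      {P | s ≤ P.2.2 ∧ P.2.2 ≤ s + δ ∧ P.2.2 ≤ T} (m₀, w₀, t₀) := by
  have hα0 : 0 < α := by linarith [hα.1]
  set D : Set (M × GeometricRoughPath α d T × ℝ) :=
    {P | s ≤ P.2.2 ∧ P.2.2 ≤ s + δ ∧ P.2.2 ≤ T} with hD
  set g : M × GeometricRoughPath α d T × ℝ → M := fun P => flow V V₀ hT P.1 P.2.1 s with hg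
  set P₀ : M × GeometricRoughPath α d T × ℝ := (m₀, w₀, t₀) with hP₀
  have hP₀D : P₀ ∈ D := ht₀
  have hgc : ContinuousAt g P₀ := by
    refine ContinuousAt.comp (g := fun P : M × GeometricRoughPath α d T => flow V V₀ hT P.1 P.2 s)
      (f := fun P : M × GeometricRoughPath α d T × ℝ => (P.1, P.2.1)) hc ?_
    exact (by fun_prop : Continuous fun P : M × GeometricRoughPath α d T × ℝ =>
      (P.1, P.2.1)).continuousAt
  have hδ : 0 ≤ δ := by linarith [ht₀.1, ht₀.2.1]
  have hmO : ∀ᶠ P in nhds P₀, g P ∈ O := hgc hO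
  have hwd : ∀ᶠ P in nhds P₀, dist P.2.1 w₀ ≤ 1 := by
    have : Continuous fun P : M × GeometricRoughPath α d T × ℝ => dist P.2.1 w₀ := by fun_prop
    exact (this.continuousAt (x := P₀)).eventually_le_const (by simp [hP₀]) |>.mono fun P h => h
  -- restarting at time `s`, the flow is the local solution through `g P`, by uniqueness
  have key : ∀ P ∈ D, g P ∈ O → dist P.2.1 w₀ ≤ 1 →
      flow V V₀ hT P.1 P.2.1 P.2.2 ∈ φ.source ∧
      (φ (flow V V₀ hT P.1 P.2.1 P.2.2)).2 = (φ (g P)).2 ∧ ∀ n : ℕ, 0 < n →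
        ‖(φ (flow V V₀ hT P.1 P.2.1 P.2.2)).1 -
          euler (fun s t => chartStep V V₀ φ (φ (g P)).2 (P.2.1.1.driver s t)) s
            ((P.2.2 - s) / n) n (φ (g P)).1‖ ≤ n * (C * (δ / n) ^ (3 * α)) := by
    rintro ⟨m, w, t⟩ ⟨h1, h2, h3⟩ hgO hwd
    have hA : IsDriver w.1.driver α R s t := (hw w hwd).mono hs h3
    obtain ⟨x, hx0, hx, hxs, hxz, hxn⟩ := hφ.exists_solution w.1.driver s t h1
      (by simp only at h2; linarith) hA _ hgO
    have hfl := (flow_isSolOn (V := V) (V₀ := V₀) hα hT w m).2.mono hs h3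
    have e : flow V V₀ hT m w t = x t :=
      hfl.eq_of_eq_left hα.1 hR hA hx hx0.symm h1 le_rfl
    simp only at h1 h2 h3 ⊢
    rw [e]
    refine ⟨hxs, hxz, fun n hn => (hxn n hn).trans ?_⟩
    have hn0 : (0 : ℝ) < n := by exact_mod_cast hn
    have : ((t - s) / n) ^ (3 * α) ≤ (δ / n) ^ (3 * α) :=
      Real.rpow_le_rpow (div_nonneg (by linarith) hn0.le)
        (div_le_div_of_nonneg_right (by linarith) hn0.le) (by linarith)
    gcongr
  have hφg : ContinuousAt (fun P => φ (g P)) P₀ :=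
    ContinuousAt.comp (g := φ) (f := g)
      (φ.continuousAt (hφ.subset_source (mem_of_mem_nhds hO))) hgc
  have heuler : ∀ n : ℕ, 0 < n → ContinuousWithinAt (fun P : M × GeometricRoughPath α d T × ℝ =>
      euler (fun s t => chartStep V V₀ φ (φ (g P)).2 (P.2.1.1.driver s t)) s
        ((P.2.2 - s) / n) n (φ (g P)).1) D P₀ := by
    intro n hn
    have hn0 : (0 : ℝ) < n := by exact_mod_cast hn
    refine continuousWithinAt_euler hφ.mem_charts
      (A := fun P : M × GeometricRoughPath α d T × ℝ => P.2.1.1.driver)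
      (h := fun P : M × GeometricRoughPath α d T × ℝ => (P.2.2 - s) / n)
      (fun k hk => ?_) (continuous_snd.continuousAt.comp hφg).continuousWithinAt
      (continuous_fst.continuousAt.comp hφg).continuousWithinAt
      (fun k hk => ?_) n le_rfl
    · have h1 := RoughPath.continuousOn_uncurry_driver (d := d) (T := T) hα0
      have h2 : ContinuousOn (fun P : M × GeometricRoughPath α d T × ℝ =>
          P.2.1.1.driver (s + k * ((P.2.2 - s) / n)) (s + (k + 1 : ℕ) * ((P.2.2 - s) / n))) D := by
        refine h1.comp (f := fun P : M × GeometricRoughPath α d T × ℝ =>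
          (P.2.1.1, s + k * ((P.2.2 - s) / n), s + (k + 1 : ℕ) * ((P.2.2 - s) / n)))
          (by fun_prop) fun P hP => ?_
        have e0 : 0 ≤ (P.2.2 - s) / n := div_nonneg (by linarith [hP.1]) hn0.le
        have e1 : (n : ℝ) * ((P.2.2 - s) / n) = P.2.2 - s := mul_div_cancel₀ _ hn0.ne'
        have e2 : ((k + 1 : ℕ) : ℝ) ≤ n := by exact_mod_cast hk
        have e3 := mul_le_mul_of_nonneg_right e2 e0
        refine ⟨?_, ?_, ?_⟩
        · positivity
        · push_cast
          linarith
        · simp only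
          linarith [hP.2.2]
      exact h2 P₀ hP₀D
    · exact hφ.euler_mem w₀.1.driver s t₀ ht₀.1 (by linarith [ht₀.2.1])
        ((hw w₀ (by simp)).mono hs ht₀.2.2) _ (mem_of_mem_nhds hO) n hn k hk
  have hY : ContinuousWithinAt (fun P : M × GeometricRoughPath α d T × ℝ =>
      (φ (flow V V₀ hT P.1 P.2.1 P.2.2)).1) D P₀ := by
    refine continuousWithinAt_of_locally_uniform_approx_of_continuousWithinAt hP₀D fun u hu => ?_
    obtain ⟨ε, hε, hεu⟩ := Metric.mem_uniformity_dist.1 hu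
    obtain ⟨n, hn, hn0⟩ := (((tendsto_nat_mul_div_rpow (by linarith [hα.1] : 1 < 3 * α) hδ
      C).eventually_lt_const hε).and (Filter.eventually_gt_atTop 0)).exists
    refine ⟨_, Filter.inter_mem self_mem_nhdsWithin
      (mem_nhdsWithin_of_mem_nhds (hmO.and hwd)), _, heuler n hn0, fun P hP => hεu ?_⟩
    rw [dist_eq_norm]
    exact ((key P hP.1 hP.2.1 hP.2.2).2.2 n hn0).trans_lt hn
  have hP₀' := key P₀ hP₀D (mem_of_mem_nhds hO) (by simp [hP₀])
  have hZ : ContinuousWithinAt (fun P : M × GeometricRoughPath α d T × ℝ => (φ (g P)).2) D P₀ :=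
    (continuous_snd.continuousAt.comp hφg).continuousWithinAt
  have hval : ∀ P ∈ D, g P ∈ O → dist P.2.1 w₀ ≤ 1 → flow V V₀ hT P.1 P.2.1 P.2.2 =
      φ.symm ((φ (flow V V₀ hT P.1 P.2.1 P.2.2)).1, (φ (g P)).2) := by
    intro P h1 h2 h3
    obtain ⟨k1, k2, -⟩ := key P h1 h2 h3
    rw [← k2, Prod.mk.eta, φ.left_inv k1]
  have hsymm : ContinuousAt φ.symm ((φ (flow V V₀ hT P₀.1 P₀.2.1 P₀.2.2)).1, (φ (g P₀)).2) := by
    refine φ.symm.continuousAt ?_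
    rw [← hP₀'.2.1]
    exact φ.map_source hP₀'.1
  have hcomp := hsymm.comp_continuousWithinAt
    (f := fun P : M × GeometricRoughPath α d T × ℝ =>
      ((φ (flow V V₀ hT P.1 P.2.1 P.2.2)).1, (φ (g P)).2)) (hY.prodMk hZ)
  refine hcomp.congr_of_eventuallyEq ?_ (hval P₀ hP₀D (mem_of_mem_nhds hO) (by simp [hP₀]))
  filter_upwards [self_mem_nhdsWithin, mem_nhdsWithin_of_mem_nhds (hmO.and hwd)] with P h1 h2
  exact hval P h1 h2.1 h2.2

/-- The flow depends continuously on the initial point, the rough path and the time. -/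
theorem continuous_lyonsIto (hα : α ∈ Set.Ioo (1 / 3 : ℝ) (1 / 2)) (hT : 0 ≤ T) :
    Continuous fun P : M × GeometricRoughPath α d T × Set.Icc (0 : ℝ) T =>
      lyonsIto V V₀ P.1 P.2.1 P.2.2 := by
  have hα0 : 0 < α := by linarith [hα.1]
  have main : ∀ (w₀ : GeometricRoughPath α d T) (t₀ : ℝ), 0 ≤ t₀ → t₀ ≤ T → ∀ m₀ : M,
      ContinuousWithinAt (fun P : M × GeometricRoughPath α d T × ℝ =>
        flow V V₀ hT P.1 P.2.1 P.2.2) {P | 0 ≤ P.2.2 ∧ P.2.2 ≤ T} (m₀, w₀, t₀) := by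
    intro w₀
    obtain ⟨R, hR, hw⟩ := w₀.exists_isDriver hα0 hα.2
    obtain ⟨δ, hδ, hloc⟩ := exists_uniform_isLocalFlowChart V V₀ hα.1 hR
    -- the restarting time `s` lies strictly before `t₀` unless it is `0`, so that the interval
    -- `[s, s + δ]` contains a neighbourhood of `t₀` in `[0, T]`
    have step : ∀ t₀ s, 0 ≤ s → s ≤ t₀ → t₀ ≤ T → t₀ ≤ s + δ / 2 → (s = 0 ∨ s < t₀) →
        ∀ m₀ : M, ContinuousAt
          (fun P : M × GeometricRoughPath α d T => flow V V₀ hT P.1 P.2 s) (m₀, w₀) →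
        ContinuousWithinAt (fun P : M × GeometricRoughPath α d T × ℝ =>
          flow V V₀ hT P.1 P.2.1 P.2.2) {P | 0 ≤ P.2.2 ∧ P.2.2 ≤ T} (m₀, w₀, t₀) := by
      intro t₀ s h1 h2 h3 h4 h5 m₀ hc
      obtain ⟨φ, O, hO, C, hC, hφ⟩ := hloc (flow V V₀ hT m₀ w₀ s)
      refine (flow_continuousWithinAt_of_continuousAt hα hT hR hC hw h1 hO hφ
        ⟨h2, by linarith, h3⟩ hc).mono_of_mem_nhdsWithin ?_
      have ht : Continuous fun P : M × GeometricRoughPath α d T × ℝ => P.2.2 := by fun_prop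
      have u1 : ∀ᶠ P in nhdsWithin (m₀, w₀, t₀) {P : M × GeometricRoughPath α d T × ℝ |
          0 ≤ P.2.2 ∧ P.2.2 ≤ T}, P.2.2 < s + δ :=
        (mem_nhdsWithin_of_mem_nhds ((isOpen_lt ht continuous_const).mem_nhds
          (show t₀ < s + δ by linarith)))
      have u2 : ∀ᶠ P in nhdsWithin (m₀, w₀, t₀) {P : M × GeometricRoughPath α d T × ℝ |
          0 ≤ P.2.2 ∧ P.2.2 ≤ T}, s ≤ P.2.2 := by
        rcases h5 with rfl | h5
        · filter_upwards [self_mem_nhdsWithin] with P hP using hP.1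
        · filter_upwards [mem_nhdsWithin_of_mem_nhds ((isOpen_lt continuous_const ht).mem_nhds
            (show s < t₀ from h5))] with P hP using le_of_lt hP
      filter_upwards [u1, u2, self_mem_nhdsWithin] with P k1 k2 k3
      exact ⟨k2, k1.le, k3.2⟩
    have hzero : ∀ m₀ : M, ContinuousAt
        (fun P : M × GeometricRoughPath α d T => flow V V₀ hT P.1 P.2 0) (m₀, w₀) := by
      intro m₀
      have : (fun P : M × GeometricRoughPath α d T => flow V V₀ hT P.1 P.2 0) = Prod.fst :=
        funext fun P => (flow_isSolOn hα hT P.2 P.1).1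
      rw [this]
      exact continuousAt_fst
    have ind : ∀ n : ℕ, ∀ t₀, 0 ≤ t₀ → t₀ ≤ T → t₀ ≤ (n + 1) * (δ / 2) → ∀ m₀ : M,
        ContinuousWithinAt (fun P : M × GeometricRoughPath α d T × ℝ =>
          flow V V₀ hT P.1 P.2.1 P.2.2) {P | 0 ≤ P.2.2 ∧ P.2.2 ≤ T} (m₀, w₀, t₀) := by
      intro n
      induction n with
      | zero =>
        exact fun t₀ h1 h2 h3 m₀ => step t₀ 0 le_rfl h1 h2 (by push_cast at h3; linarith)
          (Or.inl rfl) m₀ (hzero m₀)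
      | succ n ih =>
        intro t₀ h1 h2 h3 m₀
        rcases le_total t₀ (δ / 2) with hle | hle
        · exact step t₀ 0 le_rfl h1 h2 (by linarith) (Or.inl rfl) m₀ (hzero m₀)
        · refine step t₀ (t₀ - δ / 2) (by linarith) (by linarith) h2 (by linarith)
            (Or.inr (by linarith)) m₀ ?_
          have h := ih (t₀ - δ / 2) (by linarith) (by linarith) (by push_cast at h3; linarith) m₀
          rw [← continuousWithinAt_univ]
          refine ContinuousWithinAt.comp (t := {P | 0 ≤ P.2.2 ∧ P.2.2 ≤ T})
            (g := fun P : M × GeometricRoughPath α d T × ℝ => flow V V₀ hT P.1 P.2.1 P.2.2)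
            (f := fun P : M × GeometricRoughPath α d T => (P.1, P.2, t₀ - δ / 2))
            (x := (m₀, w₀)) h ?_ ?_
          · exact (by fun_prop : Continuous fun P : M × GeometricRoughPath α d T =>
              (P.1, P.2, t₀ - δ / 2)).continuousWithinAt
          · exact fun P _ => ⟨by simp only; linarith, by simp only; linarith⟩
    intro t₀ h1 h2 m₀
    obtain ⟨n, hn⟩ := exists_nat_ge (t₀ / (δ / 2))
    rw [div_le_iff₀ (half_pos hδ)] at hn
    exact ind n t₀ h1 h2 (by linarith) m₀
  rw [continuous_iff_continuousAt]
  rintro ⟨m₀, w₀, t₀⟩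
  rw [← continuousWithinAt_univ]
  have := ContinuousWithinAt.comp
    (f := fun P : M × GeometricRoughPath α d T × Set.Icc (0 : ℝ) T => (P.1, P.2.1, (P.2.2 : ℝ)))
    (s := Set.univ) (x := (m₀, w₀, t₀)) (main w₀ t₀ t₀.2.1 t₀.2.2 m₀)
    (by fun_prop : Continuous fun P : M × GeometricRoughPath α d T × Set.Icc (0 : ℝ) T =>
      (P.1, P.2.1, (P.2.2 : ℝ))).continuousWithinAt (fun P _ => P.2.2.2)
  refine this.congr (fun P _ => ?_) ?_ <;> exact (flow_coe _ _ _ _).symm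

end Flow

/-- A family of bijections of a compact space, jointly continuous in the point and a parameter, has
jointly continuous inverses. -/
theorem continuous_inverse_of_compactSpace {M B : Type*} [TopologicalSpace M] [CompactSpace M]
    [T2Space M] [TopologicalSpace B] {f g : M × B → M} (hf : Continuous f)
    (hfg : ∀ m b, f (g (m, b), b) = m) (hgf : ∀ m b, g (f (m, b), b) = m) : Continuous g := by
  refine continuous_iff_isClosed.2 fun C hC => ?_
  have h : g ⁻¹' C = Prod.snd '' {Q : M × M × B | Q.1 ∈ C ∧ f (Q.1, Q.2.2) = Q.2.1} := by
    ext ⟨m, b⟩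
    constructor
    · exact fun h => ⟨(g (m, b), m, b), ⟨h, hfg m b⟩, rfl⟩
    · rintro ⟨⟨m', m'', b'⟩, ⟨h1, h2⟩, h3⟩
      obtain ⟨rfl, rfl⟩ := Prod.mk.inj h3
      simp only at h1 h2
      rw [← h2, Set.mem_preimage, hgf]
      exact h1
  rw [h]
  refine isClosedMap_snd_of_compactSpace _ ((hC.preimage continuous_fst).inter (isClosed_eq ?_ ?_))
  · exact hf.comp (by fun_prop)
  · fun_prop

theorem FoliatedAtlas.foliationPreserving_of_mem_leaf {p : ℕ} {Z M : Type*} [TopologicalSpace Z]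
    [TopologicalSpace M] {𝓕 : FoliatedAtlas p Z M} {f : M → M} (h : ∀ m, f m ∈ 𝓕.leaf m) :
    𝓕.FoliationPreserving f := by
  refine fun m => ⟨m, ?_⟩
  rintro _ ⟨x, hx, rfl⟩
  exact FoliatedAtlas.mem_leaf_trans hx (h x)

theorem mainTheorem3 {p d : ℕ} {Z M : Type*}
    [TopologicalSpace Z] [LocallyCompactSpace Z] [TopologicalSpace.SeparableSpace Z]
    [TopologicalSpace.MetrizableSpace Z]
    [TopologicalSpace M] [CompactSpace M] [TopologicalSpace.MetrizableSpace M]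
    (𝓕 : FoliatedAtlas p Z M) (α T : ℝ) (hα : α ∈ Set.Ioo (1 / 3 : ℝ) (1 / 2)) (hT : 0 < T)
    (V : Fin d → LeafwiseVectorField 𝓕 3) (V₀ : LeafwiseVectorField 𝓕 3) :
    -- the maps `Φ` and `Φ̌` are well defined
    (∀ (w : GeometricRoughPath α d T) (m : M), ∃! x, IsRDESolution V V₀ w m x) ∧
    (∀ (S : Set.Icc (0 : ℝ) T) (w : GeometricRoughPath α d T) (m : M),
      ∃! x, IsRDESolution V V₀.neg (w.reverse S) m x) ∧
    -- the flow, as a continuous map `w ↦ [t ↦ Φ (·, w)_t]` into `C ([0, T], Homeo_L (M))`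
    ∃ F : GeometricRoughPath α d T → C(Set.Icc (0 : ℝ) T, LeafHomeo 𝓕), Continuous F ∧
      ∀ (w : GeometricRoughPath α d T) (S : Set.Icc (0 : ℝ) T) (m : M),
        (F w S).toHomeo m = lyonsIto V V₀ m w S ∧
        (F w S).toHomeo m ∈ 𝓕.leaf m ∧
        (F w S).toHomeo.symm m =
          lyonsIto V V₀.neg m (w.reverse S) ⟨(S : ℝ), S.2.1, le_rfl⟩ := by
  refine ⟨existsUnique_isRDESolution V V₀ hα hT.le,
    fun S w m => existsUnique_isRDESolution V V₀.neg hα S.2.1 _ m, ?_⟩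
  set f : M × GeometricRoughPath α d T × Set.Icc (0 : ℝ) T → M :=
    fun P => lyonsIto V V₀ P.1 P.2.1 P.2.2 with hf
  set g : M × GeometricRoughPath α d T × Set.Icc (0 : ℝ) T → M :=
    fun P => lyonsIto V V₀.neg P.1 (P.2.1.reverse P.2.2) ⟨(P.2.2 : ℝ), P.2.2.2.1, le_rfl⟩ with hg
  have hinv : ∀ b m, g (f (m, b), b) = m ∧ f (g (m, b), b) = m := by
    rintro ⟨w, S⟩ m
    have h := flow_reverse_flow (V := V) (V₀ := V₀) hα hT.le w S m
    have e : ∀ m' : M, flow V V₀.neg S.2.1 m' (w.reverse S) S = g (m', w, S) := fun m' =>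
      flow_coe S.2.1 m' (w.reverse S) ⟨(S : ℝ), S.2.1, le_rfl⟩
    rw [flow_coe, e, e, flow_coe] at h
    exact h
  have hfc : Continuous f := continuous_lyonsIto hα hT.le
  have hgc : Continuous g := continuous_inverse_of_compactSpace hfc (fun m b => (hinv b m).2)
    fun m b => (hinv b m).1
  have hleaf : ∀ b m, f (m, b) ∈ 𝓕.leaf m := fun b m => by
    have := flow_mem_leaf (V := V) (V₀ := V₀) hα hT.le b.1 m b.2.2.1 b.2.2.2
    rwa [flow_coe] at this
  have hleaf' : ∀ b m, g (m, b) ∈ 𝓕.leaf m := fun b m => by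
    have := hleaf b (g (m, b))
    rw [(hinv b m).2] at this
    exact FoliatedAtlas.mem_leaf_symm this
  let H : GeometricRoughPath α d T × Set.Icc (0 : ℝ) T → LeafHomeo 𝓕 := fun b =>
    { toHomeo :=
        { toFun := fun m => f (m, b)
          invFun := fun m => g (m, b)
          left_inv := fun m => (hinv b m).1
          right_inv := fun m => (hinv b m).2
          continuous_toFun := hfc.comp (by fun_prop)
          continuous_invFun := hgc.comp (by fun_prop) }
      foliationPreserving := FoliatedAtlas.foliationPreserving_of_mem_leaf (hleaf b)
      foliationPreserving_symm := FoliatedAtlas.foliationPreserving_of_mem_leaf (hleaf' b) }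
  have hH : Continuous H := by
    refine continuous_induced_rng.2 (Continuous.prodMk ?_ ?_)
    · exact ContinuousMap.continuous_of_continuous_uncurry _ (hfc.comp continuous_swap)
    · exact ContinuousMap.continuous_of_continuous_uncurry _ (hgc.comp continuous_swap)
  exact ⟨ContinuousMap.curry ⟨H, hH⟩, (ContinuousMap.curry ⟨H, hH⟩).continuous,
    fun w S m => ⟨rfl, hleaf (w, S) m, rfl⟩⟩
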